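/- Let $K$ be a field and $\ell\ge n$ natural numbers. Let $H$ be the cyclotomic nilHecke algebra of type $A$: the unital associative $K$-algebra generated by $\psi_1,\dots,\psi_{n-1},y_1,\dots,y_n$ with relations $\psi_r^2=0$; $\psi_r\psi_k=\psi_k\psi_r$ for $|r-k|>1$; $\psi_r\psi_{r+1}\psi_r=\psi_{r+1}\psi_r\psi_{r+1}$; $y_ry_k=y_ky_r$; $\psi_ry_k=y_k\psi_r$ for $k\ne r,r+1$; $\psi_ry_{r+1}=y_r\psi_r+1$; $y_{r+1}\psi_r=\psi_ry_r+1$; and $y_1^\ell=0$ (for $n=0$ there are no generators and $H=K$). It is $\mathbb Z$-graded by $\deg\psi_r=-2$, $\deg y_r=2$, and has a unique anti-automorphism $*$ fixing all generators. Modules are $\mathbb Z$-graded right $H$-modules; $M\langle s\rangle$ is the shift with $M\langle s\rangle_d=M_{d-s}$; $\dim_qM=\sum_d(\dim_KM_d)q^d$; and $[M:D]_q=\sum_d[M:D\langle d\rangle]\,q^d$, where $[M:D\langle d\rangle]$ is the multiplicity of $D\langle d\rangle$ in a graded composition series of $M$. Let $\mathscr P_0$ be the set of multipartitions $\mu=(\mu^{(1)},\dots,\mu^{(\ell)})$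 of $n$ with all $\mu^{(j)}\in\{\emptyset,(1)\}$, and let $\theta(\mu)=(k_1<\dots<k_n)$ be the positions $j$ with $\mu^{(j)}=(1)$. For $\theta(\lambda)=(k'_1,\dots,k'_n)$ write $\lambda>\mu$ if $\lambda\neq\mu$ and $k'_i\le k_i$ for all $i$. Put $y_\mu=y_1^{\ell-k_1}\cdots y_n^{\ell-k_n}$, and let $H^{>\mu}$ be the two-sided ideal generated by all $y_\lambda$ with $\lambda>\mu$. The graded Specht module $S^\mu$ is the right submodule of $H/H^{>\mu}$ generated by $y_\mu+H^{>\mu}$, graded so that this generator has degree $\ell n-\sum_ik_i$. It carries the bilinear form determined by $y_\mu a b^*y_\mu\equiv\langle y_\mu a,y_\mu b\rangle\,y_\mu\pmod{H^{>\mu}}$, and $D^\mu=S^\mu/\operatorname{rad}\langle\ ,\ \rangle$. Let $\lambda_{\min}=(\emptyset,\dots,\emptyset,(1),\dots,(1))$ (with $n$ entries $(1)$), $D_0=D^{\lambda_{\min}}$, and let $P_0$ be the graded projective cover of $D_0$. For $\lambda\in\mathscr P_0$ with $\theta(\lambda)=(k_1,\dots,k_n)$ let $\mathrm{Std}(\lambda)$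 be the set of bijections $\mathfrak t:\{k_1,\dots,k_n\}\to\{1,\dots,n\}$, and $$\deg\mathfrak t=\sum_{i=1}^n\Bigl(\#\{k_i<j\le\ell: j\notin\{k_1,\dots,k_n\}\text{ or }\mathfrak t(j)>\mathfrak t(k_i)\}-\#\{k_i<j\le\ell: j\in\{k_1,\dots,k_n\},\ \mathfrak t(j)<\mathfrak t(k_i)\}\Bigr).$$ Then $D_0$ is finite-dimensional, $P_0$ exists and is finite-dimensional, and: $$\dim_qD_0=\sum_{\mathfrak t\in\mathrm{Std}(\lambda_{\min})}q^{\deg\mathfrak t},\qquad \dim_qP_0=\sum_{1\le k_1<\dots<k_n\le\ell}\ \sum_{\mathfrak t\in\mathrm{Std}(\lambda_{\min})}q^{\deg\mathfrak t+2n\ell-n(n-1)-2\sum_ik_i}.$$ For every $\mu\in\mathscr P_0$ with $\theta(\mu)=(k_1,\dots,k_n)$, the graded decomposition number is $$d_{\mu,\lambda_{\min}}(q)=[S^\mu:D_0]_q=q^{\,n\ell-n(n-1)/2-\sum_ik_i}\in\delta_{\mu,\lambda_{\min}}+q\mathbb N[q],$$ and the graded Cartan number is $$c_{\lambda_{\min},\lambda_{\min}}(q)=[P_0:D_0]_q=\sum_{1\le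 l_1<\dots<l_n\le\ell}q^{\,2n\ell-n(n-1)-2\sum_il_i}\in1+q\mathbb N[q].$$ -/

import Mathlib

open scoped LaurentPolynomial

universe u w v v'

/-! ### Graded right modules over a graded algebra -/

section GradedModules

/-- A `ℤ`-graded right module over the `K`-algebra `A` with homogeneous components `𝒜 d`.
Right modules over `A` are modules over `Aᵐᵒᵖ`; `x · a` is `MulOpposite.op a • x`. -/
structure GrMod {K : Type u} {A : Type w} [Field K] [Ring A] [Algebra K A]
    (𝒜 : ℤ → Submodule K A) where
  carrier : Type v
  [addCommGroup : AddCommGroup carrier]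
  [moduleK : Module K carrier]
  [moduleA : Module Aᵐᵒᵖ carrier]
  [tower : IsScalarTower K Aᵐᵒᵖ carrier]
  /-- the homogeneous component of each degree -/
  comp : ℤ → Submodule K carrier
  isInternal : DirectSum.IsInternal comp
  smul_mem : ∀ (i j : ℤ) (a : A) (x : carrier), a ∈ 𝒜 i → x ∈ comp j →
    MulOpposite.op a • x ∈ comp (j + i)

namespace GrMod

attribute [instance] GrMod.addCommGroup GrMod.moduleK GrMod.moduleA GrMod.tower

variable {K : Type u} {A : Type w} [Field K] [Ring A] [Algebra K A] {𝒜 : ℤ → Submodule K A}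

theorem isInternal_of {V : Type*} [AddCommGroup V] [Module K V] (c : ℤ → Submodule K V)
    (h1 : ⨆ j, c j = ⊤)
    (h2 : ∀ (s : Finset ℤ) (x : ℤ → V), (∀ i ∈ s, x i ∈ c i) → ∑ i ∈ s, x i = 0 →
      ∀ i ∈ s, x i = 0) : DirectSum.IsInternal c := by
  refine DirectSum.isInternal_submodule_of_iSupIndep_of_iSup_eq_top ?_ h1
  rw [iSupIndep_iff_finsetSum_eq_zero_imp_eq_zero]
  intro s x hx hs i hi
  exact h2 s x hx hs i hi

/-- The `K`-linear projection onto the homogeneous component of degree `j`. -/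
noncomputable def proj (M : GrMod.{u, w, v} 𝒜) (j : ℤ) : M.carrier →ₗ[K] M.carrier :=
  letI := M.isInternal.chooseDecomposition
  (M.comp j).subtype ∘ₗ (DirectSum.component K ℤ (fun i => M.comp i) j) ∘ₗ
    (DirectSum.decomposeLinearEquiv M.comp).toLinearMap

theorem proj_mem (M : GrMod.{u, w, v} 𝒜) (j : ℤ) (x : M.carrier) : M.proj j x ∈ M.comp j := by
  simp [proj]

theorem proj_same (M : GrMod.{u, w, v} 𝒜) {j : ℤ} {x : M.carrier} (hx : x ∈ M.comp j) :
    M.proj j x = x := by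
  let _ := M.isInternal.chooseDecomposition
  exact DirectSum.decompose_of_mem_same M.comp hx

theorem proj_ne (M : GrMod.{u, w, v} 𝒜) {i j : ℤ} (h : i ≠ j) {x : M.carrier}
    (hx : x ∈ M.comp i) : M.proj j x = 0 := by
  let _ := M.isInternal.chooseDecomposition
  exact DirectSum.decompose_of_mem_ne M.comp hx h

theorem mem_iSup (M : GrMod.{u, w, v} 𝒜) (x : M.carrier) : x ∈ ⨆ j, M.comp j := by
  rw [M.isInternal.submodule_iSup_eq_top]; trivial

theorem proj_sum (M : GrMod.{u, w, v} 𝒜) (s : Finset ℤ) (x : ℤ → M.carrier)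
    (hx : ∀ i ∈ s, x i ∈ M.comp i) {j : ℤ} (hj : j ∈ s) :
    M.proj j (∑ i ∈ s, x i) = x j := by
  rw [map_sum, Finset.sum_eq_single j]
  · exact M.proj_same (hx j hj)
  · intro i hi hij
    exact M.proj_ne hij (hx i hi)
  · intro h; exact absurd hj h

theorem proj_smul (M : GrMod.{u, w, v} 𝒜) {e : ℤ} {a : A} (ha : a ∈ 𝒜 e) (j : ℤ)
    (x : M.carrier) :
    M.proj (j + e) (MulOpposite.op a • x) = MulOpposite.op a • M.proj j x := by
  induction M.mem_iSup x using Submodule.iSup_induction' with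
  | mem i x hx =>
    by_cases h : i = j
    · subst h
      rw [M.proj_same hx, M.proj_same (M.smul_mem _ _ _ _ ha hx)]
    · rw [M.proj_ne h hx, M.proj_ne (i := i + e) (by simpa using h) (M.smul_mem _ _ _ _ ha hx),
        smul_zero]
  | zero => simp
  | add x y _ _ hx hy => simp only [smul_add, map_add, hx, hy]

/-- A submodule is homogeneous if it contains the homogeneous components of its elements. -/
def IsHomogeneous (M : GrMod.{u, w, v} 𝒜) (N : Submodule Aᵐᵒᵖ M.carrier) : Prop :=
  ∀ x ∈ N, ∀ j, M.proj j x ∈ N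

/-- The poset of graded (that is, homogeneous) submodules. -/
abbrev HomSub (M : GrMod.{u, w, v} 𝒜) : Type v :=
  {N : Submodule Aᵐᵒᵖ M.carrier // M.IsHomogeneous N}

theorem isHomogeneous_span (h𝒜 : ⨆ i, 𝒜 i = ⊤) (M : GrMod.{u, w, v} 𝒜) (S : Set M.carrier)
    (hS : ∀ x ∈ S, ∀ j, M.proj j x ∈ Submodule.span Aᵐᵒᵖ S) :
    M.IsHomogeneous (Submodule.span Aᵐᵒᵖ S) := by
  intro x hx
  induction hx using Submodule.span_induction with
  | mem x hx => exact hS x hx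
  | zero => intro j; simp
  | add x y _ _ hx hy => intro j; rw [map_add]; exact Submodule.add_mem _ (hx j) (hy j)
  | smul a x _ hx =>
    intro j
    obtain ⟨a, rfl⟩ := MulOpposite.op_surjective a
    have ha : a ∈ ⨆ i, 𝒜 i := by rw [h𝒜]; trivial
    induction ha using Submodule.iSup_induction' with
    | mem i a ha =>
      have := M.proj_smul ha (j - i) x
      rw [sub_add_cancel] at this
      rw [this]
      exact Submodule.smul_mem _ _ (hx _)
    | zero => simp
    | add a b _ _ ha hb =>
      rw [MulOpposite.op_add, add_smul, map_add]
      exact Submodule.add_mem _ ha hb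

/-- A graded submodule, as a graded module. -/
noncomputable abbrev sub (M : GrMod.{u, w, v} 𝒜) (N : M.HomSub) : GrMod.{u, w, v} 𝒜 where
  carrier := N.1
  comp j := (M.comp j).comap (N.1.subtype.restrictScalars K)
  isInternal := by
    refine isInternal_of _ ?_ ?_
    · rw [eq_top_iff]
      rintro ⟨x, hxN⟩ -
      obtain ⟨f, hf⟩ := (Submodule.mem_iSup_iff_exists_finsupp _ _).1 (M.mem_iSup x)
      have hmem : ∀ j ∈ f.support, f j ∈ N.1 := by
        intro j hj
        have := N.2 x hxN j
        rwa [← hf.2, Finsupp.sum, M.proj_sum _ _ (fun i _ => hf.1 i) hj] at this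
      have : (⟨x, hxN⟩ : N.1) = ∑ j ∈ f.support.attach, ⟨f j.1, hmem j.1 j.2⟩ := by
        apply Subtype.ext
        rw [← Submodule.subtype_apply, ← Submodule.subtype_apply, map_sum]
        simp only [Submodule.subtype_apply]
        rw [← hf.2, Finsupp.sum, ← Finset.sum_attach]
      rw [this]
      refine Submodule.sum_mem _ (fun j _ => ?_)
      exact Submodule.mem_iSup_of_mem j.1 (hf.1 j.1)
    · intro s x hx h0 i hi
      apply Subtype.ext
      have h := M.proj_sum s (fun i => (x i : M.carrier)) hx hi
      rw [← h, ← Submodule.coe_sum, h0]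
      simp
  smul_mem i j a x ha hx := M.smul_mem i j a x.1 ha hx

/-- The quotient of a graded module by a graded submodule. -/
noncomputable abbrev quot (M : GrMod.{u, w, v} 𝒜) (N : M.HomSub) : GrMod.{u, w, v} 𝒜 where
  carrier := M.carrier ⧸ N.1
  comp j := (M.comp j).map (N.1.mkQ.restrictScalars K)
  isInternal := by
    refine isInternal_of _ ?_ ?_
    · rw [← Submodule.map_iSup, M.isInternal.submodule_iSup_eq_top, Submodule.map_top,
        LinearMap.range_eq_top]
      exact N.1.mkQ_surjective
    · intro s x hx h0 i hi
      choose! z hz hzx using hx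
      have h1 : ∑ i ∈ s, z i ∈ N.1 := by
        rw [← Submodule.ker_mkQ N.1, LinearMap.mem_ker, map_sum, ← h0]
        exact Finset.sum_congr rfl hzx
      have h2 := N.2 _ h1 i
      rw [M.proj_sum s z hz hi] at h2
      rw [← hzx i hi]
      exact (Submodule.Quotient.mk_eq_zero _).2 h2
  smul_mem i j a x ha hx := by
    obtain ⟨z, hz, rfl⟩ := hx
    exact ⟨MulOpposite.op a • z, M.smul_mem i j a z ha hz, rfl⟩

/-- The grading shift `M⟨s⟩`, with `M⟨s⟩_d = M_{d-s}`. -/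
abbrev shift (M : GrMod.{u, w, v} 𝒜) (s : ℤ) : GrMod.{u, w, v} 𝒜 where
  carrier := M.carrier
  comp d := M.comp (d - s)
  isInternal := by
    refine isInternal_of _ ?_ ?_
    · rw [← M.isInternal.submodule_iSup_eq_top]
      exact (Equiv.subRight s).iSup_comp (g := M.comp)
    · intro t x hx h0 i hi
      have h : M.proj (i - s) (∑ i ∈ t, x i) = x i := by
        rw [map_sum, Finset.sum_eq_single i]
        · exact M.proj_same (hx i hi)
        · intro j hj hji
          exact M.proj_ne (by simpa using hji) (hx j hj)
        · intro h; exact absurd hi h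
      rw [← h, h0, map_zero]
  smul_mem i j a x ha hx := by
    have := M.smul_mem i (j - s) a x ha hx
    rwa [show j - s + i = j + i - s by ring] at this

/-- Isomorphism of graded modules: a module isomorphism that preserves degrees. -/
def Iso (M : GrMod.{u, w, v} 𝒜) (M' : GrMod.{u, w, v'} 𝒜) : Prop :=
  ∃ e : M.carrier ≃ₗ[Aᵐᵒᵖ] M'.carrier, ∀ j x, x ∈ M.comp j ↔ e x ∈ M'.comp j

/-- The graded dimension `∑_d (dim_K M_d) q^d`. -/
noncomputable def grDim (M : GrMod.{u, w, v} 𝒜) : ℕ[T;T⁻¹] :=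
  ∑ᶠ d : ℤ, Module.finrank K (M.comp d) • (LaurentPolynomial.T d : ℕ[T;T⁻¹])

theorem isHomogeneous_comap (M : GrMod.{u, w, v} 𝒜) (N N' : M.HomSub) :
    (M.sub N').IsHomogeneous (N.1.comap N'.1.subtype) := by
  intro x hx j
  have key : ∀ y : (M.sub N').carrier,
      N'.1.subtype ((M.sub N').proj j y) = M.proj j (N'.1.subtype y) := by
    intro y
    induction (M.sub N').mem_iSup y using Submodule.iSup_induction' with
    | mem i y hy =>
      by_cases h : i = j
      · subst h
        rw [(M.sub N').proj_same hy, M.proj_same]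
        exact hy
      · rw [(M.sub N').proj_ne h hy, M.proj_ne (x := N'.1.subtype y) h hy]
        exact map_zero N'.1.subtype
    | zero => simp
    | add x y _ _ hx hy => simp only [map_add, hx, hy]
  rw [Submodule.mem_comap, key]
  exact N.2 _ hx j

/-- The graded subquotient `N' / N` (more precisely `N' / (N' ∩ N)`). -/
noncomputable def subquot (M : GrMod.{u, w, v} 𝒜) (N N' : M.HomSub) : GrMod.{u, w, v} 𝒜 :=
  (M.sub N').quot ⟨N.1.comap N'.1.subtype, M.isHomogeneous_comap N N'⟩

/-- A composition series in the category of graded modules: a chain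
`0 = N 0 < N 1 < ⋯ < N r = M` of graded submodules that cannot be refined by graded submodules
(so the factors `N (i+1) / N i` are graded simple). -/
def IsCompSeries (M : GrMod.{u, w, v} 𝒜) {r : ℕ} (N : Fin (r + 1) → M.HomSub) : Prop :=
  (N 0).1 = ⊥ ∧ (N (Fin.last r)).1 = ⊤ ∧ ∀ i : Fin r, N i.castSucc ⋖ N i.succ

/-- `∑_d m_d q^d`, where `m_d` is the number of factors of the series isomorphic to `D⟨d⟩`. -/
noncomputable def seriesMult (M : GrMod.{u, w, v} 𝒜) (D : GrMod.{u, w, v'} 𝒜) {r : ℕ}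
    (N : Fin (r + 1) → M.HomSub) : ℕ[T;T⁻¹] :=
  ∑ᶠ d : ℤ, Nat.card {i : Fin r // (M.subquot (N i.castSucc) (N i.succ)).Iso (D.shift d)} •
    (LaurentPolynomial.T d : ℕ[T;T⁻¹])

/-- `[M : D]_q = p`: the module `M` has a graded composition series, and in each of them the
graded multiplicity of `D` is `p`. -/
def HasGrMult (M : GrMod.{u, w, v} 𝒜) (D : GrMod.{u, w, v'} 𝒜) (p : ℕ[T;T⁻¹]) : Prop :=
  (∃ (r : ℕ) (N : Fin (r + 1) → M.HomSub), M.IsCompSeries N) ∧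
    ∀ (r : ℕ) (N : Fin (r + 1) → M.HomSub), M.IsCompSeries N → M.seriesMult D N = p

/-- `P` is a graded projective cover of `D`: it is projective and has a homogeneous surjection of
degree `0` onto `D` whose kernel is superfluous among graded submodules. -/
def IsProjCover (P : GrMod.{u, w, v} 𝒜) (D : GrMod.{u, w, v'} 𝒜) : Prop :=
  Module.Projective Aᵐᵒᵖ P.carrier ∧
    ∃ π : P.carrier →ₗ[Aᵐᵒᵖ] D.carrier, Function.Surjective π ∧
      (∀ j x, x ∈ P.comp j → π x ∈ D.comp j) ∧
      ∀ N : P.HomSub, N.1 ⊔ LinearMap.ker π = ⊤ → N.1 = ⊤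

end GrMod

end GradedModules

/-! ### The cyclotomic nilHecke algebra -/

section NilHecke

/-- The generators `ψ_1, …, ψ_{n-1}` and `y_1, …, y_n`, indexed from `0`. -/
inductive NilGen (n : ℕ) : Type
  | psi (r : Fin (n - 1)) : NilGen n
  | y (i : Fin n) : NilGen n

/-- The degrees of the generators. -/
def NilGen.deg {n : ℕ} : NilGen n → ℤ
  | .psi _ => -2
  | .y _ => 2

/-- A generator in the free algebra. -/
def freeGen (K : Type u) [Field K] {n : ℕ} (g : NilGen n) : FreeAlgebra K (NilGen n) :=
  FreeAlgebra.ι K g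

open NilGen in
/-- The nilHecke relations, and `y_1 ^ ℓ = 0`. -/
inductive NilRel (K : Type u) [Field K] (ℓ n : ℕ) :
    FreeAlgebra K (NilGen n) → FreeAlgebra K (NilGen n) → Prop
  | psi_sq (r : Fin (n - 1)) : NilRel K ℓ n (freeGen K (psi r) * freeGen K (psi r)) 0
  | psi_comm (r k : Fin (n - 1)) (h : k.val + 1 < r.val) :
      NilRel K ℓ n (freeGen K (psi r) * freeGen K (psi k))
        (freeGen K (psi k) * freeGen K (psi r))
  | braid (r s : Fin (n - 1)) (h : s.val = r.val + 1) :
      NilRel K ℓ n (freeGen K (psi r) * freeGen K (psi s) * freeGen K (psi r))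
        (freeGen K (psi s) * freeGen K (psi r) * freeGen K (psi s))
  | y_comm (i k : Fin n) :
      NilRel K ℓ n (freeGen K (y i) * freeGen K (y k)) (freeGen K (y k) * freeGen K (y i))
  | psi_y_comm (r : Fin (n - 1)) (k : Fin n) (h : k.val ≠ r.val) (h' : k.val ≠ r.val + 1) :
      NilRel K ℓ n (freeGen K (psi r) * freeGen K (y k)) (freeGen K (y k) * freeGen K (psi r))
  | psi_y (r : Fin (n - 1)) (i j : Fin n) (hi : i.val = r.val) (hj : j.val = r.val + 1) :
      NilRel K ℓ n (freeGen K (psi r) * freeGen K (y j))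
        (freeGen K (y i) * freeGen K (psi r) + 1)
  | y_psi (r : Fin (n - 1)) (i j : Fin n) (hi : i.val = r.val) (hj : j.val = r.val + 1) :
      NilRel K ℓ n (freeGen K (y j) * freeGen K (psi r))
        (freeGen K (psi r) * freeGen K (y i) + 1)
  | cyc (i : Fin n) (h : i.val = 0) : NilRel K ℓ n (freeGen K (y i) ^ ℓ) 0

/-- The cyclotomic nilHecke algebra of type `A`. -/
abbrev CycNilHecke (K : Type u) [Field K] (ℓ n : ℕ) : Type u := RingQuot (NilRel K ℓ n)

namespace CycNilHecke

variable (K : Type u) [Field K] (ℓ n : ℕ)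

/-- A generator in the cyclotomic nilHecke algebra. -/
noncomputable def gen (g : NilGen n) : CycNilHecke K ℓ n :=
  RingQuot.mkAlgHom K (NilRel K ℓ n) (freeGen K g)

/-- The homogeneous component of degree `d`: the span of the words of degree `d` in the
generators. -/
def grading (d : ℤ) : Submodule K (CycNilHecke K ℓ n) :=
  Submodule.span K {x | ∃ l : List (NilGen n), (l.map NilGen.deg).sum = d ∧
    (l.map (gen K ℓ n)).prod = x}

theorem word_mem (l : List (NilGen n)) :
    (l.map (gen K ℓ n)).prod ∈ grading K ℓ n (l.map NilGen.deg).sum :=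
  Submodule.subset_span ⟨l, rfl, rfl⟩

theorem one_mem : (1 : CycNilHecke K ℓ n) ∈ grading K ℓ n 0 := by
  simpa using word_mem K ℓ n []

theorem gen_mem (g : NilGen n) : gen K ℓ n g ∈ grading K ℓ n g.deg := by
  simpa using word_mem K ℓ n [g]

theorem mul_mem {i j : ℤ} {a b : CycNilHecke K ℓ n} (ha : a ∈ grading K ℓ n i)
    (hb : b ∈ grading K ℓ n j) : a * b ∈ grading K ℓ n (i + j) := by
  have h : grading K ℓ n i * grading K ℓ n j ≤ grading K ℓ n (i + j) := by
    unfold grading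
    rw [Submodule.span_mul_span, Submodule.span_le]
    rintro _ ⟨_, ⟨l, rfl, rfl⟩, _, ⟨l', rfl, rfl⟩, rfl⟩
    exact Submodule.subset_span ⟨l ++ l', by simp, by simp⟩
  exact h (Submodule.mul_mem_mul ha hb)

theorem pow_mem {i : ℤ} {a : CycNilHecke K ℓ n} (ha : a ∈ grading K ℓ n i) (k : ℕ) :
    a ^ k ∈ grading K ℓ n (k * i) := by
  induction k with
  | zero => simpa using one_mem K ℓ n
  | succ k ih =>
    rw [pow_succ, show ((k + 1 : ℕ) : ℤ) * i = k * i + i by push_cast; ring]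
    exact mul_mem K ℓ n ih ha

theorem rel_eq {a b : FreeAlgebra K (NilGen n)} (h : NilRel K ℓ n a b) :
    RingQuot.mkAlgHom K (NilRel K ℓ n) a = RingQuot.mkAlgHom K (NilRel K ℓ n) b :=
  RingQuot.mkAlgHom_rel K h

/-- Two algebra homomorphisms that agree on the generators are equal. -/
theorem hom_ext {B : Type*} [Semiring B] [Algebra K B] {f g : CycNilHecke K ℓ n →ₐ[K] B}
    (h : ∀ x, f (gen K ℓ n x) = g (gen K ℓ n x)) : f = g := by
  apply RingQuot.ringQuot_ext'
  apply FreeAlgebra.hom_ext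
  funext x
  exact h x

theorem iSup_grading : ⨆ d, grading K ℓ n d = ⊤ := by
  rw [eq_top_iff]
  rintro x -
  obtain ⟨x, rfl⟩ := RingQuot.mkAlgHom_surjective K (NilRel K ℓ n) x
  induction x using FreeAlgebra.induction with
  | grade0 r =>
    rw [AlgHom.commutes, Algebra.algebraMap_eq_smul_one]
    exact Submodule.mem_iSup_of_mem 0 (Submodule.smul_mem _ _ (one_mem K ℓ n))
  | grade1 g => exact Submodule.mem_iSup_of_mem g.deg (gen_mem K ℓ n g)
  | mul a b ha hb =>
    rw [map_mul]
    generalize RingQuot.mkAlgHom K (NilRel K ℓ n) a = a at ha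
    generalize RingQuot.mkAlgHom K (NilRel K ℓ n) b = b at hb
    induction ha using Submodule.iSup_induction' with
    | mem i a ha =>
      induction hb using Submodule.iSup_induction' with
      | mem j b hb => exact Submodule.mem_iSup_of_mem (i + j) (mul_mem K ℓ n ha hb)
      | zero => simp
      | add b b' _ _ hb hb' => rw [mul_add]; exact Submodule.add_mem _ hb hb'
    | zero => simp
    | add a a' _ _ ha ha' => rw [add_mul]; exact Submodule.add_mem _ ha ha'
  | add a b ha hb => rw [map_add]; exact Submodule.add_mem _ ha hb

/-- The homomorphism `a ↦ a q^d` (for `a` of degree `d`) that detects the grading. -/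
noncomputable def gradeHom : CycNilHecke K ℓ n →ₐ[K] AddMonoidAlgebra (CycNilHecke K ℓ n) ℤ :=
  RingQuot.liftAlgHom K ⟨FreeAlgebra.lift K
    (fun g => AddMonoidAlgebra.single g.deg (gen K ℓ n g)), by
      intro a b h
      have h' := rel_eq K ℓ n h
      cases h <;>
        simp only [map_mul, map_add, map_one, map_zero, map_pow, freeGen,
          FreeAlgebra.lift_ι_apply, AddMonoidAlgebra.single_mul_single,
          AddMonoidAlgebra.single_pow, NilGen.deg] at h' ⊢ <;>
        simp only [gen, freeGen, h', AddMonoidAlgebra.single_zero, AddMonoidAlgebra.single_add,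
          AddMonoidAlgebra.one_def] <;> norm_num⟩

theorem gradeHom_gen (g : NilGen n) :
    gradeHom K ℓ n (gen K ℓ n g) = AddMonoidAlgebra.single g.deg (gen K ℓ n g) := by
  unfold gradeHom
  conv_lhs => rw [gen, freeGen, RingQuot.liftAlgHom_mkAlgHom_apply, FreeAlgebra.lift_ι_apply]

theorem gradeHom_of_mem {d : ℤ} {x : CycNilHecke K ℓ n} (hx : x ∈ grading K ℓ n d) :
    gradeHom K ℓ n x = AddMonoidAlgebra.single d x := by
  induction hx using Submodule.span_induction with
  | mem x hx =>
    obtain ⟨l, rfl, rfl⟩ := hx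
    induction l with
    | nil => exact map_one _
    | cons g l ih =>
      rw [List.map_cons, List.prod_cons, map_mul, ih, gradeHom_gen,
        AddMonoidAlgebra.single_mul_single, List.map_cons, List.sum_cons]
  | zero => simp
  | add x y _ _ hx hy => simp [hx, hy, AddMonoidAlgebra.single_add]
  | smul c x _ hx => rw [map_smul, hx, AddMonoidAlgebra.smul_single]

/-- The regular graded right module. -/
noncomputable abbrev regular : GrMod.{u, u, u} (grading K ℓ n) where
  carrier := CycNilHecke K ℓ n
  comp := grading K ℓ n
  isInternal := by
    refine GrMod.isInternal_of _ (iSup_grading K ℓ n) ?_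
    intro s x hx h0 i hi
    have h := congrArg (gradeHom K ℓ n) h0
    rw [map_sum, map_zero, Finset.sum_congr rfl
      (fun j hj => gradeHom_of_mem K ℓ n (hx j hj))] at h
    have h2 := congrArg (fun f : AddMonoidAlgebra (CycNilHecke K ℓ n) ℤ => f.coeff i) h
    simp only [AddMonoidAlgebra.coeff_sum, AddMonoidAlgebra.coeff_single,
      Finsupp.finsetSum_apply, Finsupp.single_apply, Finset.sum_ite_eq', hi, if_true] at h2
    exact h2
  smul_mem i j a x ha hx := mul_mem K ℓ n hx ha

/-- The anti-automorphism `*` fixing the generators, as a homomorphism to the opposite algebra. -/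
noncomputable def starHom : CycNilHecke K ℓ n →ₐ[K] (CycNilHecke K ℓ n)ᵐᵒᵖ :=
  RingQuot.liftAlgHom K ⟨FreeAlgebra.lift K (fun g => MulOpposite.op (gen K ℓ n g)), by
      intro a b h
      simp only [gen]
      cases h with
      | psi_sq r => simpa [freeGen, ← MulOpposite.op_mul] using rel_eq K ℓ n (.psi_sq r)
      | psi_comm r k h =>
        simpa [freeGen, ← MulOpposite.op_mul] using (rel_eq K ℓ n (.psi_comm r k h)).symm
      | braid r s h =>
        simpa [freeGen, ← MulOpposite.op_mul, mul_assoc] using rel_eq K ℓ n (.braid r s h)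
      | y_comm i k => simpa [freeGen, ← MulOpposite.op_mul] using rel_eq K ℓ n (.y_comm k i)
      | psi_y_comm r k h h' =>
        simpa [freeGen, ← MulOpposite.op_mul] using (rel_eq K ℓ n (.psi_y_comm r k h h')).symm
      | psi_y r i j hi hj =>
        have := rel_eq K ℓ n (.y_psi r i j hi hj)
        rw [← MulOpposite.op_inj] at this
        simpa [freeGen] using this
      | y_psi r i j hi hj =>
        have := rel_eq K ℓ n (.psi_y r i j hi hj)
        rw [← MulOpposite.op_inj] at this
        simpa [freeGen] using this
      | cyc i h => simpa [freeGen, ← MulOpposite.op_pow] using rel_eq K ℓ n (.cyc i h)⟩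

/-- The anti-automorphism `*` of the cyclotomic nilHecke algebra fixing the generators. -/
noncomputable def invol (x : CycNilHecke K ℓ n) : CycNilHecke K ℓ n :=
  MulOpposite.unop (starHom K ℓ n x)

theorem invol_gen (g : NilGen n) : invol K ℓ n (gen K ℓ n g) = gen K ℓ n g := by
  unfold invol starHom
  conv_lhs => rw [gen, freeGen, RingQuot.liftAlgHom_mkAlgHom_apply, FreeAlgebra.lift_ι_apply]
  rfl

theorem invol_mul (a b : CycNilHecke K ℓ n) :
    invol K ℓ n (a * b) = invol K ℓ n b * invol K ℓ n a := by
  simp [invol]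

theorem invol_invol (x : CycNilHecke K ℓ n) : invol K ℓ n (invol K ℓ n x) = x := by
  have h : ((AlgEquiv.opOp K (CycNilHecke K ℓ n)).symm.toAlgHom.comp
      ((AlgHom.op (starHom K ℓ n)).comp (starHom K ℓ n))) = AlgHom.id K _ := by
    apply hom_ext
    intro g
    have h : starHom K ℓ n (gen K ℓ n g) = MulOpposite.op (gen K ℓ n g) :=
      MulOpposite.unop_injective (invol_gen K ℓ n g)
    simp [h]
  exact congrArg (fun f => f x) h

end CycNilHecke

/-! ### Multipartitions, tableaux, Specht modules -/

/-- The `ℓ`-multipartitions of `n` with all components `∅` or `(1)`, through the strictly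
increasing sequence `k_1 < ⋯ < k_n` of the positions of the components `(1)`. Positions are
indexed from `0`, so that `k_i` is `(μ i : ℕ) + 1`. -/
abbrev MultiPart (ℓ n : ℕ) : Type := Fin n ↪o Fin ℓ

namespace MultiPart

variable {ℓ n : ℕ}

noncomputable instance : Fintype (MultiPart ℓ n) := Fintype.ofFinite _

/-- The sum `k_1 + ⋯ + k_n`. -/
def sumK (μ : MultiPart ℓ n) : ℤ := ∑ i, (((μ i : ℕ) : ℤ) + 1)

/-- The dominance order: `lam > μ`. -/
def Dominates (lam μ : MultiPart ℓ n) : Prop := (∀ i, lam i ≤ μ i) ∧ lam ≠ μ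

/-- The multipartition `(∅, …, ∅, (1), …, (1))`. -/
def minimal (ℓ n : ℕ) (h : n ≤ ℓ) : MultiPart ℓ n :=
  OrderEmbedding.ofStrictMono (fun i => ⟨ℓ - n + i.val, by omega⟩)
    (fun _ _ hij => Nat.add_lt_add_left hij _)

/-- A tableau: a bijection `{k_1, …, k_n} → {1, …, n}`. -/
abbrev Tableau (μ : MultiPart ℓ n) : Type := Set.range μ ≃ Fin n

noncomputable instance (μ : MultiPart ℓ n) : Fintype (Tableau μ) := Fintype.ofFinite _

open Classical in
/-- The degree of a tableau. -/
noncomputable def tabDeg (μ : MultiPart ℓ n) (t : Tableau μ) : ℤ :=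
  ∑ i : Fin n,
    (((Finset.univ.filter (fun j : Fin ℓ => μ i < j ∧ (j ∉ Set.range μ ∨
        ∃ h : j ∈ Set.range μ, t ⟨μ i, Set.mem_range_self i⟩ < t ⟨j, h⟩))).card : ℤ) -
      ((Finset.univ.filter (fun j : Fin ℓ => μ i < j ∧
        ∃ h : j ∈ Set.range μ, t ⟨j, h⟩ < t ⟨μ i, Set.mem_range_self i⟩)).card : ℤ))

end MultiPart

namespace CycNilHecke

variable (K : Type u) [Field K] {ℓ n : ℕ}

/-- The element `y_μ = y_1^{ℓ-k_1} ⋯ y_n^{ℓ-k_n}`. -/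
noncomputable def yElt (μ : MultiPart ℓ n) : CycNilHecke K ℓ n :=
  (List.ofFn (fun i : Fin n => gen K ℓ n (NilGen.y i) ^ (ℓ - ((μ i : ℕ) + 1)))).prod

theorem exists_yElt_mem (μ : MultiPart ℓ n) : ∃ d, yElt K μ ∈ grading K ℓ n d := by
  have h : ∀ L : List (CycNilHecke K ℓ n), (∀ a ∈ L, ∃ d, a ∈ grading K ℓ n d) →
      ∃ d, L.prod ∈ grading K ℓ n d := by
    intro L
    induction L with
    | nil => intro _; exact ⟨0, by simpa using one_mem K ℓ n⟩
    | cons a L ih =>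
      intro hL
      obtain ⟨d, hd⟩ := hL a (by simp)
      obtain ⟨e, he⟩ := ih (fun b hb => hL b (by simp [hb]))
      exact ⟨d + e, by simpa using mul_mem K ℓ n hd he⟩
  apply h
  intro a ha
  obtain ⟨i, rfl⟩ := (List.mem_ofFn' _ _).1 ha
  exact ⟨_, pow_mem K ℓ n (gen_mem K ℓ n _) _⟩

/-- The two-sided ideal `H^{>μ}` generated by the `y_lam` with `lam > μ`, as a graded right
submodule of `H`. -/
noncomputable def cellIdeal (μ : MultiPart ℓ n) : (regular K ℓ n).HomSub :=
  ⟨Submodule.span (CycNilHecke K ℓ n)ᵐᵒᵖ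
    {x : CycNilHecke K ℓ n | ∃ (lam : MultiPart ℓ n) (a : CycNilHecke K ℓ n),
      lam.Dominates μ ∧ x = a * yElt K lam}, by
    apply GrMod.isHomogeneous_span (iSup_grading K ℓ n)
    rintro _ ⟨lam, a, hl, rfl⟩ j
    obtain ⟨d, hd⟩ := exists_yElt_mem K lam
    have ha : a ∈ ⨆ i, grading K ℓ n i := by rw [iSup_grading]; trivial
    induction ha using Submodule.iSup_induction' with
    | mem i a ha =>
      by_cases h : i + d = j
      · subst h
        rw [GrMod.proj_same _ (mul_mem K ℓ n ha hd)]
        exact Submodule.subset_span ⟨lam, a, hl, rfl⟩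
      · rw [GrMod.proj_ne _ h (mul_mem K ℓ n ha hd)]
        exact Submodule.zero_mem _
    | zero => rw [zero_mul, map_zero]; exact Submodule.zero_mem _
    | add a b _ _ ha hb => rw [add_mul, map_add]; exact Submodule.add_mem _ ha hb⟩

/-- The coset `y_μ + H^{>μ}` in the graded right module `H / H^{>μ}`. -/
noncomputable def yBar (μ : MultiPart ℓ n) : ((regular K ℓ n).quot (cellIdeal K μ)).carrier :=
  Submodule.Quotient.mk (p := (cellIdeal K μ).1) (yElt K μ)

/-- The graded submodule `y_μ H` of `H / H^{>μ}`. -/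
noncomputable def spechtSub (μ : MultiPart ℓ n) :
    ((regular K ℓ n).quot (cellIdeal K μ)).HomSub :=
  ⟨Submodule.span (CycNilHecke K ℓ n)ᵐᵒᵖ {yBar K μ}, by
    apply GrMod.isHomogeneous_span (iSup_grading K ℓ n)
    rintro _ rfl j
    obtain ⟨d, hd⟩ := exists_yElt_mem K μ
    have hd' : yBar K μ ∈ ((regular K ℓ n).quot (cellIdeal K μ)).comp d := ⟨_, hd, rfl⟩
    by_cases h : d = j
    · subst h
      rw [GrMod.proj_same _ hd']
      exact Submodule.subset_span rfl
    · rw [GrMod.proj_ne _ h hd']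
      exact Submodule.zero_mem _⟩

/-- The graded Specht module `S^μ`: the right module `y_μ H` inside `H / H^{>μ}`, with the grading
shifted so that the generator `y_μ + H^{>μ}`, of degree `2 (ℓ n - ∑ k_i)` in `H / H^{>μ}`, has in
`S^μ` the degree `ℓ n - ∑ k_i` of the initial tableau. -/
noncomputable def specht (μ : MultiPart ℓ n) : GrMod.{u, u, u} (grading K ℓ n) :=
  (((regular K ℓ n).quot (cellIdeal K μ)).sub (spechtSub K μ)).shift
    (-((ℓ : ℤ) * n - μ.sumK))

/-- The generator of the Specht module. -/
noncomputable def spechtGen (μ : MultiPart ℓ n) : (specht K μ).carrier :=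
  (⟨yBar K μ, Submodule.subset_span rfl⟩ : (spechtSub K μ).1)

/-- `CellForm K μ x b c` says that the cellular bilinear form of `S^μ`
takes the value `c` at `x` and `y_μ b`: in `S^μ` one has `x b^* y_μ = c y_μ`. -/
def CellForm (μ : MultiPart ℓ n) (x : (specht K μ).carrier) (b : CycNilHecke K ℓ n) (c : K) :
    Prop :=
  MulOpposite.op (invol K ℓ n b * yElt K μ) • x = c • spechtGen K μ

theorem isHomogeneous_rad (μ : MultiPart ℓ n) (x : (specht K μ).carrier)
    (hx : ∀ b, CellForm K μ x b 0) (j : ℤ) (b : CycNilHecke K ℓ n) :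
    CellForm K μ ((specht K μ).proj j x) b 0 := by
  have hx' : ∀ c : CycNilHecke K ℓ n, MulOpposite.op (c * yElt K μ) • x = 0 := by
    intro c
    have := hx (invol K ℓ n c)
    rwa [CellForm, invol_invol, zero_smul] at this
  unfold CellForm
  rw [zero_smul]
  generalize invol K ℓ n b = c
  obtain ⟨d, hd⟩ := exists_yElt_mem K μ
  have hc : c ∈ ⨆ i, grading K ℓ n i := by rw [iSup_grading]; trivial
  induction hc using Submodule.iSup_induction' with
  | mem i c hc => rw [← GrMod.proj_smul _ (mul_mem K ℓ n hc hd), hx', map_zero]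
  | zero => simp
  | add a b _ _ ha hb => rw [add_mul, MulOpposite.op_add, add_smul, ha, hb, add_zero]

/-- The radical of the cellular bilinear form of `S^μ`. -/
noncomputable def spechtRad (μ : MultiPart ℓ n) : (specht K μ).HomSub :=
  ⟨{ carrier := {x | ∀ b, CellForm K μ x b 0}
     zero_mem' := by intro b; simp [CellForm]
     add_mem' := by
      intro x y hx hy b
      have h1 := hx b
      have h2 := hy b
      simp only [CellForm, zero_smul] at h1 h2 ⊢
      rw [smul_add, h1, h2, add_zero]
     smul_mem' := by
      intro a x hx b
      obtain ⟨a, rfl⟩ := MulOpposite.op_surjective a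
      have h1 := hx (b * invol K ℓ n a)
      simp only [CellForm, zero_smul, invol_mul, invol_invol] at h1 ⊢
      rw [smul_smul, ← MulOpposite.op_mul, ← mul_assoc]
      exact h1 },
   fun x hx j b => isHomogeneous_rad K μ x hx j b⟩

/-- The graded module `D^μ = S^μ / rad`. -/
noncomputable def simpleMod (μ : MultiPart ℓ n) : GrMod.{u, u, u} (grading K ℓ n) :=
  (specht K μ).quot (spechtRad K μ)

/-- The graded simple module `D_0 = D^{λ_min}`. -/
noncomputable def D₀ (ℓ n : ℕ) (h : n ≤ ℓ) : GrMod.{u, u, u} (grading K ℓ n) :=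
  simpleMod K (MultiPart.minimal ℓ n h)

end CycNilHecke

end NilHecke

/-! ### Graded modules over an algebra with a full idempotent whose corner is connected -/

section Corner

open scoped RightActions

/-! The cyclotomic nilHecke algebra `H` has a full idempotent `e` of degree 0 whose corner `e H e`
is graded connected: zero in negative degrees and `K e` in degree 0. Hence, up to isomorphism and
shift, there is a single graded simple module. Moreover, for finite-dimensional `M`, passing a
composition factor raises the dimension of the corner `M e` by one, in one degree. Graded
multiplicities are therefore graded dimensions of `M e` (`GrMod.hasGrMult`), and a graded projective
cover of the simple module is a shift of `e H` (`GrMod.exists_isProjCover`,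
`GrMod.IsProjCover.exists_vector`).

The idempotent comes from the product `ψ` of the `ψ_r` along a reduced word of the longest
permutation (`longest`). It is killed by every `ψ_r` on both sides, so `ψ H = ψ K[y]` and `H ψ =
K[y] ψ`. An identity `1 = ∑ d_a ψ y^a`, with `a` running over the `n!` staircase exponents
(`StairIdx.sum_dual_mul_longElt`), gives `ψ d_0 ψ = ψ` by degrees, and `e = d_0 ψ` follows. Up to a
nonzero scalar `d_0` is `y_μ` for `μ = λ_min` (`exists_dualMon_zero_eq`).

Each `y_j` carries `y_μ` into the cell ideal (`yElt_mul_yN_mem`). Consequently the elements `e y_μ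
ψ` span `e H ψ`, and the elements `e y_μ ψ y^a` span `e H`. They are independent because their
number `C(ℓ,n) n!` equals the dimension of a quotient of the algebra of polynomials in the `y_i`
(`linearIndependent_zMon`). The quotient is the algebra obtained by splitting `n` linear factors off
`X ^ ℓ`. The polynomial representation by divided differences shows that no relation in `H` is lost
in it (`exists_quotient_of_pol`).

Independence modulo the cell ideal then shows that `S^μ e` is the line through `y_μ ψ`. So every
Specht module with `n ≤ ℓ` is already graded simple, and all of them are shifts of `D_0`; the form
on the minimal one is nonzero, whence `D_0 = S^{λ_min}` with basis `y_μ ψ y^a`. The stated exponents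
are the degrees of these basis vectors. Sums over tableaux become sums over staircase exponents
through the Lehmer code of a permutation. -/

/-- A full idempotent `e` of degree `0` in a graded algebra, with corner `e A e` that vanishes in
negative degrees and is spanned by `e` in degree `0`; fullness is witnessed by the elements
`left a` and `right a`. -/
structure CornerData {K : Type u} {A : Type w} [Field K] [Ring A] [Algebra K A]
    (𝒜 : ℤ → Submodule K A) (ι : Type*) [Fintype ι] where
  e : A
  left : ι → A
  right : ι → A
  iSup_eq : ⨆ i, 𝒜 i = ⊤
  mul_mem : ∀ {i j : ℤ} {a b : A}, a ∈ 𝒜 i → b ∈ 𝒜 j → a * b ∈ 𝒜 (i + j)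
  e_mem : e ∈ 𝒜 0
  idem : e * e = e
  corner_zero : ∀ x ∈ 𝒜 0, ∃ c : K, e * x * e = c • e
  corner_neg : ∀ i < 0, ∀ x ∈ 𝒜 i, e * x * e = 0
  one_eq : ∑ a, left a * e * right a = 1

namespace GrMod

variable {K : Type u} {A : Type w} [Field K] [Ring A] [Algebra K A] {𝒜 : ℤ → Submodule K A}

theorem ract_mul (M : GrMod.{u, w, v} 𝒜) (x : M.carrier) (a b : A) :
    x <• (a * b) = (x <• a) <• b := by
  rw [MulOpposite.op_mul, mul_smul]

theorem ract_add (M : GrMod.{u, w, v} 𝒜) (x : M.carrier) (a b : A) :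
    x <• (a + b) = x <• a + x <• b := by
  rw [MulOpposite.op_add, add_smul]

theorem ract_smul (M : GrMod.{u, w, v} 𝒜) (x : M.carrier) (c : K) (a : A) :
    x <• (c • a) = c • (x <• a) := by
  rw [MulOpposite.op_smul, smul_assoc]

theorem smul_ract (M : GrMod.{u, w, v} 𝒜) (x : M.carrier) (c : K) (a : A) :
    (c • x) <• a = c • (x <• a) := by
  rw [← ract_smul]
  conv_lhs => rw [← one_smul Aᵐᵒᵖ x, ← MulOpposite.op_one, ← ract_smul, ← ract_mul, smul_mul_assoc,
    one_mul]

/-- Scalars of `K` act through the algebra, `c • x = x · (c 1)`, so linearity over the algebra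
already implies linearity over `K`. -/
theorem map_smul_base {M : GrMod.{u, w, v} 𝒜} {M' : GrMod.{u, w, v'} 𝒜}
    (f : M.carrier →ₗ[Aᵐᵒᵖ] M'.carrier) (c : K) (x : M.carrier) : f (c • x) = c • f x := by
  have h1 : c • x = x <• (c • (1 : A)) := by rw [ract_smul, MulOpposite.op_one, one_smul]
  rw [h1, map_smul, ract_smul, MulOpposite.op_one, one_smul]

theorem ract_sub_smul (M : GrMod.{u, w, v} 𝒜) (x : M.carrier) (a b : A) (c : K) :
    x <• (a - c • b) = x <• a - c • (x <• b) := by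
  rw [MulOpposite.op_sub, sub_smul, ract_smul]

/-- The orbit map `a ↦ x · a`. -/
def orbit (M : GrMod.{u, w, v} 𝒜) (x : M.carrier) : A →ₗ[K] M.carrier where
  toFun a := x <• a
  map_add' := M.ract_add x
  map_smul' c a := M.ract_smul x c a

@[simp] theorem orbit_apply (M : GrMod.{u, w, v} 𝒜) (x : M.carrier) (a : A) :
    M.orbit x a = x <• a := rfl

/-- The action `x ↦ x · a` of an element of the algebra. -/
def actR (M : GrMod.{u, w, v} 𝒜) (a : A) : M.carrier →ₗ[K] M.carrier where
  toFun x := x <• a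
  map_add' := smul_add _
  map_smul' c x := M.smul_ract x c a

@[simp] theorem actR_apply (M : GrMod.{u, w, v} 𝒜) (x : M.carrier) (a : A) :
    M.actR a x = x <• a := rfl

theorem exists_sum (M : GrMod.{u, w, v} 𝒜) (x : M.carrier) :
    ∃ s : Finset ℤ, ∑ j ∈ s, M.proj j x = x ∧ ∀ j, j ∉ s → M.proj j x = 0 := by
  obtain ⟨f, hf⟩ := (Submodule.mem_iSup_iff_exists_finsupp _ _).1 (M.mem_iSup x)
  have hp : ∀ j ∈ f.support, M.proj j x = f j := by
    intro j hj
    rw [← hf.2, Finsupp.sum, M.proj_sum _ _ (fun i _ => hf.1 i) hj]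
  refine ⟨f.support, ?_, fun j hj => ?_⟩
  · rw [Finset.sum_congr rfl hp]; exact hf.2
  · rw [← hf.2, Finsupp.sum, map_sum]
    refine Finset.sum_eq_zero fun i hi => M.proj_ne ?_ (hf.1 i)
    rintro rfl
    exact hj hi

theorem mem_of_proj_mem (M : GrMod.{u, w, v} 𝒜) {N : Submodule K M.carrier} {x : M.carrier}
    (h : ∀ j, M.proj j x ∈ N) : x ∈ N := by
  obtain ⟨s, hs, -⟩ := M.exists_sum x
  rw [← hs]
  exact Submodule.sum_mem _ fun j _ => h j

theorem proj_eq_zero_of_mem_iSup (M : GrMod.{u, w, v} 𝒜) {S : Set ℤ} {j : ℤ} (hj : j ∉ S)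
    {x : M.carrier} (hx : x ∈ ⨆ i : S, M.comp i) : M.proj j x = 0 := by
  induction hx using Submodule.iSup_induction' with
  | mem i x hx => exact M.proj_ne (i := i) (fun h : (i : ℤ) = j => hj (h ▸ i.2)) hx
  | zero => simp
  | add x y _ _ hx hy => rw [map_add, hx, hy, add_zero]

/-- The part of degree `j` of `N e`. -/
def corner (M : GrMod.{u, w, v} 𝒜) (e : A) (N : Submodule Aᵐᵒᵖ M.carrier) (j : ℤ) :
    Submodule K M.carrier :=
  N.restrictScalars K ⊓ M.comp j ⊓ LinearMap.eqLocus (M.actR e) LinearMap.id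

theorem mem_corner (M : GrMod.{u, w, v} 𝒜) (e : A) (N : Submodule Aᵐᵒᵖ M.carrier) (j : ℤ)
    (x : M.carrier) : x ∈ M.corner e N j ↔ x ∈ N ∧ x ∈ M.comp j ∧ x <• e = x := by
  simp [corner, and_assoc]

variable {ι : Type*} [Fintype ι]

/-- The graded module `M` is simple, with `M e` spanned by a vector of degree `d`. -/
def IsType (M : GrMod.{u, w, v} 𝒜) (e : A) (d : ℤ) : Prop :=
  ∃ x ∈ M.comp d, x ≠ 0 ∧ x <• e = x ∧ ∀ y : M.carrier, ∃ c : K, y <• e = c • x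

theorem sum_ract (M : GrMod.{u, w, v} 𝒜) (h : CornerData 𝒜 ι) (x : M.carrier) :
    ∑ a, ((x <• h.left a) <• h.e) <• h.right a = x := by
  have := map_sum (M.orbit x) (fun a => h.left a * h.e * h.right a) Finset.univ
  rw [h.one_eq, orbit_apply, MulOpposite.op_one, one_smul] at this
  simp only [orbit_apply, ract_mul] at this
  exact this.symm

/-- Expanding `y = y · 1` by fullness of `e` writes it through the vectors `y · left a · e`, each of
which lies on the line `K x`. -/
theorem span_right_eq_top (M : GrMod.{u, w, v} 𝒜) (h : CornerData 𝒜 ι) {x : M.carrier}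
    (hx : ∀ y : M.carrier, ∃ c : K, y <• h.e = c • x) :
    Submodule.span K (Set.range fun a => x <• h.right a) = ⊤ := by
  rw [eq_top_iff]
  rintro y -
  rw [← M.sum_ract h y]
  refine Submodule.sum_mem _ fun a _ => ?_
  obtain ⟨c, hc⟩ := hx (y <• h.left a)
  rw [hc, smul_ract]
  exact Submodule.smul_mem _ _ (Submodule.subset_span ⟨a, rfl⟩)

theorem exists_ract_eq (M : GrMod.{u, w, v} 𝒜) (h : CornerData 𝒜 ι) {x : M.carrier}
    (hx : ∀ y : M.carrier, ∃ c : K, y <• h.e = c • x) (y : M.carrier) : ∃ a : A, x <• a = y := by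
  have hy : y ∈ Submodule.span K (Set.range fun a => x <• h.right a) := by
    rw [M.span_right_eq_top h hx]; trivial
  have : Submodule.span K (Set.range fun a => x <• h.right a) ≤ LinearMap.range (M.orbit x) := by
    rw [Submodule.span_le]
    rintro _ ⟨a, rfl⟩
    exact ⟨h.right a, rfl⟩
  exact this hy

/-- Fullness of `e`: a submodule containing all `x a e` contains `x`. Non-membership can thus be
tested inside the corner. -/
theorem exists_ract_e_notMem (M : GrMod.{u, w, v} 𝒜) (h : CornerData 𝒜 ι)
    {N : Submodule Aᵐᵒᵖ M.carrier} {x : M.carrier} (hx : x ∉ N) :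
    ∃ a : A, (x <• a) <• h.e ∉ N := by
  by_contra! hc
  apply hx
  rw [← M.sum_ract h x]
  exact Submodule.sum_mem _ fun a _ => Submodule.smul_mem _ _ (hc _)

/-- Any nonzero submodule meets the line `M e = K x` by fullness, and `x` generates. The submodule
need not be homogeneous, which makes the module simple even without its grading. -/
theorem IsType.eq_top_of_ne_bot {M : GrMod.{u, w, v} 𝒜} {h : CornerData 𝒜 ι} {d : ℤ}
    (hM : M.IsType h.e d) {N : Submodule Aᵐᵒᵖ M.carrier} (hN : N ≠ ⊥) : N = ⊤ := by
  obtain ⟨x, -, -, -, hx⟩ := hM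
  obtain ⟨y, hy, hy0⟩ := Submodule.exists_mem_ne_zero_of_ne_bot hN
  obtain ⟨a, ha⟩ := M.exists_ract_e_notMem h (N := ⊥) (x := y) (by simpa using hy0)
  obtain ⟨c, hc⟩ := hx (y <• a)
  have hc0 : c ≠ 0 := by
    rintro rfl
    simp [hc] at ha
  have hxN : x ∈ N := by
    have h1 : c • x ∈ N := hc ▸ N.smul_mem _ (N.smul_mem _ hy)
    have h2 := (N.restrictScalars K).smul_mem c⁻¹ h1
    rwa [smul_smul, inv_mul_cancel₀ hc0, one_smul] at h2
  rw [eq_top_iff]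
  rintro z -
  obtain ⟨b, rfl⟩ := M.exists_ract_eq h hx z
  exact N.smul_mem _ hxN

/-- The scalar `c` is the residue of `e a e` in the connected graded ring `e A e`. -/
theorem _root_.CornerData.exists_corner (h : CornerData 𝒜 ι) (a : A) :
    ∃ c : K, h.e * a * h.e - c • h.e ∈ ⨆ i : Set.Ioi (0 : ℤ), 𝒜 i := by
  have ha : a ∈ ⨆ i, 𝒜 i := by rw [h.iSup_eq]; trivial
  induction ha using Submodule.iSup_induction' with
  | mem i a ha =>
    rcases lt_trichotomy i 0 with hi | rfl | hi
    · exact ⟨0, by simp [h.corner_neg i hi a ha]⟩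
    · obtain ⟨c, hc⟩ := h.corner_zero a ha
      exact ⟨c, by simp [hc]⟩
    · refine ⟨0, ?_⟩
      have := h.mul_mem (h.mul_mem h.e_mem ha) h.e_mem
      rw [zero_add, add_zero] at this
      rw [zero_smul, sub_zero]
      exact Submodule.mem_iSup_of_mem (⟨i, hi⟩ : Set.Ioi (0 : ℤ)) this
  | zero => exact ⟨0, by simp⟩
  | add a b _ _ ha hb =>
    obtain ⟨c, hc⟩ := ha
    obtain ⟨c', hc'⟩ := hb
    refine ⟨c + c', ?_⟩
    have := Submodule.add_mem _ hc hc'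
    rwa [show h.e * a * h.e - c • h.e + (h.e * b * h.e - c' • h.e)
      = h.e * (a + b) * h.e - (c + c') • h.e by rw [mul_add, add_mul, add_smul]; abel] at this

theorem ract_mem_iSup (M : GrMod.{u, w, v} 𝒜) {d : ℤ} {x : M.carrier} (hx : x ∈ M.comp d)
    {a : A} (ha : a ∈ ⨆ i : Set.Ioi (0 : ℤ), 𝒜 i) :
    x <• a ∈ ⨆ i : Set.Ioi d, M.comp i := by
  induction ha using Submodule.iSup_induction' with
  | mem i a ha =>
    exact Submodule.mem_iSup_of_mem (⟨d + i, lt_add_of_pos_right d i.2⟩ : Set.Ioi d)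
      (M.smul_mem _ _ _ _ ha hx)
  | zero => simp
  | add a b _ _ ha hb => rw [ract_add]; exact Submodule.add_mem _ ha hb

theorem proj_ract_of_pos (M : GrMod.{u, w, v} 𝒜) {d : ℤ} {x : M.carrier} (hx : x ∈ M.comp d)
    {a : A} (ha : a ∈ ⨆ i : Set.Ioi (0 : ℤ), 𝒜 i) : M.proj d (x <• a) = 0 :=
  M.proj_eq_zero_of_mem_iSup (by simp) (M.ract_mem_iSup hx ha)

/-- The positive part of the corner raises degrees, while its effect on `x` stays on the line `K x`
in degree `d`; only the residue of `e a e` can act. -/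
theorem ract_e_eq_smul (M : GrMod.{u, w, v} 𝒜) (h : CornerData 𝒜 ι) {d : ℤ}
    {x : M.carrier} (hxd : x ∈ M.comp d) (hxe : x <• h.e = x)
    (hx : ∀ y : M.carrier, ∃ c : K, y <• h.e = c • x) {a : A} {c : K}
    (hc : h.e * a * h.e - c • h.e ∈ ⨆ i : Set.Ioi (0 : ℤ), 𝒜 i) : x <• (a * h.e) = c • x := by
  obtain ⟨c', hc'⟩ := hx (x <• a)
  have h1 : x <• (h.e * a * h.e - c • h.e) = c' • x - c • x := by
    have := (M.orbit x).map_sub (h.e * a * h.e) (c • h.e)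
    simp only [orbit_apply, ract_mul, ract_smul, hxe, hc'] at this
    exact this
  have h2 := M.proj_ract_of_pos hxd hc
  rw [h1, map_sub, map_smul, map_smul, M.proj_same hxd, sub_eq_zero] at h2
  rw [ract_mul, hc', h2]

/-- The condition on the right does not mention the module. Any two modules of this kind thus have
generators with the same annihilator, and this is what makes the simple module unique. -/
theorem ract_eq_zero_iff (M : GrMod.{u, w, v} 𝒜) (h : CornerData 𝒜 ι) {d : ℤ}
    {x : M.carrier} (hxd : x ∈ M.comp d) (hx0 : x ≠ 0) (hxe : x <• h.e = x)
    (hx : ∀ y : M.carrier, ∃ c : K, y <• h.e = c • x) (a : A) :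
    x <• a = 0 ↔ ∀ b, h.e * (a * b) * h.e ∈ ⨆ i : Set.Ioi (0 : ℤ), 𝒜 i := by
  constructor
  · intro h0 b
    obtain ⟨c, hc⟩ := h.exists_corner (a * b)
    have := M.ract_e_eq_smul h hxd hxe hx hc
    rw [ract_mul, ract_mul, h0, smul_zero, smul_zero, eq_comm, smul_eq_zero] at this
    rw [this.resolve_right hx0, zero_smul, sub_zero] at hc
    exact hc
  · intro hb
    by_contra h0
    obtain ⟨b, hb'⟩ := M.exists_ract_e_notMem h (N := ⊥) (x := x <• a) (by simpa using h0)
    apply hb'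
    have := M.ract_e_eq_smul h hxd hxe hx (a := a * b) (c := 0) (by simpa using hb b)
    rw [ract_mul, ract_mul, zero_smul] at this
    exact this

/-- A degree-preserving map commutes with the homogeneous projections, so an injective one also
reflects degrees. -/
theorem mem_comp_iff_of_equiv {M : GrMod.{u, w, v} 𝒜} {M' : GrMod.{u, w, v'} 𝒜}
    (f : M.carrier ≃ₗ[Aᵐᵒᵖ] M'.carrier) (hf : ∀ j x, x ∈ M.comp j → f x ∈ M'.comp j) (j : ℤ)
    (x : M.carrier) : x ∈ M.comp j ↔ f x ∈ M'.comp j := by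
  refine ⟨hf j x, fun h => ?_⟩
  obtain ⟨s, hs, h0⟩ := M.exists_sum x
  have h1 : ∀ i, M'.proj i (f x) = f (M.proj i x) := by
    intro i
    by_cases hi : i ∈ s
    · conv_lhs => rw [← hs, map_sum]
      exact M'.proj_sum s (fun j => f (M.proj j x)) (fun j _ => hf _ _ (M.proj_mem j x)) hi
    · conv_lhs => rw [← hs, map_sum, map_sum]
      rw [h0 i hi, map_zero]
      refine Finset.sum_eq_zero fun k hk => M'.proj_ne ?_ (hf _ _ (M.proj_mem k x))
      rintro rfl
      exact hi hk
  have h2 := h1 j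
  rw [M'.proj_same h] at h2
  rw [f.injective h2]
  exact M.proj_mem j x

theorem IsType.iso {M : GrMod.{u, w, v} 𝒜} {M' : GrMod.{u, w, v'} 𝒜} {h : CornerData 𝒜 ι}
    {d d' : ℤ} (hM : M.IsType h.e d) (hM' : M'.IsType h.e d') : M.Iso (M'.shift (d - d')) := by
  obtain ⟨x, hxd, hx0, hxe, hx⟩ := hM
  obtain ⟨y, hyd, hy0, hye, hy⟩ := hM'
  let f : Aᵐᵒᵖ →ₗ[Aᵐᵒᵖ] M.carrier := LinearMap.toSpanSingleton Aᵐᵒᵖ _ x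
  let g : Aᵐᵒᵖ →ₗ[Aᵐᵒᵖ] M'.carrier := LinearMap.toSpanSingleton Aᵐᵒᵖ _ y
  have hf : Function.Surjective f := fun z => by
    obtain ⟨a, ha⟩ := M.exists_ract_eq h hx z
    exact ⟨MulOpposite.op a, ha⟩
  have hg : Function.Surjective g := fun z => by
    obtain ⟨a, ha⟩ := M'.exists_ract_eq h hy z
    exact ⟨MulOpposite.op a, ha⟩
  -- Both modules are the quotient of the algebra by this common annihilator, which yields the
  -- isomorphism `x a ↦ y a`.
  have hk : LinearMap.ker f = LinearMap.ker g := by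
    ext a
    obtain ⟨a, rfl⟩ := MulOpposite.op_surjective a
    rw [LinearMap.mem_ker, LinearMap.mem_ker]
    exact (M.ract_eq_zero_iff h hxd hx0 hxe hx a).trans
      (M'.ract_eq_zero_iff h hyd hy0 hye hy a).symm
  let E : M.carrier ≃ₗ[Aᵐᵒᵖ] M'.carrier :=
    (f.quotKerEquivOfSurjective hf).symm.trans
      ((Submodule.quotEquivOfEq _ _ hk).trans (g.quotKerEquivOfSurjective hg))
  have hE : ∀ a : A, E (x <• a) = y <• a := by
    intro a
    have h1 : (f.quotKerEquivOfSurjective hf).symm (x <• a) =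
        Submodule.Quotient.mk (MulOpposite.op a) := by
      rw [LinearEquiv.symm_apply_eq]
      rfl
    simp only [E, LinearEquiv.trans_apply, h1]
    rfl
  refine ⟨E, mem_comp_iff_of_equiv (M' := M'.shift (d - d')) E ?_⟩
  intro j z hz
  obtain ⟨a, rfl⟩ := M.exists_ract_eq h hx z
  have ha : ∀ b : A, M.proj j (x <• b) = x <• b → M'.proj (j - (d - d')) (y <• b) = y <• b := by
    intro b hb
    -- A homogeneous vector `x b` can be written with `b` homogeneous, namely with the part of `b`
    -- of degree `j - d`.
    obtain ⟨b', hb', hbb'⟩ : ∃ b' ∈ 𝒜 (j - d), M.proj j (x <• b) = x <• b' := by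
      clear hb
      have hb : b ∈ ⨆ i, 𝒜 i := by rw [h.iSup_eq]; trivial
      induction hb using Submodule.iSup_induction' with
      | mem i b hb =>
        have h1 := M.smul_mem _ _ _ _ hb hxd
        by_cases hij : d + i = j
        · subst hij
          exact ⟨b, by simpa using hb, M.proj_same h1⟩
        · exact ⟨0, Submodule.zero_mem _, by rw [M.proj_ne hij h1]; simp⟩
      | zero => exact ⟨0, Submodule.zero_mem _, by simp⟩
      | add a b _ _ ha hb =>
        obtain ⟨a', ha', h1⟩ := ha
        obtain ⟨b', hb', h2⟩ := hb
        exact ⟨a' + b', Submodule.add_mem _ ha' hb', by rw [ract_add, map_add, h1, h2, ract_add]⟩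
    rw [← hE, ← hb, hbb', hE]
    have := M'.smul_mem _ _ _ _ hb' hyd
    rw [show d' + (j - d) = j - (d - d') by ring] at this
    exact M'.proj_same this
  change E (x <• a) ∈ M'.comp (j - (d - d'))
  rw [hE, ← ha a (M.proj_same hz)]
  exact M'.proj_mem _ _

/-- The line `M e` is spanned by a homogeneous vector and so sits in exactly one degree. -/
theorem IsType.unique {M : GrMod.{u, w, v} 𝒜} {e : A} {d d' : ℤ} (hM : M.IsType e d)
    (hM' : M.IsType e d') : d = d' := by
  obtain ⟨x, hxd, hx0, hxe, hx⟩ := hM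
  obtain ⟨y, hyd, hy0, hye, -⟩ := hM'
  obtain ⟨c, hc⟩ := hx y
  rw [hye] at hc
  by_contra hne
  have h1 := M.proj_ne hne ((M.comp d).smul_mem c hxd)
  rw [← hc, M.proj_same hyd] at h1
  exact hy0 h1

theorem IsType.of_iso_shift {M : GrMod.{u, w, v} 𝒜} {M' : GrMod.{u, w, v'} 𝒜} {e : A} {d s : ℤ}
    (hM' : M'.IsType e d) (hi : M.Iso (M'.shift s)) : M.IsType e (d + s) := by
  obtain ⟨x, hxd, hx0, hxe, hx⟩ := hM'
  obtain ⟨f, hf⟩ := hi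
  have hsm : ∀ (c : K) (z : M'.carrier), f.symm (c • z) = c • f.symm z :=
    map_smul_base (M := M') (M' := M) f.symm.toLinearMap
  refine ⟨f.symm x, ?_, ?_, ?_, fun y => ?_⟩
  · rw [hf]
    change f (f.symm x) ∈ M'.comp (d + s - s)
    rw [f.apply_symm_apply, add_sub_cancel_right]
    exact hxd
  · exact fun h => hx0 ((f.symm.map_eq_zero_iff).1 h)
  · rw [← f.symm.map_smul]; exact congrArg f.symm hxe
  · obtain ⟨c, hc⟩ := hx (f y)
    refine ⟨c, ?_⟩
    rw [← hsm, ← hc]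
    exact (f.symm_apply_apply _).symm.trans (congrArg f.symm (f.map_smul _ _))

end GrMod
end Corner

/-! ### Composition series and graded multiplicities read off from the corner. -/

section Corner

open scoped RightActions

namespace GrMod

variable {K : Type u} {A : Type w} [Field K] [Ring A] [Algebra K A] {𝒜 : ℤ → Submodule K A}
  {ι : Type*} [Fintype ι]

theorem mem_span_singleton_iff (M : GrMod.{u, w, v} 𝒜) (x y : M.carrier) :
    y ∈ Submodule.span Aᵐᵒᵖ {x} ↔ ∃ a : A, x <• a = y := by
  rw [Submodule.mem_span_singleton]
  exact ⟨fun ⟨a, ha⟩ => ⟨a.unop, ha⟩, fun ⟨a, ha⟩ => ⟨MulOpposite.op a, ha⟩⟩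

theorem isHomogeneous_span_singleton (M : GrMod.{u, w, v} 𝒜) (h𝒜 : ⨆ i, 𝒜 i = ⊤) {d : ℤ}
    {x : M.carrier} (hx : x ∈ M.comp d) : M.IsHomogeneous (Submodule.span Aᵐᵒᵖ {x}) := by
  refine M.isHomogeneous_span h𝒜 _ ?_
  rintro _ rfl j
  by_cases h : d = j
  · subst h
    rw [M.proj_same hx]
    exact Submodule.mem_span_singleton_self _
  · rw [M.proj_ne h hx]
    exact Submodule.zero_mem _

theorem IsHomogeneous.sup {M : GrMod.{u, w, v} 𝒜} {N N' : Submodule Aᵐᵒᵖ M.carrier}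
    (hN : M.IsHomogeneous N) (hN' : M.IsHomogeneous N') : M.IsHomogeneous (N ⊔ N') := by
  intro x hx j
  obtain ⟨y, hy, z, hz, rfl⟩ := Submodule.mem_sup.1 hx
  rw [map_add]
  exact Submodule.add_mem_sup (hN y hy j) (hN' z hz j)

/-- The kernel of a graded map from a graded module generated by a vector `x` with `x e = x` is
superfluous, if it does not contain `x`. -/
theorem eq_top_of_sup_ker {P : GrMod.{u, w, v} 𝒜} {D : GrMod.{u, w, v'} 𝒜} (h : CornerData 𝒜 ι)
    {d : ℤ} {x : P.carrier} (hxd : x ∈ P.comp d) (hxe : x <• h.e = x)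
    (hx : ∀ y, ∃ a : A, x <• a = y) (f : P.carrier →ₗ[Aᵐᵒᵖ] D.carrier) (hfd : f x ∈ D.comp d)
    (hf0 : f x ≠ 0) {N : P.HomSub} (hN : N.1 ⊔ LinearMap.ker f = ⊤) : N.1 = ⊤ := by
  have htop : x ∈ N.1 ⊔ LinearMap.ker f := by
    rw [hN]; exact Submodule.mem_top
  obtain ⟨y, hy, z, hz, hyz⟩ := Submodule.mem_sup.1 htop
  obtain ⟨a, ha⟩ := hx z
  obtain ⟨c, hc⟩ := h.exists_corner a
  have h1 : x <• (h.e * a * h.e - c • h.e) = z <• h.e - c • x := by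
    rw [ract_sub_smul, ract_mul, ract_mul, hxe, ha]
  -- In degree `d` the image of `z e` under `f` is `c f(x)`; as `z` lies in the kernel and `f(x)`
  -- does not vanish, the residue `c` is zero.
  have hc0 : c = 0 := by
    have h2 := D.proj_ract_of_pos hfd hc
    rw [← map_smul, h1, map_sub, map_smul, map_smul_base, LinearMap.mem_ker.1 hz, smul_zero,
      zero_sub, map_neg, map_smul, D.proj_same hfd, neg_eq_zero, smul_eq_zero] at h2
    exact h2.resolve_right hf0
  have h2 := P.proj_ract_of_pos hxd hc
  rw [h1, hc0, zero_smul, sub_zero] at h2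
  have h3 : P.proj d (y <• h.e) = x := by
    have h4 : y <• h.e = x - z <• h.e := by
      rw [eq_sub_iff_add_eq, ← smul_add, hyz, hxe]
    rw [h4, map_sub, h2, sub_zero, P.proj_same hxd]
  have h4 : x ∈ N.1 := by
    rw [← h3]
    exact N.2 _ (N.1.smul_mem _ hy) d
  rw [eq_top_iff]
  rintro y -
  obtain ⟨a, rfl⟩ := hx y
  exact N.1.smul_mem _ h4

theorem finite_ne_bot (M : GrMod.{u, w, v} 𝒜) [Module.Finite K M.carrier] :
    {j | M.comp j ≠ ⊥}.Finite :=
  WellFoundedGT.finite_ne_bot_of_iSupIndep M.isInternal.submodule_iSupIndep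

/-- A maximal graded submodule `N` of `N'` is complemented, up to the radical of the corner, by a
homogeneous vector fixed by `e`. -/
theorem exists_top_vector (M : GrMod.{u, w, v} 𝒜) [Module.Finite K M.carrier]
    (h : CornerData 𝒜 ι) {N N' : M.HomSub} (hN : N ⋖ N') :
    ∃ d, ∃ x ∈ M.corner h.e N'.1 d, x ∉ N.1 ∧
      ∀ y ∈ N'.1, ∃ c : K, y <• h.e - c • x ∈ N.1 := by
  let S : Set ℤ := {d | ∃ x ∈ M.corner h.e N'.1 d, x ∉ N.1}
  have hproj : ∀ j (y : M.carrier), (M.proj j y) <• h.e = M.proj j (y <• h.e) := by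
    intro j y
    rw [← M.proj_smul h.e_mem, add_zero]
  have hee : ∀ y : M.carrier, (y <• h.e) <• h.e = y <• h.e := by
    intro y; rw [← ract_mul, h.idem]
  have hfin : S.Finite := by
    refine M.finite_ne_bot.subset ?_
    rintro d ⟨x, hx, hxN⟩ hbot
    rw [mem_corner, hbot, Submodule.mem_bot] at hx
    exact hxN (hx.2.1 ▸ N.1.zero_mem)
  have hmem : ∀ y ∈ N'.1, ∀ j, M.proj j (y <• h.e) ∈ M.corner h.e N'.1 j := by
    intro y hy j
    rw [mem_corner]
    exact ⟨N'.2 _ (N'.1.smul_mem _ hy) j, M.proj_mem _ _, by rw [hproj, hee]⟩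
  have hne : S.Nonempty := by
    obtain ⟨x, hx, hxN⟩ := Set.exists_of_ssubset (show (N.1 : Set M.carrier) ⊂ N'.1 from hN.1)
    obtain ⟨a, ha⟩ := M.exists_ract_e_notMem h hxN
    have : ∃ j, M.proj j ((x <• a) <• h.e) ∉ N.1 := by
      by_contra! hc
      exact ha (M.mem_of_proj_mem (N := N.1.restrictScalars K) hc)
    obtain ⟨j, hj⟩ := this
    exact ⟨j, _, hmem _ (N'.1.smul_mem _ hx) j, hj⟩
  -- With `d` as large as possible, anything that positive degree elements of the algebra make out
  -- of `x` in the corner falls into `N`.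
  obtain ⟨d, ⟨x, hx, hxN⟩, hmax⟩ := Set.exists_max_image S id hfin hne
  refine ⟨d, x, hx, hxN, ?_⟩
  rw [mem_corner] at hx
  have hpos : ∀ a ∈ ⨆ i : Set.Ioi (0 : ℤ), 𝒜 i, (x <• a) <• h.e ∈ N.1 := by
    intro a ha
    refine M.mem_of_proj_mem (N := N.1.restrictScalars K) fun j => ?_
    by_cases hj : d < j
    · by_contra hc
      have := hmax j ⟨_, hmem _ (N'.1.smul_mem _ hx.1) j, hc⟩
      simp only [id] at this
      omega
    · rw [← hproj, M.proj_eq_zero_of_mem_iSup (S := Set.Ioi d) hj (M.ract_mem_iSup hx.2.1 ha),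
        smul_zero]
      exact Submodule.zero_mem _
  -- The left side is homogeneous, strictly above `N` and inside `N'`, so the covering relation
  -- forces equality.
  have hsup : N.1 ⊔ Submodule.span Aᵐᵒᵖ {x} = N'.1 := by
    let N'' : M.HomSub := ⟨N.1 ⊔ Submodule.span Aᵐᵒᵖ {x},
      N.2.sup (M.isHomogeneous_span_singleton h.iSup_eq hx.2.1)⟩
    have h1 : N < N'' := by
      refine lt_of_le_of_ne (show N.1 ≤ N''.1 from le_sup_left) fun heq => hxN ?_
      rw [heq]
      exact (le_sup_right : _ ≤ N''.1) (Submodule.mem_span_singleton_self x)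
    have h2 : N'' ≤ N' := by
      change N''.1 ≤ N'.1
      refine sup_le hN.1.le ?_
      rw [Submodule.span_singleton_le_iff_mem]
      exact hx.1
    exact congrArg Subtype.val (h2.eq_of_not_lt (hN.2 h1))
  intro y hy
  rw [← hsup] at hy
  obtain ⟨z, hz, t, ht, rfl⟩ := Submodule.mem_sup.1 hy
  obtain ⟨a, rfl⟩ := (M.mem_span_singleton_iff x t).1 ht
  obtain ⟨c, hc⟩ := h.exists_corner a
  refine ⟨c, ?_⟩
  have h1 := hpos _ hc
  have h2 : (x <• (h.e * a * h.e - c • h.e)) <• h.e = (x <• a) <• h.e - c • x := by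
    rw [← ract_mul, sub_mul, mul_assoc, h.idem, smul_mul_assoc, h.idem]
    have := (M.orbit x).map_sub (h.e * a * h.e) (c • h.e)
    simp only [orbit_apply, ract_mul, ract_smul, hx.2.2] at this
    exact this
  rw [h2] at h1
  rw [smul_add, add_sub_assoc]
  exact Submodule.add_mem _ (N.1.smul_mem _ hz) h1

/-- The vector of `exists_top_vector` spans the corner of `N'` modulo that of `N`. One composition
factor therefore accounts for exactly one dimension of the corner, in the degree that determines the
factor. -/
theorem covBy_step (M : GrMod.{u, w, v} 𝒜) [Module.Finite K M.carrier]
    (h : CornerData 𝒜 ι) {N N' : M.HomSub} (hN : N ⋖ N') :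
    ∃ d, (M.subquot N N').IsType h.e d ∧ ∀ j, Module.finrank K (M.corner h.e N'.1 j) =
      Module.finrank K (M.corner h.e N.1 j) + if d = j then 1 else 0 := by
  obtain ⟨d, x, hx, hxN, hxy⟩ := M.exists_top_vector h hN
  have hx' := (M.mem_corner _ _ _ _).1 hx
  have hle : N.1 ≤ N'.1 := hN.1.le
  refine ⟨d, ?_, fun j => ?_⟩
  · unfold subquot
    refine ⟨Submodule.Quotient.mk ⟨x, hx'.1⟩, ⟨⟨x, hx'.1⟩, hx'.2.1, rfl⟩, ?_, ?_, ?_⟩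
    · intro h0
      have h1 : (⟨x, hx'.1⟩ : N'.1) ∈ N.1.comap N'.1.subtype :=
        (Submodule.Quotient.mk_eq_zero _).1 h0
      exact hxN h1
    · exact congrArg Submodule.Quotient.mk (Subtype.ext hx'.2.2)
    · intro y
      obtain ⟨⟨y, hy⟩, rfl⟩ := Submodule.Quotient.mk_surjective _ y
      obtain ⟨c, hc⟩ := hxy y hy
      exact ⟨c, (Submodule.Quotient.eq _).2 hc⟩
  · have hmono : M.corner h.e N.1 j ≤ M.corner h.e N'.1 j := by
      intro y hy
      rw [mem_corner] at hy ⊢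
      exact ⟨hle hy.1, hy.2⟩
    split_ifs with hdj
    · subst hdj
      suffices hs : M.corner h.e N'.1 d = M.corner h.e N.1 d ⊔ Submodule.span K {x} by
        rw [hs, Submodule.finrank_sup_span_singleton fun hc =>
          hxN ((M.mem_corner _ _ _ _).1 hc).1]
      refine le_antisymm ?_ (sup_le hmono ?_)
      · intro y hy
        have hy' := (M.mem_corner _ _ _ _).1 hy
        obtain ⟨c, hc⟩ := hxy y hy'.1
        rw [hy'.2.2] at hc
        rw [← sub_add_cancel y (c • x)]
        refine Submodule.add_mem_sup ?_ (Submodule.smul_mem _ _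
          (Submodule.mem_span_singleton_self _))
        rw [mem_corner]
        refine ⟨hc, Submodule.sub_mem _ hy'.2.1 (Submodule.smul_mem _ _ hx'.2.1), ?_⟩
        rw [smul_sub, smul_ract, hy'.2.2, hx'.2.2]
      · rw [Submodule.span_singleton_le_iff_mem]
        exact hx
    · suffices hs : M.corner h.e N'.1 j ≤ M.corner h.e N.1 j by
        rw [add_zero, le_antisymm hs hmono]
      intro y hy
      have hy' := (M.mem_corner _ _ _ _).1 hy
      obtain ⟨c, hc⟩ := hxy y hy'.1
      have := N.2 _ hc j
      rw [hy'.2.2, map_sub, map_smul, M.proj_same hy'.2.1, M.proj_ne hdj hx'.2.1, smul_zero,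
        sub_zero] at this
      rw [mem_corner]
      exact ⟨this, hy'.2⟩

theorem exists_compSeries (M : GrMod.{u, w, v} 𝒜) [Module.Finite K M.carrier] :
    ∃ (r : ℕ) (N : Fin (r + 1) → M.HomSub), M.IsCompSeries N := by
  let R : M.HomSub → Submodule K M.carrier := fun N => N.1.restrictScalars K
  have hR : StrictMono R := fun N N' hN => hN
  have : WellFoundedLT M.HomSub := hR.wellFoundedLT
  have : WellFoundedGT M.HomSub := hR.wellFoundedGT
  let B : M.HomSub := ⟨⊥, fun x hx j => by
    rw [Submodule.mem_bot] at hx ⊢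
    rw [hx, map_zero]⟩
  let T : M.HomSub := ⟨⊤, fun x _ j => trivial⟩
  obtain ⟨a, ha0, n, han, ha⟩ := exists_covBy_seq_of_wellFoundedLT_wellFoundedGT_of_le
    (show B ≤ T from (bot_le : (⊥ : Submodule Aᵐᵒᵖ M.carrier) ≤ _))
  refine ⟨n, fun i => a i, ?_, ?_, fun i => ?_⟩
  · simp [ha0, B]
  · simp [han, T]
  · simpa using ha i i.2

theorem corner_bot (M : GrMod.{u, w, v} 𝒜) (e : A) (j : ℤ) : M.corner e ⊥ j = ⊥ := by
  rw [eq_bot_iff]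
  intro x hx
  exact ((M.mem_corner _ _ _ _).1 hx).1

/-- Adding up `covBy_step` along any composition series counts the factors of each type by the
corner of the whole module. The count cannot depend on the series, so no Jordan–Hölder theorem is
needed. -/
theorem hasGrMult (M : GrMod.{u, w, v} 𝒜) [Module.Finite K M.carrier] (h : CornerData 𝒜 ι)
    {D : GrMod.{u, w, v'} 𝒜} {d : ℤ} (hD : D.IsType h.e d) :
    M.HasGrMult D (∑ᶠ j : ℤ, Module.finrank K (M.corner h.e ⊤ (d + j)) •
      (LaurentPolynomial.T j : ℕ[T;T⁻¹])) := by
  refine ⟨M.exists_compSeries, ?_⟩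
  intro r N hN
  obtain ⟨hN0, hN1, hN⟩ := hN
  choose t ht hdim using fun i => M.covBy_step h (hN i)
  have hiso : ∀ i j, (M.subquot (N i.castSucc) (N i.succ)).Iso (D.shift j) ↔ t i = d + j := by
    intro i j
    constructor
    · intro hi
      exact (ht i).unique (hD.of_iso_shift hi)
    · intro hi
      have := (ht i).iso hD
      rwa [hi, add_sub_cancel_left] at this
  have hcount : ∀ j, Module.finrank K (M.corner h.e ⊤ j) =
      ∑ i, if t i = j then 1 else 0 := by
    intro j
    -- The corner of the `k`-th submodule counts the factors strictly below it, in each degree.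
    have key : ∀ k : Fin (r + 1), Module.finrank K (M.corner h.e (N k).1 j) =
        ∑ i : Fin r, if i.castSucc < k then (if t i = j then 1 else 0) else 0 := by
      intro k
      induction k using Fin.induction with
      | zero => simp [hN0, corner_bot]
      | succ k ih =>
        rw [hdim, ih]
        have : (if t k = j then 1 else 0) =
            ∑ i : Fin r, if i = k then (if t i = j then 1 else 0) else 0 := by simp
        rw [this, ← Finset.sum_add_distrib]
        refine Finset.sum_congr rfl fun i _ => ?_
        rcases lt_trichotomy i k with hik | rfl | hik
        · simp [hik, hik.ne, Fin.castSucc_lt_succ_iff, hik.le]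
        · simp
        · simp [hik.not_gt, hik.ne', Fin.castSucc_lt_succ_iff, hik.not_ge]
    have := key (Fin.last r)
    rw [hN1] at this
    simpa [Fin.castSucc_lt_last] using this
  unfold seriesMult
  classical
  refine finsum_congr fun j => ?_
  congr 1
  rw [hcount, Finset.sum_boole, Nat.card_eq_fintype_card, Fintype.card_subtype]
  simp only [hiso, Nat.cast_id]

theorem finsum_card_smul_T {κ : Type*} [Fintype κ] (δ : κ → ℤ) (d : ℤ) :
    ∑ᶠ j : ℤ, Nat.card {a // δ a = d + j} • (LaurentPolynomial.T j : ℕ[T;T⁻¹]) =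
      ∑ a, LaurentPolynomial.T (δ a - d) := by
  classical
  rw [finsum_eq_sum_of_support_subset (s := Finset.univ.image fun a => δ a - d)]
  · rw [← Finset.sum_fiberwise_of_maps_to (s := Finset.univ) (g := fun a => δ a - d)
      (fun a _ => Finset.mem_image_of_mem _ (Finset.mem_univ a))]
    refine Finset.sum_congr rfl fun j _ => ?_
    rw [Finset.sum_congr rfl (g := fun _ => LaurentPolynomial.T j)
      (fun a ha => by rw [(Finset.mem_filter.1 ha).2]), Finset.sum_const,
      Nat.card_eq_fintype_card, Fintype.card_subtype]
    congr 2
    ext a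
    simp only [Finset.mem_filter, Finset.mem_univ, true_and]
    omega
  · intro j hj
    rw [Function.mem_support] at hj
    have : Nat.card {a // δ a = d + j} ≠ 0 := fun h0 => hj (by rw [h0, zero_smul])
    rw [Nat.card_ne_zero] at this
    obtain ⟨⟨a, ha⟩⟩ := this.1
    simp only [Finset.coe_image, Finset.coe_univ, Set.image_univ, Set.mem_range]
    exact ⟨a, by omega⟩

/-- Projecting to degree `j` keeps the terms `b a` with `δ a = j` and kills the others, so these
span the part of degree `j`. -/
theorem finrank_inf_comp (M : GrMod.{u, w, v} 𝒜) {κ : Type*} [Fintype κ] {b : κ → M.carrier}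
    (hb : LinearIndependent K b) {δ : κ → ℤ} (hδ : ∀ a, b a ∈ M.comp (δ a)) (j : ℤ) :
    Module.finrank K ↥(Submodule.span K (Set.range b) ⊓ M.comp j) = Nat.card {a // δ a = j} := by
  classical
  have h1 : Submodule.span K (Set.range b) ⊓ M.comp j =
      Submodule.span K (Set.range fun a : {a // δ a = j} => b a) := by
    refine le_antisymm ?_ (le_inf (Submodule.span_mono ?_) ?_)
    · rintro x ⟨hx, hxj⟩
      obtain ⟨c, rfl⟩ := (Submodule.mem_span_range_iff_exists_fun K).1 hx
      have := M.proj_same hxj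
      rw [← this, map_sum]
      refine Submodule.sum_mem _ fun a _ => ?_
      rw [map_smul]
      by_cases ha : δ a = j
      · rw [M.proj_same (ha ▸ hδ a)]
        exact Submodule.smul_mem _ _ (Submodule.subset_span ⟨⟨a, ha⟩, rfl⟩)
      · rw [M.proj_ne ha (hδ a), smul_zero]
        exact Submodule.zero_mem _
    · rintro _ ⟨a, rfl⟩
      exact ⟨a, rfl⟩
    · rw [Submodule.span_le]
      rintro _ ⟨a, rfl⟩
      have := hδ a
      rwa [a.2] at this
  rw [h1, Nat.card_eq_fintype_card]
  exact finrank_span_eq_card (hb.comp _ Subtype.val_injective)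

theorem grDim_eq (M : GrMod.{u, w, v} 𝒜) {κ : Type*} [Fintype κ] {b : κ → M.carrier}
    (hb : LinearIndependent K b) (hs : Submodule.span K (Set.range b) = ⊤) {δ : κ → ℤ}
    (hδ : ∀ a, b a ∈ M.comp (δ a)) : M.grDim = ∑ a, LaurentPolynomial.T (δ a) := by
  have h := finsum_card_smul_T δ 0
  simp only [zero_add, sub_zero] at h
  rw [← h]
  refine finsum_congr fun j => ?_
  rw [← M.finrank_inf_comp hb hδ, hs, top_inf_eq]

theorem hasGrMult_of_basis (M : GrMod.{u, w, v} 𝒜) [Module.Finite K M.carrier]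
    (h : CornerData 𝒜 ι) {D : GrMod.{u, w, v'} 𝒜} {d : ℤ} (hD : D.IsType h.e d)
    {κ : Type*} [Fintype κ] {b : κ → M.carrier} (hb : LinearIndependent K b)
    (hs : ∀ x, x <• h.e = x ↔ x ∈ Submodule.span K (Set.range b)) {δ : κ → ℤ}
    (hδ : ∀ a, b a ∈ M.comp (δ a)) :
    M.HasGrMult D (∑ a, LaurentPolynomial.T (δ a - d)) := by
  rw [← finsum_card_smul_T]
  convert M.hasGrMult h hD using 6 with j
  rw [← M.finrank_inf_comp hb hδ]
  have : Submodule.span K (Set.range b) ⊓ M.comp (d + j) = M.corner h.e ⊤ (d + j) := by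
    ext x
    rw [mem_corner, Submodule.mem_inf, ← hs]
    simp [and_comm]
  rw [this]

theorem IsType.hasGrMult {M : GrMod.{u, w, v} 𝒜} [Module.Finite K M.carrier]
    {h : CornerData 𝒜 ι} {d d' : ℤ} (hM : M.IsType h.e d') {D : GrMod.{u, w, v'} 𝒜}
    (hD : D.IsType h.e d) : M.HasGrMult D (LaurentPolynomial.T (d' - d)) := by
  obtain ⟨x, hxd, hx0, hxe, hx⟩ := hM
  have := M.hasGrMult_of_basis h hD (κ := Unit) (b := fun _ => x)
    (LinearIndependent.of_subsingleton () hx0) (δ := fun _ => d') (fun y => ?_) (fun _ => hxd)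
  · simpa using this
  · rw [Set.range_const, Submodule.mem_span_singleton]
    constructor
    · intro hy
      obtain ⟨c, hc⟩ := hx y
      exact ⟨c, by rw [← hc, hy]⟩
    · rintro ⟨c, rfl⟩
      rw [smul_ract, hxe]

end GrMod
end Corner

/-! ### Graded projective covers over the cyclotomic nilHecke algebra. -/

section ProjectiveCovers

open scoped RightActions
open CycNilHecke

namespace GrMod

variable {K : Type u} [Field K] {ℓ n : ℕ} {ι : Type*} [Fintype ι]

/-- Left multiplication is injective on elements congruent to the identity modulo elements of
positive degree. -/
theorem _root_.CycNilHecke.eq_zero_of_eq_mul {t x : CycNilHecke K ℓ n}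
    (ht : t ∈ ⨆ i : Set.Ioi (0 : ℤ), grading K ℓ n i) (hx : x = t * x) : x = 0 := by
  classical
  obtain ⟨s, hs, h0⟩ := (regular K ℓ n).exists_sum x
  by_contra hne
  have hS : (s.filter fun j => (regular K ℓ n).proj j x ≠ 0).Nonempty := by
    by_contra hc
    rw [Finset.not_nonempty_iff_eq_empty, Finset.filter_eq_empty_iff] at hc
    apply hne
    rw [← hs]
    exact Finset.sum_eq_zero fun j hj => not_not.1 (hc hj)
  -- Take the lowest nonzero component of `x`: `t * x` begins in strictly higher degree, so this
  -- component of `x = t * x` must vanish.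
  obtain ⟨j, hj, hmin⟩ := Finset.exists_min_image _ id hS
  rw [Finset.mem_filter] at hj
  apply hj.2
  have hmem : ∀ i, ∀ y ∈ grading K ℓ n i, j ≤ i →
      t * y ∈ ⨆ i : Set.Ioi j, grading K ℓ n i := by
    intro i y hy hij
    clear hx
    induction ht using Submodule.iSup_induction' with
    | mem k t ht =>
      refine Submodule.mem_iSup_of_mem (⟨k + i, ?_⟩ : Set.Ioi j) (mul_mem K ℓ n ht hy)
      have : (0 : ℤ) < k := k.2
      simp only [Set.mem_Ioi]
      omega
    | zero => simp
    | add a b _ _ ha hb => rw [add_mul]; exact Submodule.add_mem _ ha hb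
  rw [hx]
  refine (regular K ℓ n).proj_eq_zero_of_mem_iSup (S := Set.Ioi j) (by simp) ?_
  conv => enter [2]; rw [← hs, Finset.mul_sum]
  refine Submodule.sum_mem _ fun i hi => ?_
  by_cases hi0 : (regular K ℓ n).proj i x = 0
  · rw [hi0, mul_zero]; exact Submodule.zero_mem _
  · exact hmem i _ ((regular K ℓ n).proj_mem i x)
      (hmin i (Finset.mem_filter.2 ⟨hi, hi0⟩))

/-- A graded projective cover of a module of type `d` is generated by a vector of degree `d` with
the same annihilator as `e`. -/
theorem IsProjCover.exists_vector (h : CornerData (grading K ℓ n) ι)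
    {P : GrMod.{u, u, v} (grading K ℓ n)} {D : GrMod.{u, u, v'} (grading K ℓ n)} {d : ℤ}
    (hD : D.IsType h.e d) (hP : P.IsProjCover D) :
    ∃ x ∈ P.comp d, x <• h.e = x ∧ (∀ y : P.carrier, ∃ a : CycNilHecke K ℓ n, x <• a = y) ∧
      ∀ a : CycNilHecke K ℓ n, x <• a = 0 → h.e * a = 0 := by
  obtain ⟨hproj, π, hsurj, hdeg, hsup⟩ := hP
  obtain ⟨w, hwd, hw0, hwe, hw⟩ := hD
  have hπ : ∀ (y : P.carrier) (a : CycNilHecke K ℓ n), π (y <• a) = π y <• a :=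
    fun y a => π.map_smul _ _
  obtain ⟨z, hz⟩ := hsurj w
  have hzp : π (P.proj d z) = w := by
    have key : ∀ y, π (P.proj d y) = D.proj d (π y) := by
      intro y
      induction P.mem_iSup y using Submodule.iSup_induction' with
      | mem i y hy =>
        by_cases hi : i = d
        · subst hi
          rw [P.proj_same hy, D.proj_same (hdeg _ _ hy)]
        · rw [P.proj_ne hi hy, D.proj_ne hi (hdeg _ _ hy), map_zero]
      | zero => simp
      | add a b _ _ ha hb => simp only [map_add, ha, hb]
    rw [key, hz, D.proj_same hwd]
  set x : P.carrier := P.proj d z <• h.e with hx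
  have hxd : x ∈ P.comp d := by
    have := P.smul_mem _ _ _ _ h.e_mem (P.proj_mem d z)
    rwa [add_zero] at this
  have hxe : x <• h.e = x := by rw [hx, ← ract_mul, h.idem]
  have hπx : π x = w := by rw [hx, hπ, hzp, hwe]
  have hx0 : x ≠ 0 := by
    intro h0
    rw [h0, map_zero] at hπx
    exact hw0 hπx.symm
  clear_value x
  -- The homogeneous submodule generated by `x` already maps onto `D`, and the kernel is
  -- superfluous.
  have hgen : Submodule.span (CycNilHecke K ℓ n)ᵐᵒᵖ {x} = ⊤ := by
    refine hsup ⟨_, P.isHomogeneous_span_singleton h.iSup_eq hxd⟩ ?_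
    rw [eq_top_iff]
    rintro y -
    obtain ⟨a, ha⟩ := D.exists_ract_eq h hw (π y)
    rw [← add_sub_cancel (x <• a) y]
    refine Submodule.add_mem_sup
      (Submodule.smul_mem _ _ (Submodule.mem_span_singleton_self _)) ?_
    rw [LinearMap.mem_ker, map_sub, hπ, hπx, ha, sub_self]
  have hall : ∀ y : P.carrier, ∃ a : CycNilHecke K ℓ n, x <• a = y := fun y =>
    (P.mem_span_singleton_iff x y).1 (hgen ▸ Submodule.mem_top)
  refine ⟨x, hxd, hxe, hall, ?_⟩
  let φ : (CycNilHecke K ℓ n)ᵐᵒᵖ →ₗ[(CycNilHecke K ℓ n)ᵐᵒᵖ] P.carrier :=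
    LinearMap.toSpanSingleton _ _ x
  have hφ : Function.Surjective φ := fun y => by
    obtain ⟨a, ha⟩ := hall y
    exact ⟨MulOpposite.op a, ha⟩
  -- Projectivity splits `a ↦ x a`. The element `s = σ(x)` satisfies `x s = x` and `s e = s`, and
  -- any relation `x a = 0` becomes `s a = 0` in the algebra.
  obtain ⟨σ, hσ⟩ := Module.projective_lifting_property φ LinearMap.id hφ
  set s : CycNilHecke K ℓ n := MulOpposite.unop (σ x) with hs
  have hxs : x <• s = x := LinearMap.congr_fun hσ x
  have hσa : ∀ a : CycNilHecke K ℓ n, MulOpposite.unop (σ (x <• a)) = s * a := by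
    intro a
    rw [map_smul]
    rfl
  have hse : s * h.e = s := by rw [← hσa, hxe]
  obtain ⟨c, hc⟩ := h.exists_corner s
  rw [mul_assoc, hse] at hc
  have hxt : x <• (h.e * s - c • h.e) = x - c • x := by
    have := P.ract_sub_smul x (h.e * s) h.e c
    rwa [ract_mul, hxe, hxs] at this
  -- Comparing the degree `d` parts in `x s = x` shows that `e s` has residue 1, so `e s - e` has
  -- positive degree.
  have hc1 : c = 1 := by
    have := P.proj_ract_of_pos hxd hc
    rw [hxt, map_sub, map_smul, P.proj_same hxd, sub_eq_zero] at this
    have h2 : (1 - c) • x = 0 := by rw [sub_smul, one_smul, sub_eq_zero]; exact this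
    rw [smul_eq_zero] at h2
    exact (sub_eq_zero.1 (h2.resolve_right hx0)).symm
  subst hc1
  rw [one_smul] at hc
  intro a ha
  have hsa : s * a = 0 := by rw [← hσa, ha, map_zero]; rfl
  -- From `s a = 0` one gets `e a = (e - e s)(e a)`, where the left factor has positive degree.
  refine eq_zero_of_eq_mul (Submodule.neg_mem _ hc) ?_
  have hse' : s * (h.e * a) = 0 := by rw [← mul_assoc, hse, hsa]
  rw [neg_sub, sub_mul, ← mul_assoc, h.idem, mul_assoc, hse', mul_zero, sub_zero]

/-- The cover is `e H` shifted by `d`, mapped by `e a ↦ w a`. It is projective as a direct summand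
of `H`, and its kernel is superfluous by `eq_top_of_sup_ker`. -/
theorem exists_isProjCover (h : CornerData (grading K ℓ n) ι)
    {D : GrMod.{u, u, v'} (grading K ℓ n)} {d : ℤ} (hD : D.IsType h.e d) :
    ∃ P : GrMod.{u, u, u} (grading K ℓ n), P.IsProjCover D := by
  obtain ⟨w, hwd, hw0, hwe, hw⟩ := hD
  let R := regular K ℓ n
  let S : R.HomSub := ⟨Submodule.span (CycNilHecke K ℓ n)ᵐᵒᵖ {(h.e : CycNilHecke K ℓ n)},
    R.isHomogeneous_span_singleton h.iSup_eq (x := (h.e : CycNilHecke K ℓ n)) h.e_mem⟩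
  have hS : ∀ a ∈ S.1, h.e * a = a := by
    intro a ha
    obtain ⟨b, rfl⟩ := (R.mem_span_singleton_iff (h.e : CycNilHecke K ℓ n) a).1 ha
    change h.e * (h.e * b) = h.e * b
    rw [← mul_assoc, h.idem]
  have he : (h.e : CycNilHecke K ℓ n) ∈ S.1 :=
    Submodule.mem_span_singleton_self (h.e : CycNilHecke K ℓ n)
  let eb : S.1 := ⟨h.e, he⟩
  have heb : ∀ y : S.1, ∃ a : CycNilHecke K ℓ n, y = eb <• a := by
    intro y
    obtain ⟨a, ha⟩ := (R.mem_span_singleton_iff (h.e : CycNilHecke K ℓ n) y.1).1 y.2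
    exact ⟨a, Subtype.ext ha.symm⟩
  let f : CycNilHecke K ℓ n →ₗ[(CycNilHecke K ℓ n)ᵐᵒᵖ] D.carrier :=
    { toFun := fun a => w <• a
      map_add' := D.ract_add w
      map_smul' := fun b a => D.ract_mul w a b.unop }
  have hprojA : Module.Projective (CycNilHecke K ℓ n)ᵐᵒᵖ (CycNilHecke K ℓ n) :=
    Module.Projective.of_equiv
      ({ toFun := MulOpposite.unop
         invFun := MulOpposite.op
         map_add' := fun _ _ => rfl
         map_smul' := fun _ _ => rfl
         left_inv := fun _ => rfl
         right_inv := fun _ => rfl } :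
        (CycNilHecke K ℓ n)ᵐᵒᵖ ≃ₗ[(CycNilHecke K ℓ n)ᵐᵒᵖ] CycNilHecke K ℓ n)
  refine ⟨(R.sub S).shift d, ?_, f ∘ₗ S.1.subtype, ?_, ?_, ?_⟩
  · let p : CycNilHecke K ℓ n →ₗ[(CycNilHecke K ℓ n)ᵐᵒᵖ] S.1 :=
      { toFun := fun a => ⟨h.e * a, S.1.smul_mem (MulOpposite.op a) he⟩
        map_add' := fun a b => Subtype.ext (mul_add _ _ _)
        map_smul' := fun b a => Subtype.ext (mul_assoc _ _ _).symm }
    exact Module.Projective.of_split S.1.subtype p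
      (LinearMap.ext fun a => Subtype.ext (hS _ a.2))
  · intro y
    obtain ⟨a, rfl⟩ := D.exists_ract_eq h hw y
    refine ⟨eb <• a, ?_⟩
    change w <• (h.e * a) = w <• a
    rw [ract_mul, hwe]
  · intro j x hx
    change w <• (x : CycNilHecke K ℓ n) ∈ D.comp j
    have := D.smul_mem (j - d) d _ _ (show (x : CycNilHecke K ℓ n) ∈ grading K ℓ n (j - d) from hx)
      hwd
    rwa [add_sub_cancel] at this
  · intro N hN
    refine GrMod.eq_top_of_sup_ker (P := (R.sub S).shift d) h (x := eb) (d := d) ?_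
      (Subtype.ext h.idem) (fun y => (heb y).imp fun _ h => h.symm) (f ∘ₗ S.1.subtype) ?_ ?_ hN
    · change h.e ∈ grading K ℓ n (d - d)
      rw [sub_self]; exact h.e_mem
    · change w <• h.e ∈ D.comp d
      rwa [hwe]
    · change w <• h.e ≠ 0
      rwa [hwe]

end GrMod
end ProjectiveCovers

/-! ### Divided differences -/

section DividedDifferences

open MvPolynomial

variable {K : Type u} [Field K] {σ : Type*} [DecidableEq σ]

theorem X_sub_X_dvd_sub_rename_swap (i j : σ) (f : MvPolynomial σ K) :
    (X j - X i) ∣ f - rename (Equiv.swap i j) f := by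
  induction f using MvPolynomial.induction_on with
  | C a => simp
  | add f g hf hg =>
    rw [map_add, add_sub_add_comm]
    exact dvd_add hf hg
  | mul_X f k hf =>
    have h : (X j - X i : MvPolynomial σ K) ∣ X k - X (Equiv.swap i j k) := by
      rcases eq_or_ne k i with rfl | hi
      · rw [Equiv.swap_apply_left]
        exact ⟨-1, by ring⟩
      rcases eq_or_ne k j with rfl | hj
      · rw [Equiv.swap_apply_right]
      · rw [Equiv.swap_apply_of_ne_of_ne hi hj, sub_self]
        exact dvd_zero _
    rw [map_mul, rename_X, show f * X k - rename (Equiv.swap i j) f * X (Equiv.swap i j k) =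
      (f - rename (Equiv.swap i j) f) * X k +
        rename (Equiv.swap i j) f * (X k - X (Equiv.swap i j k)) by ring]
    exact dvd_add (hf.mul_right _) (h.mul_left _)

theorem X_sub_X_ne_zero {σ : Type*} {i j : σ} (h : i ≠ j) : (X j - X i : MvPolynomial σ K) ≠ 0 :=
  sub_ne_zero.2 fun hc => h (X_injective hc).symm

/-- The divided difference `f ↦ (f - s f) / (X_j - X_i)`, where `s` swaps `X_i` and `X_j`. -/
noncomputable def divDiff {i j : σ} (h : i ≠ j) : MvPolynomial σ K →ₗ[K] MvPolynomial σ K where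
  toFun f := (X_sub_X_dvd_sub_rename_swap i j f).choose
  map_add' f g := by
    apply mul_left_cancel₀ (X_sub_X_ne_zero (K := K) h)
    rw [mul_add, ← (X_sub_X_dvd_sub_rename_swap i j f).choose_spec,
      ← (X_sub_X_dvd_sub_rename_swap i j g).choose_spec,
      ← (X_sub_X_dvd_sub_rename_swap i j (f + g)).choose_spec, map_add]
    ring
  map_smul' c f := by
    apply mul_left_cancel₀ (X_sub_X_ne_zero (K := K) h)
    rw [RingHom.id_apply, mul_smul_comm, ← (X_sub_X_dvd_sub_rename_swap i j f).choose_spec,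
      ← (X_sub_X_dvd_sub_rename_swap i j (c • f)).choose_spec, map_smul, smul_sub]

theorem mul_divDiff {i j : σ} (h : i ≠ j) (f : MvPolynomial σ K) :
    (X j - X i) * divDiff h f = f - rename (Equiv.swap i j) f :=
  (X_sub_X_dvd_sub_rename_swap i j f).choose_spec.symm

theorem divDiff_eq_iff {i j : σ} (h : i ≠ j) (f g : MvPolynomial σ K) :
    divDiff h f = g ↔ f - rename (Equiv.swap i j) f = (X j - X i) * g := by
  rw [← mul_divDiff h, mul_right_inj' (X_sub_X_ne_zero h)]

theorem rename_swap_swap (i j : σ) (f : MvPolynomial σ K) :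
    rename (Equiv.swap i j) (rename (Equiv.swap i j) f) = f := by
  rw [rename_rename]
  convert rename_id_apply f
  funext k
  simp

theorem divDiff_divDiff {i j : σ} (h : i ≠ j) (f : MvPolynomial σ K) :
    divDiff h (divDiff h f) = 0 := by
  rw [divDiff_eq_iff, mul_zero, sub_eq_zero]
  apply mul_left_cancel₀ (X_sub_X_ne_zero (K := K) h)
  have h1 := mul_divDiff h f
  have h2 := congrArg (rename (Equiv.swap i j)) h1
  simp only [map_mul, map_sub, rename_X, Equiv.swap_apply_left, Equiv.swap_apply_right,
    rename_swap_swap] at h2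
  linear_combination h1 + h2

theorem divDiff_mul_of_invariant {i j : σ} (h : i ≠ j) (f : MvPolynomial σ K)
    {c : MvPolynomial σ K} (hc : rename (Equiv.swap i j) c = c) :
    divDiff h (f * c) = divDiff h f * c := by
  rw [divDiff_eq_iff, ← mul_assoc, mul_divDiff, map_mul, hc, sub_mul]

theorem divDiff_X_mul_right {i j : σ} (h : i ≠ j) (f : MvPolynomial σ K) :
    divDiff h (X j * f) = X i * divDiff h f + f := by
  rw [divDiff_eq_iff, map_mul, rename_X, Equiv.swap_apply_right]
  linear_combination -X i * mul_divDiff h f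

theorem X_mul_divDiff_right {i j : σ} (h : i ≠ j) (f : MvPolynomial σ K) :
    X j * divDiff h f = divDiff h (X i * f) + f := by
  rw [← sub_eq_iff_eq_add, eq_comm, divDiff_eq_iff, map_mul, rename_X, Equiv.swap_apply_left]
  linear_combination -X j * mul_divDiff h f

theorem divDiff_X_mul_of_ne {i j k : σ} (h : i ≠ j) (hi : k ≠ i) (hj : k ≠ j)
    (f : MvPolynomial σ K) : divDiff h (X k * f) = X k * divDiff h f := by
  rw [mul_comm, divDiff_mul_of_invariant, mul_comm]
  rw [rename_X, Equiv.swap_apply_of_ne_of_ne hi hj]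

theorem divDiff_comm {i j k l : σ} (h : i ≠ j) (h' : k ≠ l) (hik : i ≠ k) (hil : i ≠ l)
    (hjk : j ≠ k) (hjl : j ≠ l) (f : MvPolynomial σ K) :
    divDiff h (divDiff h' f) = divDiff h' (divDiff h f) := by
  have hsw : ∀ g : MvPolynomial σ K, rename (Equiv.swap i j) (rename (Equiv.swap k l) g) =
      rename (Equiv.swap k l) (rename (Equiv.swap i j) g) := by
    intro g
    rw [rename_rename, rename_rename, ← Equiv.Perm.coe_mul, ← Equiv.Perm.coe_mul,
      (Equiv.Perm.disjoint_swap_swap (by simp [*])).commute.eq]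
  apply mul_left_cancel₀ (X_sub_X_ne_zero (K := K) h)
  apply mul_left_cancel₀ (X_sub_X_ne_zero (K := K) h')
  have e1 := mul_divDiff h (divDiff h' f)
  have e2 := mul_divDiff h' (divDiff h f)
  have e3 := mul_divDiff h f
  have e4 := mul_divDiff h' f
  have e5 := congrArg (rename (Equiv.swap i j)) e4
  have e6 := congrArg (rename (Equiv.swap k l)) e3
  simp only [map_mul, map_sub, rename_X, Equiv.swap_apply_of_ne_of_ne hik.symm hjk.symm,
    Equiv.swap_apply_of_ne_of_ne hil.symm hjl.symm, hsw] at e5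
  simp only [map_mul, map_sub, rename_X, Equiv.swap_apply_of_ne_of_ne hik hil,
    Equiv.swap_apply_of_ne_of_ne hjk hjl] at e6
  linear_combination (X l - X k) * e1 - (X j - X i) * e2 + e4 - e5 - e3 + e6

/-- After clearing the denominators `a b (a + b)`, both sides equal the alternating sum of `f` over
the six elements of the group generated by `s` and `t`; these sums agree because `s t s = t s t`. -/
theorem braid_of_difference_quotients {R : Type*} [CommRing R] [IsDomain R] {s t : R →+* R}
    {a b : R} {D E : R → R} (ha : a ≠ 0) (hb : b ≠ 0) (hab : a + b ≠ 0)
    (hD : ∀ f, a * D f = f - s f) (hE : ∀ f, b * E f = f - t f)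
    (hsa : s a = -a) (hsb : s b = a + b) (hta : t a = a + b) (htb : t b = -b)
    (hs : ∀ f, s (s f) = f) (ht : ∀ f, t (t f) = f)
    (hst : ∀ f, s (t (s f)) = t (s (t f))) (f : R) :
    D (E (D f)) = E (D (E f)) := by
  have key : ∀ {s t : R →+* R} {a b : R} {D E : R → R}, a ≠ 0 →
      (∀ f, a * D f = f - s f) → (∀ f, b * E f = f - t f) →
      s a = -a → s b = a + b → t a = a + b →
      (∀ f, s (s f) = f) →
      ∀ f, a * b * (a + b) * D (E (D f)) =
        f - s f - t f + t (s f) + s (t f) - s (t (s f)) := by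
    intro s t a b D E ha hD hE hsa hsb hta hs f
    have h1 := hD f
    -- A divided difference is invariant: numerator and denominator both change sign under `s`.
    have h2 : s (D f) = D f := by
      have := congrArg s h1
      rw [map_mul, map_sub, hs, hsa] at this
      apply mul_left_cancel₀ ha
      linear_combination -this - h1
    have h3 := hE (D f)
    have h4 := congrArg s h3
    rw [map_mul, map_sub, h2, hsb] at h4
    have h5 := hD (E (D f))
    have h6 := congrArg t h1
    rw [map_mul, map_sub, hta] at h6
    have h7 := congrArg s h6
    rw [map_mul, map_sub, map_add, hsa, hsb] at h7
    linear_combination b * (a + b) * h5 + (a + b) * h3 - b * h4 + h1 - h6 + h7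
  have h1 := key (b := b) ha hD hE hsa hsb hta hs f
  have h2 := key (b := a) (s := t) (t := s) hb hE hD htb (by rw [hta, add_comm])
    (by rw [hsb, add_comm]) ht f
  have h3 : a * b * (a + b) ≠ 0 := mul_ne_zero (mul_ne_zero ha hb) hab
  apply mul_left_cancel₀ h3
  linear_combination h1 - h2 - hst f

theorem divDiff_braid {i j k : σ} (hij : i ≠ j) (hjk : j ≠ k) (hik : i ≠ k)
    (f : MvPolynomial σ K) : divDiff hij (divDiff hjk (divDiff hij f)) =
      divDiff hjk (divDiff hij (divDiff hjk f)) := by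
  refine braid_of_difference_quotients (R := MvPolynomial σ K)
    (s := (rename (Equiv.swap i j) : _ →ₐ[K] _).toRingHom)
    (t := (rename (Equiv.swap j k) : _ →ₐ[K] _).toRingHom)
    (X_sub_X_ne_zero hij) (X_sub_X_ne_zero hjk) (a := X j - X i) (b := X k - X j) ?_
    (mul_divDiff hij) (mul_divDiff hjk) ?_ ?_ ?_ ?_ (rename_swap_swap i j) (rename_swap_swap j k)
    ?_ f
  · rw [add_comm, sub_add_sub_cancel]
    exact X_sub_X_ne_zero hik
  · simp [rename_X]
  · simp [rename_X, Equiv.swap_apply_of_ne_of_ne hik.symm hjk.symm]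
  · simp [rename_X, Equiv.swap_apply_of_ne_of_ne hij hik]
  · simp [rename_X]
  · intro f
    simp only [AlgHom.toRingHom_eq_coe, RingHom.coe_coe, rename_rename]
    congr 1
    rw [← Equiv.Perm.coe_mul, ← Equiv.Perm.coe_mul, ← Equiv.Perm.coe_mul, ← Equiv.Perm.coe_mul]
    congr 1
    rw [← mul_assoc, ← mul_assoc, Equiv.swap_mul_swap_mul_swap hij hik, Equiv.swap_comm i j,
      Equiv.swap_comm j k, Equiv.swap_mul_swap_mul_swap hjk.symm hik.symm, Equiv.swap_comm]

/-- Divided differences are linear over invariants, so they preserve an ideal generated by symmetric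
polynomials. -/
theorem divDiff_mem_span {S : Set (MvPolynomial σ K)}
    (hS : ∀ c ∈ S, ∀ π : Equiv.Perm σ, rename π c = c) {i j : σ} (h : i ≠ j)
    {f : MvPolynomial σ K} (hf : f ∈ Ideal.span S) : divDiff h f ∈ Ideal.span S := by
  -- The extra factor `g` is what lets the induction absorb multiplication by ring elements, under
  -- which divided differences are not linear.
  suffices H : ∀ g, divDiff h (g * f) ∈ Ideal.span S by simpa using H 1
  refine Submodule.span_induction (p := fun f _ => ∀ g, divDiff h (g * f) ∈ Ideal.span S)
    ?_ ?_ ?_ ?_ hf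
  · intro c hc g
    rw [divDiff_mul_of_invariant h g (hS c hc _)]
    exact Ideal.mul_mem_left _ _ (Ideal.subset_span hc)
  · simp
  · intro x y _ _ hx hy g
    rw [mul_add, map_add]
    exact Ideal.add_mem _ (hx g) (hy g)
  · intro a x _ hx g
    rw [smul_eq_mul, ← mul_assoc]
    exact hx _

end DividedDifferences

/-! ### Splitting off roots of `X ^ ℓ` -/

section Splitting

open Polynomial

/-- The universal algebra over which `X ^ ℓ` acquires `n` linear factors. -/
theorem exists_splitting (K : Type u) [Field K] (ℓ n : ℕ) (hn : n ≤ ℓ) :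
    ∃ (R : Type u) (_ : CommRing R) (_ : Algebra K R) (z : Fin n → R) (q : R[X]),
      Nontrivial R ∧ q.Monic ∧ q.natDegree = ℓ - n ∧ X ^ ℓ = (∏ i, (X - C (z i))) * q ∧
      Module.finrank K R = ℓ.descFactorial n ∧
      Function.Surjective (MvPolynomial.aeval z : MvPolynomial (Fin n) K →ₐ[K] R) := by
  induction n with
  | zero =>
    refine ⟨K, inferInstance, inferInstance, Fin.elim0, X ^ ℓ, inferInstance, monic_X_pow ℓ,
      by simp, by simp, by simp, fun x => ⟨MvPolynomial.C x, by simp⟩⟩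
  | succ n ih =>
    obtain ⟨R, _, _, z, q, _, hq, hdeg, hX, hrank, hsurj⟩ := ih (by omega)
    have hfr := (AdjoinRoot.powerBasis' hq).finrank
    rw [AdjoinRoot.powerBasis'_dim, hdeg] at hfr
    have hfree : Module.Free R (AdjoinRoot q) :=
      Module.Free.of_basis (AdjoinRoot.powerBasis' hq).basis
    -- The rank over `R` is `ℓ - n`, which is positive since one more root is still to be adjoined.
    have hnt : Nontrivial (AdjoinRoot q) := by
      by_contra hc
      rw [not_nontrivial_iff_subsingleton] at hc
      rw [Module.finrank_zero_of_subsingleton] at hfr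
      omega
    have hroot : (q.map (AdjoinRoot.of q)).IsRoot (AdjoinRoot.root q) := AdjoinRoot.isRoot_root q
    have hdiv := mul_divByMonic_eq_iff_isRoot.2 hroot
    refine ⟨AdjoinRoot q, inferInstance, inferInstance,
      Fin.snoc (fun i => AdjoinRoot.of q (z i)) (AdjoinRoot.root q),
      (q.map (AdjoinRoot.of q)) /ₘ (X - C (AdjoinRoot.root q)), hnt, ?_, ?_, ?_, ?_, ?_⟩
    · refine (monic_X_sub_C (AdjoinRoot.root q)).of_mul_monic_left ?_
      rw [hdiv]
      exact hq.map _
    · rw [natDegree_divByMonic _ (monic_X_sub_C _), natDegree_X_sub_C, hq.natDegree_map, hdeg]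
      omega
    · rw [Fin.prod_univ_castSucc]
      simp only [Fin.snoc_castSucc, Fin.snoc_last]
      rw [mul_assoc, hdiv]
      have := congrArg (Polynomial.map (AdjoinRoot.of q)) hX
      simpa [Polynomial.map_prod] using this
    · rw [← Module.finrank_mul_finrank K R, hrank, hfr, Nat.descFactorial_succ, mul_comm]
    · rw [← AlgHom.range_eq_top, eq_top_iff]
      rintro x -
      obtain ⟨p, rfl⟩ := AdjoinRoot.mk_surjective x
      have hroot' : AdjoinRoot.root q ∈ (MvPolynomial.aeval (R := K)
          (Fin.snoc (α := fun _ => AdjoinRoot q) (fun i => AdjoinRoot.of q (z i))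
            (AdjoinRoot.root q))).range :=
        ⟨MvPolynomial.X (Fin.last n), by simp⟩
      induction p using Polynomial.induction_on' with
      | add p p' hp hp' => rw [map_add]; exact Subalgebra.add_mem _ hp hp'
      | monomial k a =>
        rw [← C_mul_X_pow_eq_monomial, map_mul, map_pow, AdjoinRoot.mk_X, AdjoinRoot.mk_C]
        refine Subalgebra.mul_mem _ ?_ (Subalgebra.pow_mem _ hroot' k)
        obtain ⟨f, rfl⟩ := hsurj a
        refine ⟨MvPolynomial.rename Fin.castSucc f, ?_⟩
        rw [AlgHom.toRingHom_eq_coe, RingHom.coe_coe, MvPolynomial.aeval_rename]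
        have : (Fin.snoc (α := fun _ => AdjoinRoot q) (fun i => AdjoinRoot.of q (z i))
            (AdjoinRoot.root q)) ∘ Fin.castSucc = fun i => AdjoinRoot.of q (z i) := by
          funext i
          simp
        rw [this]
        induction f using MvPolynomial.induction_on with
        | C c =>
          rw [MvPolynomial.aeval_C, MvPolynomial.aeval_C]
          exact IsScalarTower.algebraMap_apply K R (AdjoinRoot q) c
        | add f g hf hg => simp only [map_add, hf, hg]
        | mul_X f i hf => simp only [map_mul, hf, MvPolynomial.aeval_X]

end Splitting

/-! ### The polynomial representation -/

section PolynomialRepresentation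

open MvPolynomial

variable {K : Type u} [Field K]

open scoped IsMulCommutative in
/-- Evaluation of polynomials at commuting elements of a noncommutative algebra. -/
noncomputable def polyHom {σ : Type*} {A : Type*} [Ring A] [Algebra K A] (y : σ → A)
    (hy : ∀ i j, y i * y j = y j * y i) : MvPolynomial σ K →ₐ[K] A :=
  haveI : IsMulCommutative (Algebra.adjoin K (Set.range y)) := Algebra.isMulCommutative_adjoin K
    (by rintro _ ⟨i, rfl⟩ _ ⟨j, rfl⟩; exact hy i j)
  (Algebra.adjoin K (Set.range y)).val.comp
    (aeval fun i => (⟨y i, Algebra.subset_adjoin ⟨i, rfl⟩⟩ : Algebra.adjoin K (Set.range y)))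

@[simp] theorem polyHom_X {σ : Type*} {A : Type*} [Ring A] [Algebra K A] (y : σ → A)
    (hy : ∀ i j, y i * y j = y j * y i) (i : σ) : polyHom (K := K) y hy (X i) = y i := by
  simp [polyHom]

/-- The remainder ideal: the condition that `∏ (t - X_i)` divides `t ^ ℓ`. -/
noncomputable def splittingIdeal (K : Type u) [Field K] (ℓ n : ℕ) :
    Ideal (MvPolynomial (Fin n) K) :=
  Ideal.span (Set.range fun k : ℕ =>
    (Polynomial.X ^ ℓ %ₘ ∏ i : Fin n, (Polynomial.X - Polynomial.C (X i))).coeff k)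

/-- Permuting the variables permutes the factors `T - X_i`, so the coefficients of the remainder are
symmetric. -/
theorem divDiff_mem_splittingIdeal {ℓ n : ℕ} {i j : Fin n} (h : i ≠ j)
    {f : MvPolynomial (Fin n) K} (hf : f ∈ splittingIdeal K ℓ n) :
    divDiff h f ∈ splittingIdeal K ℓ n := by
  refine divDiff_mem_span ?_ h hf
  rintro _ ⟨k, rfl⟩ π
  have hm := Polynomial.monic_prod_of_monic Finset.univ
    (fun i : Fin n => Polynomial.X - Polynomial.C (X i : MvPolynomial (Fin n) K))
    (fun i _ => Polynomial.monic_X_sub_C _)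
  have := Polynomial.map_modByMonic (rename π : MvPolynomial (Fin n) K →ₐ[K] _).toRingHom hm
    (p := Polynomial.X ^ ℓ)
  rw [Polynomial.map_pow, Polynomial.map_X, Polynomial.map_prod] at this
  simp only [AlgHom.toRingHom_eq_coe, Polynomial.map_sub, Polynomial.map_X, Polynomial.map_C,
    RingHom.coe_coe, rename_X] at this
  rw [Equiv.prod_comp π (fun i => Polynomial.X - Polynomial.C (X i : MvPolynomial (Fin n) K))]
    at this
  have h2 := congrArg (fun p => Polynomial.coeff p k) this
  simp only [Polynomial.coeff_map, RingHom.coe_coe] at h2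
  exact h2

/-- Evaluating the division of `T ^ ℓ` at `T = X_i` kills the divisor and leaves the remainder. For
the first variable this is the cyclotomic relation. -/
theorem X_pow_mem_splittingIdeal (ℓ n : ℕ) (i : Fin n) :
    (X i : MvPolynomial (Fin n) K) ^ ℓ ∈ splittingIdeal K ℓ n := by
  have h := Polynomial.modByMonic_add_div (Polynomial.X ^ ℓ)
    (∏ i : Fin n, (Polynomial.X - Polynomial.C (X i : MvPolynomial (Fin n) K)))
  have h2 := congrArg (Polynomial.eval (X i : MvPolynomial (Fin n) K)) h
  rw [Polynomial.eval_add, Polynomial.eval_mul, Polynomial.eval_prod,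
    Finset.prod_eq_zero (s := Finset.univ)
      (f := fun j => Polynomial.eval (X i) (Polynomial.X - Polynomial.C (X j)))
      (Finset.mem_univ i) (by simp), zero_mul, add_zero, Polynomial.eval_pow,
    Polynomial.eval_X] at h2
  rw [← h2, Polynomial.eval_eq_sum_range]
  exact Ideal.sum_mem _ fun k _ => Ideal.mul_mem_right _ _ (Ideal.subset_span ⟨k, rfl⟩)

/-- Division by a monic polynomial commutes with specialisation, and the specialised remainder is
zero. -/
theorem aeval_eq_zero_of_mem_splittingIdeal {ℓ n : ℕ} {R : Type*} [CommRing R] [Algebra K R]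
    {z : Fin n → R} (hz : (∏ i, (Polynomial.X - Polynomial.C (z i))) ∣ Polynomial.X ^ ℓ)
    {f : MvPolynomial (Fin n) K} (hf : f ∈ splittingIdeal K ℓ n) : aeval z f = 0 := by
  have : splittingIdeal K ℓ n ≤ RingHom.ker (aeval z : MvPolynomial (Fin n) K →ₐ[K] R) := by
    refine Ideal.span_le.2 ?_
    rintro _ ⟨k, rfl⟩
    have hm := Polynomial.monic_prod_of_monic Finset.univ
      (fun i : Fin n => Polynomial.X - Polynomial.C (X i : MvPolynomial (Fin n) K))
      (fun i _ => Polynomial.monic_X_sub_C _)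
    have h := Polynomial.map_modByMonic (aeval z : MvPolynomial (Fin n) K →ₐ[K] R).toRingHom hm
      (p := Polynomial.X ^ ℓ)
    rw [Polynomial.map_pow, Polynomial.map_X, Polynomial.map_prod] at h
    simp only [AlgHom.toRingHom_eq_coe, Polynomial.map_sub, Polynomial.map_X, Polynomial.map_C,
      RingHom.coe_coe, aeval_X] at h
    rw [(Polynomial.modByMonic_eq_zero_iff_dvd (Polynomial.monic_prod_of_monic _ _
      fun i _ => Polynomial.monic_X_sub_C _)).2 hz] at h
    have h2 := congrArg (fun p => Polynomial.coeff p k) h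
    simpa [Polynomial.coeff_map] using h2
  exact this hf

/-- The action of a generator on polynomials: divided differences and multiplications. -/
noncomputable def genAction (K : Type u) [Field K] (n : ℕ) :
    NilGen n → Module.End K (MvPolynomial (Fin n) K)
  | .psi r => divDiff (i := ⟨r, by omega⟩) (j := ⟨r + 1, by omega⟩) (by simp)
  | .y i => LinearMap.mulLeft K (X i)

theorem genAction_mem {ℓ n : ℕ} (g : NilGen n) :
    (splittingIdeal K ℓ n).restrictScalars K ≤
      ((splittingIdeal K ℓ n).restrictScalars K).comap (genAction K n g) := by
  intro f hf
  cases g with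
  | psi r => exact divDiff_mem_splittingIdeal (by simp) hf
  | y i => exact Ideal.mul_mem_left _ _ hf

/-- The polynomial representation of the cyclotomic nilHecke algebra. -/
noncomputable def polyRep (K : Type u) [Field K] (ℓ n : ℕ) : CycNilHecke K ℓ n →ₐ[K]
    Module.End K (MvPolynomial (Fin n) K ⧸ (splittingIdeal K ℓ n).restrictScalars K) :=
  RingQuot.liftAlgHom K ⟨FreeAlgebra.lift K
    (fun g => Submodule.mapQ _ _ (genAction K n g) (genAction_mem g)), by
      intro a b h
      refine LinearMap.ext fun x => ?_
      obtain ⟨f, rfl⟩ := Submodule.mkQ_surjective _ x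
      cases h with
      | psi_sq r =>
        simp only [freeGen, map_mul, FreeAlgebra.lift_ι_apply, Module.End.mul_apply,
          Submodule.mkQ_apply, Submodule.mapQ_apply, genAction, divDiff_divDiff, map_zero]
        rfl
      | psi_comm r k h =>
        simp only [freeGen, map_mul, FreeAlgebra.lift_ι_apply, Module.End.mul_apply,
          Submodule.mkQ_apply, Submodule.mapQ_apply, genAction]
        rw [divDiff_comm] <;> simp <;> omega
      | braid r s h =>
        simp only [freeGen, map_mul, FreeAlgebra.lift_ι_apply, Module.End.mul_apply,
          Submodule.mkQ_apply, Submodule.mapQ_apply, genAction, h]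
        rw [divDiff_braid]
        simp only [ne_eq, Fin.mk.injEq]
        omega
      | y_comm i k =>
        simp only [freeGen, map_mul, FreeAlgebra.lift_ι_apply, Module.End.mul_apply,
          Submodule.mkQ_apply, Submodule.mapQ_apply, genAction, LinearMap.mulLeft_apply,
          mul_left_comm]
      | psi_y_comm r k h h' =>
        simp only [freeGen, map_mul, FreeAlgebra.lift_ι_apply, Module.End.mul_apply,
          Submodule.mkQ_apply, Submodule.mapQ_apply, genAction, LinearMap.mulLeft_apply]
        rw [divDiff_X_mul_of_ne _ (by simpa [Fin.ext_iff] using h)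
          (by simpa [Fin.ext_iff] using h')]
      | psi_y r i j hi hj =>
        have hr : r.val + 1 < n := hj ▸ j.2
        obtain rfl : i = ⟨r, Nat.lt_of_succ_lt hr⟩ := Fin.ext hi
        obtain rfl : j = ⟨r + 1, hr⟩ := Fin.ext hj
        simp only [freeGen, map_mul, map_add, map_one, FreeAlgebra.lift_ι_apply,
          Module.End.mul_apply, LinearMap.add_apply, Module.End.one_apply,
          Submodule.mkQ_apply, Submodule.mapQ_apply, genAction, LinearMap.mulLeft_apply,
          divDiff_X_mul_right, Submodule.Quotient.mk_add]
      | y_psi r i j hi hj =>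
        have hr : r.val + 1 < n := hj ▸ j.2
        obtain rfl : i = ⟨r, Nat.lt_of_succ_lt hr⟩ := Fin.ext hi
        obtain rfl : j = ⟨r + 1, hr⟩ := Fin.ext hj
        simp only [freeGen, map_mul, map_add, map_one, FreeAlgebra.lift_ι_apply,
          Module.End.mul_apply, LinearMap.add_apply, Module.End.one_apply,
          Submodule.mkQ_apply, Submodule.mapQ_apply, genAction, LinearMap.mulLeft_apply,
          X_mul_divDiff_right, Submodule.Quotient.mk_add]
      | cyc i h =>
        have key : ∀ k : ℕ, (Submodule.mapQ _ _ (genAction K n (.y i)) (genAction_mem (.y i)) ^ k :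
            Module.End K (MvPolynomial (Fin n) K ⧸ (splittingIdeal K ℓ n).restrictScalars K))
            (Submodule.Quotient.mk f) = Submodule.Quotient.mk (X i ^ k * f) := by
          intro k
          induction k with
          | zero => simp
          | succ k ih =>
            rw [pow_succ', Module.End.mul_apply, ih, Submodule.mapQ_apply]
            simp only [genAction, LinearMap.mulLeft_apply]
            rw [pow_succ', mul_assoc]
        simp only [freeGen, map_pow, FreeAlgebra.lift_ι_apply, Submodule.mkQ_apply, map_zero,
          LinearMap.zero_apply]
        rw [key, Submodule.Quotient.mk_eq_zero]
        exact Ideal.mul_mem_right _ _ (X_pow_mem_splittingIdeal ℓ n i)⟩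

theorem polyRep_gen {ℓ n : ℕ} (g : NilGen n) (f : MvPolynomial (Fin n) K) :
    polyRep K ℓ n (CycNilHecke.gen K ℓ n g) (Submodule.Quotient.mk f) =
      Submodule.Quotient.mk (genAction K n g f) := by
  unfold polyRep
  conv_lhs => rw [CycNilHecke.gen, freeGen, RingQuot.liftAlgHom_mkAlgHom_apply,
    FreeAlgebra.lift_ι_apply]
  rfl

namespace CycNilHecke

theorem y_comm {ℓ n : ℕ} (i k : Fin n) :
    gen K ℓ n (.y i) * gen K ℓ n (.y k) = gen K ℓ n (.y k) * gen K ℓ n (.y i) := by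
  simpa [gen] using rel_eq K ℓ n (.y_comm i k)

/-- The polynomials in `y_1, …, y_n`, as elements of the cyclotomic nilHecke algebra. -/
noncomputable def pol (K : Type u) [Field K] (ℓ n : ℕ) :
    MvPolynomial (Fin n) K →ₐ[K] CycNilHecke K ℓ n :=
  polyHom (fun i => gen K ℓ n (.y i)) y_comm

theorem polyRep_pol {ℓ n : ℕ} (f g : MvPolynomial (Fin n) K) :
    polyRep K ℓ n (pol K ℓ n f) (Submodule.Quotient.mk g) = Submodule.Quotient.mk (f * g) := by
  induction f using MvPolynomial.induction_on generalizing g with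
  | C a =>
    rw [← algebraMap_eq, AlgHom.commutes, AlgHom.commutes, Module.algebraMap_end_apply,
      ← Submodule.Quotient.mk_smul, Algebra.smul_def]
  | add f f' hf hf' =>
    rw [map_add, map_add, LinearMap.add_apply, hf, hf', add_mul, Submodule.Quotient.mk_add]
  | mul_X f i hf =>
    rw [map_mul, map_mul, Module.End.mul_apply, pol, polyHom_X, polyRep_gen, ← pol, hf, mul_assoc]
    rfl

/-- A lower bound for the algebra of polynomials in `y_1, …, y_n`. -/
theorem exists_quotient_of_pol (K : Type u) [Field K] (ℓ n : ℕ) (hn : n ≤ ℓ) :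
    ∃ (R : Type u) (_ : CommRing R) (_ : Algebra K R) (φ : MvPolynomial (Fin n) K →ₐ[K] R),
      Module.finrank K R = ℓ.descFactorial n ∧ Function.Surjective φ ∧
      ∀ f, pol K ℓ n f = 0 → φ f = 0 := by
  obtain ⟨R, _, _, z, q, -, -, -, hX, hrank, hsurj⟩ := exists_splitting K ℓ n hn
  refine ⟨R, _, _, aeval z, hrank, hsurj, fun f hf => ?_⟩
  apply aeval_eq_zero_of_mem_splittingIdeal (Dvd.intro _ hX.symm)
  -- Letting a polynomial act on the class of 1 recovers its class, so a polynomial that vanishes in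
  -- `H` lies in the ideal.
  have := polyRep_pol (ℓ := ℓ) f 1
  rw [hf, map_zero, LinearMap.zero_apply, mul_one, eq_comm, Submodule.Quotient.mk_eq_zero] at this
  exact this

end CycNilHecke

end PolynomialRepresentation

/-! ### The longest element of the nilHecke algebra -/

section LongestElement

/-- The nilHecke relations on `n` strands for two sequences of elements of a ring. -/
structure IsNilHecke {A : Type*} [Ring A] (n : ℕ) (ψ y : ℕ → A) : Prop where
  psi_sq : ∀ r, r + 1 < n → ψ r * ψ r = 0
  psi_comm : ∀ r k, k + 1 < r → r + 1 < n → ψ r * ψ k = ψ k * ψ r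
  braid : ∀ r, r + 2 < n → ψ r * ψ (r + 1) * ψ r = ψ (r + 1) * ψ r * ψ (r + 1)
  y_comm : ∀ i k, i < n → k < n → y i * y k = y k * y i
  psi_y_comm : ∀ r k, r + 1 < n → k < n → k ≠ r → k ≠ r + 1 → ψ r * y k = y k * ψ r
  psi_y : ∀ r, r + 1 < n → ψ r * y (r + 1) = y r * ψ r + 1
  y_psi : ∀ r, r + 1 < n → y (r + 1) * ψ r = ψ r * y r + 1

variable {A : Type*} [Ring A] (ψ y : ℕ → A)

/-- The product `ψ_s ψ_{s+1} ⋯ ψ_{s+k-1}`. -/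
def psiWord (s : ℕ) : ℕ → A
  | 0 => 1
  | k + 1 => ψ s * psiWord (s + 1) k

/-- The product of the `ψ`s over a reduced word of the longest permutation of `m` strands. -/
def longElt : ℕ → A
  | 0 => 1
  | m + 1 => psiWord ψ 0 m * longElt m

variable {ψ y}

theorem psiWord_succ_right (s k : ℕ) : psiWord ψ s (k + 1) = psiWord ψ s k * ψ (s + k) := by
  induction k generalizing s with
  | zero => simp [psiWord]
  | succ k ih =>
    rw [psiWord, ih, psiWord, mul_assoc, show s + 1 + k = s + (k + 1) by ring]

theorem commute_psiWord {x : A} {s k : ℕ} (h : ∀ j, s ≤ j → j < s + k → Commute x (ψ j)) :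
    Commute x (psiWord ψ s k) := by
  induction k generalizing s with
  | zero => exact Commute.one_right x
  | succ k ih =>
    exact (h s le_rfl (by omega)).mul_right (ih fun j hj hj' => h j (by omega) (by omega))

theorem commute_longElt {x : A} {m : ℕ} (h : ∀ j, j + 1 < m → Commute x (ψ j)) :
    Commute x (longElt ψ m) := by
  induction m with
  | zero => exact Commute.one_right x
  | succ m ih =>
    exact (commute_psiWord fun j _ hj => h j (by omega)).mul_right
      (ih fun j hj => h j (by omega))

namespace IsNilHecke

variable {n : ℕ} (H : IsNilHecke n ψ y)
include H

theorem commute_psi {r k : ℕ} (hr : r + 1 < n) (hk : k + 1 < n) (h : k + 1 < r ∨ r + 1 < k) :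
    Commute (ψ r) (ψ k) := by
  rcases h with h | h
  · exact H.psi_comm r k h hr
  · exact (H.psi_comm k r h hk).symm

/-- The braid relation is used where the word meets `ψ_j`; the remaining factors commute because
they are distant. -/
theorem psiWord_mul_psi {s k j : ℕ} (hj : s ≤ j) (hjk : j + 1 < s + k) (hn : s + k < n) :
    psiWord ψ s k * ψ j = ψ (j + 1) * psiWord ψ s k := by
  induction k generalizing s with
  | zero => omega
  | succ k ih =>
    rcases hj.eq_or_lt with rfl | hj'
    · obtain ⟨k, rfl⟩ : ∃ k', k = k' + 1 := ⟨k - 1, by omega⟩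
      have hc : Commute (ψ s) (psiWord ψ (s + 1 + 1) k) :=
        commute_psiWord fun i hi hi' => H.commute_psi (by omega) (by omega) (by omega)
      simp only [psiWord]
      rw [mul_assoc, mul_assoc, ← hc.eq, ← mul_assoc, ← mul_assoc, H.braid s (by omega)]
      simp only [mul_assoc]
    · rw [psiWord, mul_assoc, ih hj' (by omega) (by omega), ← mul_assoc,
        (H.commute_psi (r := s) (k := j + 1) (by omega) (by omega) (by omega)).eq, mul_assoc]

theorem psiWord_mul_psiWord {k s l : ℕ} (h : s + l ≤ k) (hn : k + 1 < n) :
    psiWord ψ 0 (k + 1) * psiWord ψ s l = psiWord ψ (s + 1) l * psiWord ψ 0 (k + 1) := by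
  induction l generalizing s with
  | zero => simp [psiWord]
  | succ l ih =>
    simp only [psiWord]
    have h1 := H.psiWord_mul_psi (s := 0) (k := k + 1) (j := s) (by omega) (by omega) (by omega)
    have h2 := ih (s := s + 1) (by omega)
    rw [psiWord] at h1 h2
    rw [← mul_assoc, h1, mul_assoc, h2, mul_assoc]

theorem psi_mul_longElt {m r : ℕ} (hm : m ≤ n) (hr : r + 1 < m) : ψ r * longElt ψ m = 0 := by
  induction m generalizing r with
  | zero => omega
  | succ m ih =>
    rw [longElt]
    rcases r with _ | r
    · obtain ⟨m, rfl⟩ : ∃ k, m = k + 1 := ⟨m - 1, by omega⟩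
      rw [psiWord, ← mul_assoc, ← mul_assoc, H.psi_sq 0 (by omega), zero_mul, zero_mul]
    · rw [← mul_assoc, ← H.psiWord_mul_psi (by omega) (by omega) (by omega), mul_assoc,
        ih (by omega) (by omega), mul_zero]

/-- The defining word makes only the last `ψ` nontrivial. -/
theorem longElt_mul_psi {m r : ℕ} (hm : m ≤ n) (hr : r + 1 < m) : longElt ψ m * ψ r = 0 := by
  induction m with
  | zero => omega
  | succ m ih =>
    by_cases h : r + 1 < m
    · rw [longElt, mul_assoc, ih (by omega) h, mul_zero]
    · obtain rfl : m = r + 1 := by omega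
      have hc : Commute (ψ r) (longElt ψ r) :=
        commute_longElt fun j hj => H.commute_psi (by omega) (by omega) (by omega)
      -- Moving the second descending block through the first turns the product into one containing
      -- the square of `ψ_r`.
      have h1 := H.psiWord_mul_psiWord (k := r) (s := 0) (l := r) (by omega) (by omega)
      have h2 := psiWord_succ_right (ψ := ψ) 0 r
      rw [zero_add] at h2
      rw [longElt, longElt, mul_assoc, mul_assoc, ← hc.eq, ← mul_assoc (psiWord ψ 0 r),
        ← mul_assoc, ← mul_assoc (psiWord ψ 0 (r + 1)), h1, mul_assoc (psiWord ψ (0 + 1) r), h2,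
        mul_assoc (psiWord ψ 0 r), H.psi_sq r (by omega)]
      simp

/-- Sliding `y_m` leftwards through the word leaves `y_j` in front plus correction terms. All but
one correction end with some `ψ_j` reaching the long element, which it kills. -/
theorem psiWord_mul_y {m j k : ℕ} (hm : m < n) (hj : j + (k + 1) = m) :
    psiWord ψ j (k + 1) * (y m * longElt ψ m) =
      y j * (psiWord ψ j (k + 1) * longElt ψ m) + psiWord ψ (j + 1) k * longElt ψ m := by
  induction k generalizing j with
  | zero =>
    subst hj
    simp only [psiWord, mul_one, one_mul, zero_add]
    rw [← mul_assoc, H.psi_y j (by omega), add_mul, one_mul, mul_assoc]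
  | succ k ih =>
    have hc : Commute (ψ j) (psiWord ψ (j + 1 + 1) k) :=
      commute_psiWord fun i hi hi' => H.commute_psi (by omega) (by omega) (by omega)
    rw [psiWord, mul_assoc, ih (by omega), mul_add, ← mul_assoc (ψ j) (y (j + 1)),
      H.psi_y j (by omega), ← mul_assoc (ψ j) (psiWord ψ (j + 1 + 1) k), hc.eq,
      mul_assoc _ (ψ j) (longElt ψ m), H.psi_mul_longElt (by omega) (by omega), mul_zero, add_zero,
      add_mul, one_mul]
    simp only [mul_assoc]

end IsNilHecke

variable (y) in
/-- The coefficients of `∏_{i < j} (T - y_i)`. -/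
def rootCoef : ℕ → ℕ → A
  | 0, 0 => 1
  | 0, _ + 1 => 0
  | j + 1, 0 => -(y j * rootCoef j 0)
  | j + 1, k + 1 => rootCoef j k - y j * rootCoef j (k + 1)

theorem rootCoef_eq_zero {j k : ℕ} (h : j < k) : rootCoef y j k = 0 := by
  induction j generalizing k with
  | zero =>
    obtain ⟨k, rfl⟩ : ∃ k', k = k' + 1 := ⟨k - 1, by omega⟩
    rfl
  | succ j ih =>
    obtain ⟨k, rfl⟩ : ∃ k', k = k' + 1 := ⟨k - 1, by omega⟩
    rw [rootCoef, ih (by omega), ih (by omega), mul_zero, sub_zero]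

/-- By `psiWord_mul_y`, deleting the first letter of the word amounts to right multiplication by
`y_m` minus left multiplication by `y_j`. Iterating from the full word gives `∏ (T - y_i)` with `T`
acting as `y_m` from the right. -/
theorem IsNilHecke.psiWord_mul_longElt_eq_sum {n : ℕ} (H : IsNilHecke n ψ y) {m j k : ℕ}
    (hm : m < n) (hj : j + k = m) : psiWord ψ j k * longElt ψ m =
      ∑ i ∈ Finset.range (j + 1), rootCoef y j i * longElt ψ (m + 1) * y m ^ i := by
  induction j generalizing k with
  | zero =>
    obtain rfl : k = m := by omega
    simp [rootCoef, longElt]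
  | succ j ih =>
    have hc : Commute (y m) (longElt ψ m) := commute_longElt fun i hi =>
      (H.psi_y_comm i m (by omega) hm (by omega) (by omega)).symm
    have h1 := H.psiWord_mul_y (m := m) (j := j) (k := k) hm (by omega)
    rw [hc.eq, ← mul_assoc, ih (by omega)] at h1
    rw [← sub_eq_iff_eq_add'] at h1
    have e1 : y j * ∑ i ∈ Finset.range (j + 1), rootCoef y j i * longElt ψ (m + 1) * y m ^ i =
        ∑ i ∈ Finset.range (j + 1 + 1), y j * rootCoef y j i * longElt ψ (m + 1) * y m ^ i := by
      rw [Finset.sum_range_succ _ (j + 1), rootCoef_eq_zero (Nat.lt_succ_self j), Finset.mul_sum]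
      simp [mul_assoc]
    have e2 : (∑ i ∈ Finset.range (j + 1), rootCoef y j i * longElt ψ (m + 1) * y m ^ i) * y m =
        ∑ i ∈ Finset.range (j + 1), rootCoef y j i * longElt ψ (m + 1) * y m ^ (i + 1) := by
      rw [Finset.sum_mul]
      simp [mul_assoc, pow_succ]
    rw [← h1, e1, e2, Finset.sum_range_succ' _ (j + 1), Finset.sum_range_succ' _ (j + 1),
      ← sub_sub, ← Finset.sum_sub_distrib]
    simp [rootCoef, add_mul, sub_eq_add_neg]

/-- The index set `{0} × {0, 1} × ⋯ × {0, …, m - 1}`. -/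
def StairIdx : ℕ → Type
  | 0 => Unit
  | m + 1 => StairIdx m × Fin (m + 1)

namespace StairIdx

instance instFintype : (m : ℕ) → Fintype (StairIdx m)
  | 0 => inferInstanceAs (Fintype Unit)
  | m + 1 => letI := instFintype m; inferInstanceAs (Fintype (StairIdx m × Fin (m + 1)))

/-- The sum of the entries. -/
def total : (m : ℕ) → StairIdx m → ℕ
  | 0, _ => 0
  | m + 1, a => total m a.1 + a.2

/-- The zero sequence. -/
def zero : (m : ℕ) → StairIdx m
  | 0 => ()
  | m + 1 => (zero m, 0)

theorem eq_zero_of_total {m : ℕ} {a : StairIdx m} (h : total m a = 0) : a = zero m := by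
  induction m with
  | zero => rfl
  | succ m ih =>
    obtain ⟨a, k⟩ := a
    simp only [total, Nat.add_eq_zero_iff] at h
    exact Prod.ext (ih h.1) (Fin.ext h.2)

theorem total_zero (m : ℕ) : total m (zero m) = 0 := by
  induction m with
  | zero => rfl
  | succ m ih => simp [total, zero, ih]

theorem card (m : ℕ) : Fintype.card (StairIdx m) = m.factorial := by
  induction m with
  | zero => rfl
  | succ m ih =>
    have : Fintype.card (StairIdx (m + 1)) = Fintype.card (StairIdx m × Fin (m + 1)) := rfl
    rw [this, Fintype.card_prod, ih, Fintype.card_fin, Nat.factorial_succ, mul_comm]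

variable (y)

/-- The monomial `∏ y_i ^ {a_i}`. -/
def monomial : (m : ℕ) → StairIdx m → A
  | 0, _ => 1
  | m + 1, a => y m ^ (a.2 : ℕ) * monomial m a.1

/-- The coefficients dual to the monomials. -/
def dual : (m : ℕ) → StairIdx m → A
  | 0, _ => 1
  | m + 1, a => dual m a.1 * rootCoef y m a.2

/-- Deleting the whole word in `psiWord_mul_longElt_eq_sum` expresses the long element on `m`
strands through the one on `m + 1` strands. Descending to zero strands, where it is 1, gives the
decomposition of the unit that makes the idempotent full. -/
theorem sum_dual_mul_longElt {n : ℕ} (H : IsNilHecke n ψ y) {m : ℕ} (hm : m ≤ n) :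
    ∑ a : StairIdx m, dual y m a * longElt ψ m * monomial y m a = 1 := by
  induction m with
  | zero =>
    have : ∑ a : StairIdx 0, dual y 0 a * longElt ψ 0 * monomial y 0 a =
      ∑ a : Unit, (1 : A) * 1 * 1 := rfl
    rw [this]
    simp
  | succ m ih =>
    have : ∑ a : StairIdx (m + 1), dual y (m + 1) a * longElt ψ (m + 1) * monomial y (m + 1) a =
      ∑ a : StairIdx m × Fin (m + 1), dual y m a.1 * rootCoef y m a.2 * longElt ψ (m + 1) *
        (y m ^ (a.2 : ℕ) * monomial y m a.1) := rfl
    rw [this, Fintype.sum_prod_type, ← ih (by omega)]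
    refine Finset.sum_congr rfl fun a _ => ?_
    have h1 := H.psiWord_mul_longElt_eq_sum (m := m) (j := m) (k := 0) (by omega) (by omega)
    rw [psiWord, one_mul, ← Fin.sum_univ_eq_sum_range
      (fun i => rootCoef y m i * longElt ψ (m + 1) * y m ^ i)] at h1
    rw [h1, Finset.mul_sum, Finset.sum_mul]
    simp only [mul_assoc]

theorem monomial_mem {K : Type*} [Field K] [Algebra K A] {D : ℤ → Submodule K A}
    (h1 : 1 ∈ D 0) (hmul : ∀ {i j a b}, a ∈ D i → b ∈ D j → a * b ∈ D (i + j))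
    (hpow : ∀ {i a} (k : ℕ), a ∈ D i → a ^ k ∈ D (k * i)) {n m : ℕ} (hm : m ≤ n)
    (hy : ∀ i < n, y i ∈ D 2) (a : StairIdx m) : monomial y m a ∈ D (2 * total m a) := by
  induction m with
  | zero => exact h1
  | succ m ih =>
    have := hmul (hpow (a.2 : ℕ) (hy m (by omega))) (ih (by omega) a.1)
    convert this using 1
    simp only [total]
    push_cast
    ring_nf
    rfl

theorem rootCoef_mem {K : Type*} [Field K] [Algebra K A] {D : ℤ → Submodule K A}
    (h1 : 1 ∈ D 0) (hmul : ∀ {i j a b}, a ∈ D i → b ∈ D j → a * b ∈ D (i + j)) {n : ℕ}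
    (hy : ∀ i < n, y i ∈ D 2) {j k : ℕ} (hj : j ≤ n) :
    rootCoef y j k ∈ D (2 * ((j : ℤ) - k)) := by
  induction j generalizing k with
  | zero =>
    cases k with
    | zero => exact h1
    | succ k => exact Submodule.zero_mem _
  | succ j ih =>
    have h2 : ∀ k : ℕ, y j * rootCoef y j k ∈ D (2 * (((j + 1 : ℕ) : ℤ) - k)) := by
      intro k
      have := hmul (hy j (by omega)) (ih (k := k) (by omega))
      rwa [show 2 + 2 * ((j : ℤ) - k) = 2 * (((j + 1 : ℕ) : ℤ) - k) by push_cast; ring] at this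
    cases k with
    | zero => exact Submodule.neg_mem _ (h2 0)
    | succ k =>
      refine Submodule.sub_mem _ ?_ (h2 _)
      have := ih (k := k) (by omega)
      rwa [show 2 * ((j : ℤ) - k) = 2 * (((j + 1 : ℕ) : ℤ) - ((k + 1 : ℕ) : ℤ)) by
        push_cast; ring] at this

theorem dual_mem {K : Type*} [Field K] [Algebra K A] {D : ℤ → Submodule K A}
    (h1 : 1 ∈ D 0) (hmul : ∀ {i j a b}, a ∈ D i → b ∈ D j → a * b ∈ D (i + j)) {n m : ℕ}
    (hm : m ≤ n) (hy : ∀ i < n, y i ∈ D 2) (a : StairIdx m) :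
    dual y m a ∈ D (m * (m - 1) - 2 * total m a) := by
  induction m with
  | zero => exact h1
  | succ m ih =>
    have := hmul (ih (by omega) a.1) (rootCoef_mem y h1 hmul hy (j := m) (k := a.2) (by omega))
    convert this using 1
    simp only [total]
    push_cast
    ring_nf
    rfl

end StairIdx

theorem psiWord_mem {K : Type*} [Field K] [Algebra K A] {D : ℤ → Submodule K A}
    (h1 : 1 ∈ D 0) (hmul : ∀ {i j a b}, a ∈ D i → b ∈ D j → a * b ∈ D (i + j)) {n : ℕ}
    (hψ : ∀ i, i + 1 < n → ψ i ∈ D (-2)) {s k : ℕ} (hs : s + k < n) :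
    psiWord ψ s k ∈ D (-2 * k) := by
  induction k generalizing s with
  | zero => simpa [psiWord] using h1
  | succ k ih =>
    have := hmul (hψ s (by omega)) (ih (s := s + 1) (by omega))
    rwa [show -2 + -2 * (k : ℤ) = -2 * ((k + 1 : ℕ) : ℤ) by push_cast; ring] at this

theorem longElt_mem {K : Type*} [Field K] [Algebra K A] {D : ℤ → Submodule K A}
    (h1 : 1 ∈ D 0) (hmul : ∀ {i j a b}, a ∈ D i → b ∈ D j → a * b ∈ D (i + j)) {n m : ℕ}
    (hψ : ∀ i, i + 1 < n → ψ i ∈ D (-2)) (hm : m ≤ n) :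
    longElt ψ m ∈ D (-(m * (m - 1))) := by
  induction m with
  | zero => simpa [longElt] using h1
  | succ m ih =>
    have := hmul (psiWord_mem h1 hmul hψ (s := 0) (k := m) (by omega)) (ih (by omega))
    rwa [show -2 * (m : ℤ) + -(m * (m - 1)) = -(((m + 1 : ℕ) : ℤ) * (((m + 1 : ℕ) : ℤ) - 1)) by
      push_cast; ring] at this

end LongestElement

/-! ### The idempotent of the cyclotomic nilHecke algebra -/

namespace CycNilHecke

section Idempotent

open MvPolynomial

variable (K : Type u) [Field K] (ℓ n : ℕ)

/-- The generators `ψ`, indexed by natural numbers. -/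
noncomputable def psiN (r : ℕ) : CycNilHecke K ℓ n :=
  if h : r < n - 1 then gen K ℓ n (.psi ⟨r, h⟩) else 0

/-- The generators `y`, indexed by natural numbers. -/
noncomputable def yN (i : ℕ) : CycNilHecke K ℓ n :=
  if h : i < n then gen K ℓ n (.y ⟨i, h⟩) else 0

theorem isNilHecke : IsNilHecke n (psiN K ℓ n) (yN K ℓ n) where
  psi_sq r h := by
    simpa [psiN, show r < n - 1 by omega, gen] using rel_eq K ℓ n (.psi_sq ⟨r, by omega⟩)
  psi_comm r k h h' := by
    simpa [psiN, show r < n - 1 by omega, show k < n - 1 by omega, gen] using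
      rel_eq K ℓ n (.psi_comm ⟨r, by omega⟩ ⟨k, by omega⟩ h)
  braid r h := by
    simpa [psiN, show r < n - 1 by omega, show r + 1 < n - 1 by omega, gen] using
      rel_eq K ℓ n (.braid ⟨r, by omega⟩ ⟨r + 1, by omega⟩ rfl)
  y_comm i k hi hk := by
    simpa [yN, hi, hk, gen] using rel_eq K ℓ n (.y_comm ⟨i, hi⟩ ⟨k, hk⟩)
  psi_y_comm r k hr hk h h' := by
    simpa [psiN, yN, show r < n - 1 by omega, hk, gen] using
      rel_eq K ℓ n (.psi_y_comm ⟨r, by omega⟩ ⟨k, hk⟩ h h')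
  psi_y r hr := by
    simpa [psiN, yN, show r < n - 1 by omega, show r < n by omega, hr, gen] using
      rel_eq K ℓ n (.psi_y ⟨r, by omega⟩ ⟨r, by omega⟩ ⟨r + 1, hr⟩ rfl rfl)
  y_psi r hr := by
    simpa [psiN, yN, show r < n - 1 by omega, show r < n by omega, hr, gen] using
      rel_eq K ℓ n (.y_psi ⟨r, by omega⟩ ⟨r, by omega⟩ ⟨r + 1, hr⟩ rfl rfl)

theorem psiN_mem (r : ℕ) : psiN K ℓ n r ∈ grading K ℓ n (-2) := by
  by_cases h : r < n - 1
  · rw [psiN, dif_pos h]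
    exact gen_mem K ℓ n (.psi ⟨r, h⟩)
  · rw [psiN, dif_neg h]
    exact (grading K ℓ n (-2)).zero_mem

theorem yN_mem (i : ℕ) : yN K ℓ n i ∈ grading K ℓ n 2 := by
  by_cases h : i < n
  · rw [yN, dif_pos h]
    exact gen_mem K ℓ n (.y ⟨i, h⟩)
  · rw [yN, dif_neg h]
    exact (grading K ℓ n 2).zero_mem

variable {K ℓ n}

theorem pol_X (i : Fin n) : pol K ℓ n (X i) = yN K ℓ n i := by
  simp [pol, yN]

theorem yN_mem_range (i : ℕ) : yN K ℓ n i ∈ (pol K ℓ n).range := by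
  by_cases h : i < n
  · exact ⟨X ⟨i, h⟩, pol_X _⟩
  · rw [yN, dif_neg h]
    exact Subalgebra.zero_mem _

theorem pol_commute (f g : MvPolynomial (Fin n) K) :
    pol K ℓ n f * pol K ℓ n g = pol K ℓ n g * pol K ℓ n f := by
  rw [← map_mul, mul_comm, map_mul]

/-- Induction over the words in the generators. -/
theorem induction_gen {C : CycNilHecke K ℓ n → Prop}
    (hC : ∀ c : K, C (algebraMap K _ c)) (hψ : ∀ r, r + 1 < n → C (psiN K ℓ n r))
    (hy : ∀ i : Fin n, C (yN K ℓ n i)) (hmul : ∀ a b, C a → C b → C (a * b))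
    (hadd : ∀ a b, C a → C b → C (a + b)) (x : CycNilHecke K ℓ n) : C x := by
  obtain ⟨x, rfl⟩ := RingQuot.mkAlgHom_surjective K (NilRel K ℓ n) x
  induction x using FreeAlgebra.induction with
  | grade0 r => rw [AlgHom.commutes]; exact hC r
  | grade1 g =>
    cases g with
    | psi r =>
      have := hψ r (by omega)
      rw [psiN, dif_pos r.2] at this
      exact this
    | y i =>
      have := hy i
      rw [yN, dif_pos i.2] at this
      exact this
  | mul a b ha hb => rw [map_mul]; exact hmul _ _ ha hb
  | add a b ha hb => rw [map_add]; exact hadd _ _ ha hb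

theorem exists_psi_mul_pol {r : ℕ} (hr : r + 1 < n) (f : MvPolynomial (Fin n) K) :
    ∃ f' f'', psiN K ℓ n r * pol K ℓ n f = pol K ℓ n f' * psiN K ℓ n r + pol K ℓ n f'' := by
  have H := isNilHecke K ℓ n
  induction f using MvPolynomial.induction_on with
  | C a =>
    refine ⟨C a, 0, ?_⟩
    rw [← algebraMap_eq, AlgHom.commutes, map_zero, add_zero, Algebra.commutes]
  | add f g hf hg =>
    obtain ⟨f1, f2, hf⟩ := hf
    obtain ⟨g1, g2, hg⟩ := hg
    refine ⟨f1 + g1, f2 + g2, ?_⟩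
    rw [map_add, mul_add, hf, hg, map_add, map_add, add_mul]
    abel
  | mul_X f i hf =>
    obtain ⟨f1, f2, hf⟩ := hf
    rw [map_mul, ← mul_assoc, hf, add_mul, pol_X, mul_assoc]
    by_cases h1 : (i : ℕ) = r
    · refine ⟨f1 * X ⟨r + 1, hr⟩, f2 * X i - f1, ?_⟩
      have h2 := H.y_psi r hr
      rw [← sub_eq_iff_eq_add] at h2
      rw [h1, ← h2, map_mul, map_sub, map_mul, pol_X, pol_X, h1, mul_sub, mul_assoc, mul_one]
      abel
    by_cases h2 : (i : ℕ) = r + 1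
    · refine ⟨f1 * X ⟨r, by omega⟩, f2 * X i + f1, ?_⟩
      rw [h2, H.psi_y r hr, map_mul, map_add, map_mul, pol_X, pol_X, h2, mul_add, mul_assoc,
        mul_one]
      abel
    · refine ⟨f1 * X i, f2 * X i, ?_⟩
      rw [H.psi_y_comm r i hr i.2 h1 h2, map_mul, map_mul, pol_X, mul_assoc]

theorem exists_pol_mul_psi {r : ℕ} (hr : r + 1 < n) (f : MvPolynomial (Fin n) K) :
    ∃ f' f'', pol K ℓ n f * psiN K ℓ n r = psiN K ℓ n r * pol K ℓ n f' + pol K ℓ n f'' := by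
  have H := isNilHecke K ℓ n
  induction f using MvPolynomial.induction_on with
  | C a =>
    refine ⟨C a, 0, ?_⟩
    rw [← algebraMap_eq, AlgHom.commutes, map_zero, add_zero, Algebra.commutes]
  | add f g hf hg =>
    obtain ⟨f1, f2, hf⟩ := hf
    obtain ⟨g1, g2, hg⟩ := hg
    refine ⟨f1 + g1, f2 + g2, ?_⟩
    rw [map_add, add_mul, hf, hg, map_add, map_add, mul_add]
    abel
  | mul_X f i hf =>
    obtain ⟨f1, f2, hf⟩ := hf
    rw [mul_comm, map_mul, mul_assoc, hf, mul_add, pol_X, ← mul_assoc]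
    by_cases h1 : (i : ℕ) = r
    · refine ⟨X ⟨r + 1, hr⟩ * f1, X i * f2 - f1, ?_⟩
      have h2 := H.psi_y r hr
      rw [← sub_eq_iff_eq_add] at h2
      rw [h1, ← h2, map_mul, map_sub, map_mul, pol_X, pol_X, h1, sub_mul, mul_assoc, one_mul]
      abel
    by_cases h2 : (i : ℕ) = r + 1
    · refine ⟨X ⟨r, by omega⟩ * f1, X i * f2 + f1, ?_⟩
      rw [h2, H.y_psi r hr, map_mul, map_add, map_mul, pol_X, pol_X, h2, add_mul, mul_assoc,
        one_mul]
      abel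
    · refine ⟨X i * f1, X i * f2, ?_⟩
      rw [← H.psi_y_comm r i hr i.2 h1 h2, map_mul, map_mul, pol_X, mul_assoc]

variable (K ℓ n) in
/-- The product of the `ψ`s over a reduced word of the longest permutation. -/
noncomputable def longest : CycNilHecke K ℓ n := longElt (psiN K ℓ n) n

theorem longest_mul_psi {r : ℕ} (hr : r + 1 < n) : longest K ℓ n * psiN K ℓ n r = 0 :=
  (isNilHecke K ℓ n).longElt_mul_psi le_rfl hr

theorem psi_mul_longest {r : ℕ} (hr : r + 1 < n) : psiN K ℓ n r * longest K ℓ n = 0 :=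
  (isNilHecke K ℓ n).psi_mul_longElt le_rfl hr

theorem longest_mem : longest K ℓ n ∈ grading K ℓ n (-(n * (n - 1))) :=
  longElt_mem (one_mem K ℓ n) (mul_mem K ℓ n) (fun i _ => psiN_mem K ℓ n i) le_rfl

/-- Every `ψ_r` can be moved left past polynomials up to a polynomial remainder, and there it is
killed by the longest element. -/
theorem exists_longest_mul (a : CycNilHecke K ℓ n) :
    ∃ f, longest K ℓ n * a = longest K ℓ n * pol K ℓ n f := by
  suffices H : ∀ g, ∃ f, longest K ℓ n * pol K ℓ n g * a = longest K ℓ n * pol K ℓ n f by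
    simpa using H 1
  induction a using induction_gen with
  | hC c =>
    intro g
    refine ⟨g * C c, ?_⟩
    rw [map_mul, ← algebraMap_eq, AlgHom.commutes, mul_assoc]
  | hψ r hr =>
    intro g
    obtain ⟨g1, g2, hg⟩ := exists_pol_mul_psi (ℓ := ℓ) hr g
    refine ⟨g2, ?_⟩
    rw [mul_assoc, hg, mul_add, ← mul_assoc, longest_mul_psi hr, zero_mul, zero_add]
  | hy i =>
    intro g
    refine ⟨g * X i, ?_⟩
    rw [map_mul, pol_X, mul_assoc]
  | hmul a b ha hb =>
    intro g
    obtain ⟨f, hf⟩ := ha g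
    obtain ⟨f', hf'⟩ := hb f
    exact ⟨f', by rw [← mul_assoc, hf, hf']⟩
  | hadd a b ha hb =>
    intro g
    obtain ⟨f, hf⟩ := ha g
    obtain ⟨f', hf'⟩ := hb g
    exact ⟨f + f', by rw [mul_add, hf, hf', map_add, mul_add]⟩

theorem exists_mul_longest (a : CycNilHecke K ℓ n) :
    ∃ f, a * longest K ℓ n = pol K ℓ n f * longest K ℓ n := by
  suffices H : ∀ g, ∃ f, a * (pol K ℓ n g * longest K ℓ n) = pol K ℓ n f * longest K ℓ n by
    simpa using H 1
  induction a using induction_gen with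
  | hC c =>
    intro g
    refine ⟨C c * g, ?_⟩
    rw [map_mul, ← algebraMap_eq, AlgHom.commutes, mul_assoc]
  | hψ r hr =>
    intro g
    obtain ⟨g1, g2, hg⟩ := exists_psi_mul_pol (ℓ := ℓ) hr g
    refine ⟨g2, ?_⟩
    rw [← mul_assoc, hg, add_mul, mul_assoc, psi_mul_longest hr, mul_zero, zero_add]
  | hy i =>
    intro g
    refine ⟨X i * g, ?_⟩
    rw [map_mul, pol_X, mul_assoc]
  | hmul a b ha hb =>
    intro g
    obtain ⟨f, hf⟩ := hb g
    obtain ⟨f', hf'⟩ := ha f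
    exact ⟨f', by rw [mul_assoc, hf, hf']⟩
  | hadd a b ha hb =>
    intro g
    obtain ⟨f, hf⟩ := ha g
    obtain ⟨f', hf'⟩ := hb g
    exact ⟨f + f', by rw [add_mul, hf, hf', map_add, add_mul]⟩

theorem exists_pol_sub_mem (f : MvPolynomial (Fin n) K) :
    ∃ c : K, pol K ℓ n f - algebraMap K _ c ∈ ⨆ i : Set.Ioi (0 : ℤ), grading K ℓ n i := by
  induction f using MvPolynomial.induction_on with
  | C a => exact ⟨a, by rw [← algebraMap_eq, AlgHom.commutes, sub_self]; exact Submodule.zero_mem _⟩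
  | add f g hf hg =>
    obtain ⟨c, hc⟩ := hf
    obtain ⟨c', hc'⟩ := hg
    refine ⟨c + c', ?_⟩
    rw [map_add, map_add, add_sub_add_comm]
    exact Submodule.add_mem _ hc hc'
  | mul_X f i hf =>
    obtain ⟨c, hc⟩ := hf
    refine ⟨0, ?_⟩
    rw [map_zero, sub_zero, map_mul, pol_X]
    have h1 : ∀ t ∈ ⨆ i : Set.Ioi (0 : ℤ), grading K ℓ n i,
        t * yN K ℓ n i ∈ ⨆ i : Set.Ioi (0 : ℤ), grading K ℓ n i := by
      intro t ht
      induction ht using Submodule.iSup_induction' with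
      | mem j t ht =>
        exact Submodule.mem_iSup_of_mem (⟨j + 2, show (0 : ℤ) < j + 2 from add_pos j.2 two_pos⟩ : Set.Ioi (0 : ℤ))
          (mul_mem K ℓ n ht (yN_mem K ℓ n i))
      | zero => rw [zero_mul]; exact Submodule.zero_mem _
      | add a b _ _ ha hb => rw [add_mul]; exact Submodule.add_mem _ ha hb
    have h2 := h1 _ hc
    have h3 : algebraMap K _ c * yN K ℓ n i ∈ ⨆ i : Set.Ioi (0 : ℤ), grading K ℓ n i := by
      rw [← Algebra.smul_def]
      exact Submodule.smul_mem _ _ (Submodule.mem_iSup_of_mem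
        (⟨2, show (0 : ℤ) < 2 from two_pos⟩ : Set.Ioi (0 : ℤ)) (yN_mem K ℓ n i))
    have h4 := Submodule.add_mem _ h2 h3
    rwa [sub_mul, sub_add_cancel] at h4

/-- `ψ H = ψ K[y]`, and polynomials live in nonnegative degrees with only constants in degree zero;
so `ψ` spans the lowest degree of `ψ H`. -/
theorem longest_mul_of_mem {a : CycNilHecke K ℓ n} {i : ℤ}
    (h : longest K ℓ n * a ∈ grading K ℓ n i) :
    (i < -(n * (n - 1)) → longest K ℓ n * a = 0) ∧
    (i = -(n * (n - 1)) → ∃ c : K, longest K ℓ n * a = algebraMap K _ c * longest K ℓ n) := by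
  obtain ⟨f, hf⟩ := exists_longest_mul a
  obtain ⟨c, hc⟩ := exists_pol_sub_mem (ℓ := ℓ) f
  have h1 : longest K ℓ n * (pol K ℓ n f - algebraMap K _ c) ∈
      ⨆ i : Set.Ioi (-(n * (n - 1)) : ℤ), grading K ℓ n i :=
    (regular K ℓ n).ract_mem_iSup (x := longest K ℓ n) longest_mem hc
  rw [mul_sub (longest K ℓ n), ← hf] at h1
  have h2 : algebraMap K _ c * longest K ℓ n ∈ grading K ℓ n (-(n * (n - 1))) := by
    rw [← Algebra.smul_def]
    exact Submodule.smul_mem _ _ longest_mem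
  rw [← Algebra.commutes] at h1
  have h3 : ∀ j ≤ (-(n * (n - 1)) : ℤ), (regular K ℓ n).proj j (longest K ℓ n * a) =
      (regular K ℓ n).proj j (algebraMap K _ c * longest K ℓ n) := by
    intro j hj
    rw [← sub_eq_zero, ← map_sub]
    exact (regular K ℓ n).proj_eq_zero_of_mem_iSup (S := Set.Ioi (-(n * (n - 1)) : ℤ))
      (by simpa using hj) h1
  constructor
  · intro hi
    have := h3 i hi.le
    rw [(regular K ℓ n).proj_same h, (regular K ℓ n).proj_ne hi.ne' h2] at this
    exact this
  · intro hi
    subst hi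
    have := h3 _ le_rfl
    rw [(regular K ℓ n).proj_same h, (regular K ℓ n).proj_same h2] at this
    exact ⟨c, this⟩

/-- The monomials `∏ y_i ^ {a_i}`. -/
noncomputable abbrev mon (K : Type u) [Field K] (ℓ : ℕ) {n : ℕ} (a : StairIdx n) :
    CycNilHecke K ℓ n := StairIdx.monomial (yN K ℓ n) n a

/-- The coefficients dual to the monomials. -/
noncomputable abbrev dualMon (K : Type u) [Field K] (ℓ : ℕ) {n : ℕ} (a : StairIdx n) :
    CycNilHecke K ℓ n := StairIdx.dual (yN K ℓ n) n a

theorem mon_mem (a : StairIdx n) : mon K ℓ a ∈ grading K ℓ n (2 * StairIdx.total n a) :=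
  StairIdx.monomial_mem _ (one_mem K ℓ n) (mul_mem K ℓ n) (fun k h => pow_mem K ℓ n h k) le_rfl
    (fun i _ => yN_mem K ℓ n i) a

theorem dualMon_mem (a : StairIdx n) :
    dualMon K ℓ a ∈ grading K ℓ n (n * (n - 1) - 2 * StairIdx.total n a) :=
  StairIdx.dual_mem _ (one_mem K ℓ n) (mul_mem K ℓ n) le_rfl (fun i _ => yN_mem K ℓ n i) a

theorem sum_dualMon_mul : ∑ a : StairIdx n, dualMon K ℓ a * longest K ℓ n * mon K ℓ a = 1 :=
  StairIdx.sum_dual_mul_longElt _ (isNilHecke K ℓ n) le_rfl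

theorem mon_mem_range (a : StairIdx n) : mon K ℓ a ∈ (pol K ℓ n).range := by
  suffices H : ∀ m (a : StairIdx m), StairIdx.monomial (yN K ℓ n) m a ∈ (pol K ℓ n).range from
    H n a
  intro m a
  induction m with
  | zero => exact Subalgebra.one_mem _
  | succ m ih => exact Subalgebra.mul_mem _ (Subalgebra.pow_mem _ (yN_mem_range m) _) (ih _)

theorem mon_zero : mon K ℓ (StairIdx.zero n) = 1 := by
  suffices H : ∀ m, StairIdx.monomial (yN K ℓ n) m (StairIdx.zero m) = 1 from H n
  intro m
  induction m with
  | zero => rfl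
  | succ m ih => simp [StairIdx.monomial, StairIdx.zero, ih]

/-- Multiply the decomposition of 1 on the left by `ψ`. A term of positive total contains `ψ d_a ψ`,
whose degree lies below the lowest degree of `ψ H`, so only the zero exponent survives. -/
theorem longest_mul_dualMon_mul_longest :
    longest K ℓ n * dualMon K ℓ (StairIdx.zero n) * longest K ℓ n = longest K ℓ n := by
  have h1 := congrArg (longest K ℓ n * ·) (sum_dualMon_mul (K := K) (ℓ := ℓ) (n := n))
  simp only [Finset.mul_sum, mul_one] at h1
  rw [Finset.sum_eq_single (StairIdx.zero n)] at h1
  · rw [mon_zero, mul_one, ← mul_assoc] at h1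
    exact h1
  · intro a _ ha
    have h2 : 0 < StairIdx.total n a := by
      by_contra hc
      exact ha (StairIdx.eq_zero_of_total (by omega))
    have h3 := mul_mem K ℓ n (longest_mem (K := K) (ℓ := ℓ) (n := n))
      (mul_mem K ℓ n (dualMon_mem (K := K) (ℓ := ℓ) a) longest_mem)
    rw [← mul_assoc, (longest_mul_of_mem h3).1 (by linarith), zero_mul]
  · simp

variable (K ℓ n) in
/-- The primitive idempotent of the cyclotomic nilHecke algebra, with the matrix units. -/
noncomputable def cornerData : CornerData (grading K ℓ n) (StairIdx n) where
  e := dualMon K ℓ (StairIdx.zero n) * longest K ℓ n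
  left a := dualMon K ℓ a * longest K ℓ n
  right := mon K ℓ
  iSup_eq := iSup_grading K ℓ n
  mul_mem := mul_mem K ℓ n
  e_mem := by
    have := mul_mem K ℓ n (dualMon_mem (K := K) (ℓ := ℓ) (StairIdx.zero n)) longest_mem
    rwa [StairIdx.total_zero, Nat.cast_zero, mul_zero, sub_zero, add_neg_cancel] at this
  idem := by rw [mul_assoc, ← mul_assoc (longest K ℓ n), longest_mul_dualMon_mul_longest]
  corner_zero x hx := by
    -- The degrees of `ψ` and `d_0` cancel, so `ψ x d_0 ψ` sits in the lowest degree of `ψ H` and is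
    -- a scalar multiple of `ψ`.
    have h3 := mul_mem K ℓ n (longest_mem (K := K) (ℓ := ℓ) (n := n))
      (mul_mem K ℓ n hx (mul_mem K ℓ n (dualMon_mem (K := K) (ℓ := ℓ) (StairIdx.zero n))
        longest_mem))
    obtain ⟨c, hc⟩ := (longest_mul_of_mem h3).2 (by simp [StairIdx.total_zero])
    refine ⟨c, ?_⟩
    rw [mul_assoc, mul_assoc, hc, ← mul_assoc, ← Algebra.commutes, mul_assoc, Algebra.smul_def]
  corner_neg i hi x hx := by
    have h3 := mul_mem K ℓ n (longest_mem (K := K) (ℓ := ℓ) (n := n))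
      (mul_mem K ℓ n hx (mul_mem K ℓ n (dualMon_mem (K := K) (ℓ := ℓ) (StairIdx.zero n))
        longest_mem))
    rw [mul_assoc, mul_assoc, (longest_mul_of_mem h3).1 (by simp [StairIdx.total_zero, hi]),
      mul_zero]
  one_eq := by
    rw [← sum_dualMon_mul]
    refine Finset.sum_congr rfl fun a _ => ?_
    rw [mul_assoc (dualMon K ℓ a), ← mul_assoc (longest K ℓ n),
      longest_mul_dualMon_mul_longest]

end Idempotent

end CycNilHecke

/-! ### The cellular structure -/

namespace MultiPart

variable {ℓ n : ℕ}

theorem Dominates.trans {a b c : MultiPart ℓ n} (h : a.Dominates b) (h' : b.Dominates c) :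
    a.Dominates c := by
  refine ⟨fun i => (h.1 i).trans (h'.1 i), ?_⟩
  rintro rfl
  exact h.2 (DFunLike.ext _ _ fun i => le_antisymm (h.1 i) (h'.1 i))

/-- The sum of positions is the measure for induction up the dominance order. -/
theorem Dominates.sum_lt {a b : MultiPart ℓ n} (h : a.Dominates b) :
    ∑ i, (a i : ℕ) < ∑ i, (b i : ℕ) := by
  refine Finset.sum_lt_sum (fun i _ => h.1 i) ?_
  by_contra! hc
  exact h.2 (DFunLike.ext _ _ fun i => le_antisymm (h.1 i) (hc i (Finset.mem_univ i)))

theorem card : Fintype.card (MultiPart ℓ n) = ℓ.choose n := by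
  rw [← Nat.card_eq_fintype_card, Nat.card_congr Set.powersetCard.ofFinEmbEquiv,
    Set.powersetCard.card, Nat.card_fin]

/-- If the position before the `j`-th one is free, the `j`-th component can be moved there. -/
theorem exists_move (μ : MultiPart ℓ n) (j : Fin n) (h0 : 0 < (μ j : ℕ))
    (h : ∀ i < j, (μ i : ℕ) + 1 < μ j) :
    ∃ lam : MultiPart ℓ n, lam.Dominates μ ∧ ∀ i, (lam i : ℕ) = μ i - if i = j then 1 else 0 := by
  let f : Fin n → Fin ℓ := fun i => ⟨μ i - if i = j then 1 else 0, by omega⟩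
  have hf : StrictMono f := by
    intro a b hab
    have h1 : (μ a : ℕ) < μ b := μ.strictMono hab
    simp only [f, Fin.mk_lt_mk]
    split_ifs with ha hb hb
    · omega
    · omega
    · subst hb
      have := h a hab
      omega
    · omega
  refine ⟨OrderEmbedding.ofStrictMono f hf, ⟨fun i => ?_, fun hc => ?_⟩, fun i => rfl⟩
  · change (μ i : ℕ) - _ ≤ μ i
    omega
  · have := congrArg (fun m : MultiPart ℓ n => (m j : ℕ)) hc
    change (μ j : ℕ) - (if j = j then 1 else 0) = μ j at this
    rw [if_pos rfl] at this
    omega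

end MultiPart

namespace CycNilHecke

section Cells

open MvPolynomial

variable {K : Type u} [Field K] {ℓ n : ℕ}

variable (K ℓ) in
/-- The monomial in `y_1, …, y_n` with given exponents. -/
noncomputable def mono {n : ℕ} (e : Fin n → ℕ) : CycNilHecke K ℓ n :=
  pol K ℓ n (∏ i, X i ^ e i)

theorem mono_mul (e e' : Fin n → ℕ) : mono K ℓ e * mono K ℓ e' = mono K ℓ (e + e') := by
  simp only [mono, ← map_mul, ← Finset.prod_mul_distrib, Pi.add_apply, pow_add]

theorem mono_single (i : Fin n) : mono K ℓ (Pi.single i 1) = yN K ℓ n i := by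
  rw [mono, ← pol_X, Finset.prod_eq_single i]
  · simp
  · intro j _ hj; simp [hj]
  · simp

theorem yElt_eq_mono (μ : MultiPart ℓ n) :
    yElt K μ = mono K ℓ fun i => ℓ - ((μ i : ℕ) + 1) := by
  rw [mono, ← List.prod_ofFn, map_list_prod, List.map_ofFn, yElt]
  congr 2
  funext i
  simp [pol]

theorem mono_mem (e : Fin n → ℕ) : mono K ℓ e ∈ grading K ℓ n (2 * ∑ i, (e i : ℤ)) := by
  have : ∀ s : Finset (Fin n), pol K ℓ n (∏ i ∈ s, X i ^ e i) ∈
      grading K ℓ n (2 * ∑ i ∈ s, (e i : ℤ)) := by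
    intro s
    classical
    induction s using Finset.induction_on with
    | empty => simpa using one_mem K ℓ n
    | insert i s hi ih =>
      rw [Finset.prod_insert hi, Finset.sum_insert hi, map_mul, map_pow, pol_X, mul_add,
        mul_comm 2 (e i : ℤ)]
      exact mul_mem K ℓ n (pow_mem K ℓ n (yN_mem K ℓ n i) _) ih
  exact this Finset.univ

theorem yElt_mem (μ : MultiPart ℓ n) :
    yElt K μ ∈ grading K ℓ n (2 * ((ℓ : ℤ) * n - μ.sumK)) := by
  rw [yElt_eq_mono]
  convert mono_mem (K := K) (ℓ := ℓ) (fun i : Fin n => ℓ - ((μ i : ℕ) + 1)) using 2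
  have : ∀ i, ((ℓ - ((μ i : ℕ) + 1) : ℕ) : ℤ) = ℓ - ((μ i : ℕ) + 1 : ℤ) := by
    intro i
    have := (μ i).2
    push_cast [Nat.cast_sub (show (μ i : ℕ) + 1 ≤ ℓ by omega)]
    ring
  simp only [this, Finset.sum_sub_distrib, MultiPart.sumK]
  simp [mul_comm]

theorem exists_rootCoef_eq {j : ℕ} (hj : j ≤ n) : ∃ c : K, c ≠ 0 ∧
    rootCoef (yN K ℓ n) j 0 =
      algebraMap K _ c * mono K ℓ fun i : Fin n => if (i : ℕ) < j then 1 else 0 := by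
  induction j with
  | zero => exact ⟨1, one_ne_zero, by simp [rootCoef, mono]⟩
  | succ j ih =>
    obtain ⟨c, hc, h⟩ := ih (by omega)
    refine ⟨-c, neg_ne_zero.2 hc, ?_⟩
    have h1 : (fun i : Fin n => if (i : ℕ) < j + 1 then 1 else 0) =
        Pi.single (⟨j, by omega⟩ : Fin n) 1 + fun i : Fin n => if (i : ℕ) < j then 1 else 0 := by
      funext i
      simp only [Pi.add_apply, Pi.single_apply, Fin.ext_iff]
      split_ifs <;> omega
    rw [rootCoef, h, h1, ← mono_mul, mono_single, ← mul_assoc, ← Algebra.commutes, mul_assoc,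
      map_neg]
    exact (neg_mul (algebraMap K (CycNilHecke K ℓ n) c) _).symm

/-- The zero dual is a product of constant terms of `∏_{i<m} (T - y_i)`, that is, up to sign, the
staircase monomial `∏ y_i^{n-1-i}` with `i` counted from 0. For `λ_min` these are the exponents `ℓ -
k_i`. This links the idempotent to the cell structure. -/
theorem exists_dualMon_zero_eq (hn : n ≤ ℓ) : ∃ c : K, c ≠ 0 ∧
    dualMon K ℓ (StairIdx.zero n) = algebraMap K _ c * yElt K (MultiPart.minimal ℓ n hn) := by
  have key : ∀ m ≤ n, ∃ c : K, c ≠ 0 ∧ StairIdx.dual (yN K ℓ n) m (StairIdx.zero m) =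
      algebraMap K _ c * mono K ℓ fun i : Fin n => m - 1 - i := by
    intro m
    induction m with
    | zero => exact fun _ => ⟨1, one_ne_zero, by simp [StairIdx.dual, mono]⟩
    | succ m ih =>
      intro hm
      obtain ⟨c, hc, h⟩ := ih (by omega)
      obtain ⟨c', hc', h'⟩ := exists_rootCoef_eq (K := K) (ℓ := ℓ) (n := n) (j := m) (by omega)
      refine ⟨c * c', mul_ne_zero hc hc', ?_⟩
      have h1 : (fun i : Fin n => m + 1 - 1 - (i : ℕ)) =
          (fun i : Fin n => m - 1 - (i : ℕ)) +
            fun i : Fin n => if (i : ℕ) < m then 1 else 0 := by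
        funext i
        simp only [Pi.add_apply]
        split_ifs <;> omega
      have h2 : StairIdx.dual (yN K ℓ n) (m + 1) (StairIdx.zero (m + 1)) =
        StairIdx.dual (yN K ℓ n) m (StairIdx.zero m) * rootCoef (yN K ℓ n) m 0 := rfl
      rw [h2, h, h', h1, ← mono_mul, map_mul, mul_assoc, mul_assoc,
        ← mul_assoc (mono K ℓ _) (algebraMap K _ c'), ← Algebra.commutes c', mul_assoc]
  obtain ⟨c, hc, h⟩ := key n le_rfl
  refine ⟨c, hc, ?_⟩
  rw [dualMon, h, yElt_eq_mono]
  congr 2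
  funext i
  change n - 1 - (i : ℕ) = ℓ - (ℓ - n + i + 1)
  omega

theorem mul_left_mem_cellIdeal {μ : MultiPart ℓ n} {x : CycNilHecke K ℓ n}
    (hx : x ∈ (cellIdeal K μ).1) (a : CycNilHecke K ℓ n) : a * x ∈ (cellIdeal K μ).1 := by
  refine Submodule.span_induction
    (p := fun (x : CycNilHecke K ℓ n) _ => a * x ∈ (cellIdeal K μ).1) ?_ ?_ ?_ ?_ hx
  · rintro _ ⟨lam, b, h, rfl⟩
    exact Submodule.subset_span ⟨lam, a * b, h, (mul_assoc _ _ _).symm⟩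
  · rw [mul_zero]; exact (cellIdeal K μ).1.zero_mem
  · intro x y _ _ hx hy
    rw [mul_add]
    exact (cellIdeal K μ).1.add_mem hx hy
  · intro b x _ hx
    have := (cellIdeal K μ).1.smul_mem b hx
    rw [MulOpposite.smul_eq_mul_unop] at this ⊢
    rwa [← mul_assoc]

theorem mul_right_mem_cellIdeal {μ : MultiPart ℓ n} {x : CycNilHecke K ℓ n}
    (hx : x ∈ (cellIdeal K μ).1) (a : CycNilHecke K ℓ n) : x * a ∈ (cellIdeal K μ).1 :=
  (cellIdeal K μ).1.smul_mem (MulOpposite.op a) hx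

theorem yElt_mem_cellIdeal {lam μ : MultiPart ℓ n} (h : lam.Dominates μ) :
    yElt K lam ∈ (cellIdeal K μ).1 :=
  Submodule.subset_span ⟨lam, 1, h, (one_mul _).symm⟩

/-- Equal exponents make the monomial a power of `y_r y_{r+1}`, which commutes with `ψ_r`, times
variables that `ψ_r` commutes with. -/
theorem psi_mul_mono {r : ℕ} (hr : r + 1 < n) {e : Fin n → ℕ}
    (he : e ⟨r, by omega⟩ = e ⟨r + 1, hr⟩) :
    psiN K ℓ n r * mono K ℓ e = mono K ℓ e * psiN K ℓ n r := by
  have H := isNilHecke K ℓ n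
  have h1 : Commute (psiN K ℓ n r) (yN K ℓ n r * yN K ℓ n (r + 1)) := by
    have h2 := H.y_psi r hr
    rw [← sub_eq_iff_eq_add] at h2
    change _ * _ = _ * _
    rw [← mul_assoc, ← h2, sub_mul, one_mul, mul_assoc, H.psi_y r hr, mul_add, mul_one,
      add_sub_cancel_right, ← mul_assoc, H.y_comm (r + 1) r hr (by omega)]
  have h3 : mono K ℓ e = (yN K ℓ n r * yN K ℓ n (r + 1)) ^ e ⟨r, by omega⟩ *
      pol K ℓ n (∏ i ∈ (Finset.univ.erase (⟨r, by omega⟩ : Fin n)).erase ⟨r + 1, hr⟩,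
        X i ^ e i) := by
    have h4 : (⟨r + 1, hr⟩ : Fin n) ∈ Finset.univ.erase (⟨r, by omega⟩ : Fin n) := by simp
    rw [mono, ← Finset.mul_prod_erase _ _ (Finset.mem_univ (⟨r, by omega⟩ : Fin n)),
      ← Finset.mul_prod_erase _ _ h4, ← mul_assoc, ← he, ← mul_pow, map_mul, map_pow, map_mul,
      pol_X, pol_X]
  rw [h3]
  refine ((h1.pow_right _).mul_right ?_).eq
  have h4 : ∀ s : Finset (Fin n), (∀ i ∈ s, (i : ℕ) ≠ r ∧ (i : ℕ) ≠ r + 1) →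
      Commute (psiN K ℓ n r) (pol K ℓ n (∏ i ∈ s, X i ^ e i)) := by
    intro s
    induction s using Finset.induction_on with
    | empty => intro _; rw [Finset.prod_empty, map_one]; exact Commute.one_right _
    | insert i s hi ih =>
      intro hs
      have h5 := hs i (Finset.mem_insert_self i s)
      rw [Finset.prod_insert hi, map_mul, map_pow, pol_X]
      exact (Commute.pow_right (H.psi_y_comm r i hr i.2 h5.1 h5.2) _).mul_right
        (ih fun j hj => hs j (Finset.mem_insert_of_mem hj))
  refine h4 _ fun i hi => ?_
  simp only [Finset.mem_erase, Fin.ext_iff, ne_eq, Finset.mem_univ, and_true] at hi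
  exact ⟨hi.2, hi.1⟩

theorem yN_zero_pow (h : 0 < n) : yN K ℓ n 0 ^ ℓ = 0 := by
  simpa [yN, h, gen] using rel_eq K ℓ n (.cyc ⟨0, h⟩ rfl)

/-- Raising an exponent of `y_μ` produces an element of the cell ideal. -/
theorem yElt_mul_yN_mem (μ : MultiPart ℓ n) (j : ℕ) (hj : j < n) :
    yElt K μ * yN K ℓ n j ∈ (cellIdeal K μ).1 := by
  have H := isNilHecke K ℓ n
  induction j with
  | zero =>
    by_cases h0 : 0 < (μ ⟨0, hj⟩ : ℕ)
    · obtain ⟨lam, hlam, h⟩ := μ.exists_move ⟨0, hj⟩ h0 (fun i hi => absurd (Fin.lt_def.1 hi) (Nat.not_lt_zero _))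
      convert yElt_mem_cellIdeal hlam
      rw [yElt_eq_mono, yElt_eq_mono, ← mono_single (⟨0, hj⟩ : Fin n), mono_mul]
      congr 1
      funext i
      rw [Pi.add_apply, h, Pi.single_apply]
      have := (μ i).2
      split_ifs with hi
      · subst hi; omega
      · omega
    -- The first component already occupies the first position, so the exponent of the first
    -- variable reaches `ℓ` and the cyclotomic relation applies.
    · have h1 : yElt K μ * yN K ℓ n 0 =
          yN K ℓ n 0 ^ ℓ * pol K ℓ n (∏ i ∈ Finset.univ.erase (⟨0, hj⟩ : Fin n),
            X i ^ (ℓ - ((μ i : ℕ) + 1))) := by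
        have h2 := (μ ⟨0, hj⟩).2
        have h3 : ℓ = (ℓ - ((μ ⟨0, hj⟩ : ℕ) + 1)) + 1 := by omega
        have h4 : yN K ℓ n 0 = pol K ℓ n (X ⟨0, hj⟩) := (pol_X (⟨0, hj⟩ : Fin n)).symm
        conv_rhs => enter [1, 2]; rw [h3]
        rw [yElt_eq_mono, mono, ← Finset.mul_prod_erase _ _ (Finset.mem_univ (⟨0, hj⟩ : Fin n)),
          h4, ← map_pow, ← map_mul, ← map_mul]
        congr 1
        ring
      rw [h1, yN_zero_pow hj, zero_mul]
      exact (cellIdeal K μ).1.zero_mem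
  | succ r ih =>
    have hr : (μ ⟨r, by omega⟩ : ℕ) < μ ⟨r + 1, hj⟩ := μ.strictMono (by simp)
    by_cases h0 : (μ ⟨r, by omega⟩ : ℕ) + 1 < μ ⟨r + 1, hj⟩
    · obtain ⟨lam, hlam, h⟩ := μ.exists_move ⟨r + 1, hj⟩ (by omega) (fun i hi => by
        have : μ i ≤ μ ⟨r, by omega⟩ := μ.monotone (by
          rw [Fin.le_def]; rw [Fin.lt_def] at hi; simp only at hi ⊢; omega)
        have : (μ i : ℕ) ≤ μ ⟨r, by omega⟩ := this
        omega)
      convert yElt_mem_cellIdeal hlam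
      rw [yElt_eq_mono, yElt_eq_mono, ← mono_single (⟨r + 1, hj⟩ : Fin n), mono_mul]
      congr 1
      funext i
      rw [Pi.add_apply, h, Pi.single_apply]
      have := (μ i).2
      split_ifs with hi
      · subst hi; omega
      · omega
    · have ih := ih (by omega)
      -- The two positions are adjacent, so raising the later exponent equalises the exponents at
      -- `r` and `r + 1`. Then `f` commutes with `ψ_r`, and `y_r f` is in the ideal by induction.
      set f := yElt K μ * yN K ℓ n (r + 1) with hf
      have hcomm : psiN K ℓ n r * f = f * psiN K ℓ n r := by
        rw [hf, yElt_eq_mono, ← mono_single (⟨r + 1, hj⟩ : Fin n), mono_mul]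
        refine psi_mul_mono hj ?_
        have := (μ ⟨r + 1, hj⟩).2
        simp
        omega
      have hyf : ∀ i < n, yN K ℓ n i * f = f * yN K ℓ n i := by
        intro i hi
        rw [hf, yElt_eq_mono, ← mono_single (⟨r + 1, hj⟩ : Fin n), mono_mul, mono,
          ← pol_X ⟨i, hi⟩, pol_commute]
      have hg : yN K ℓ n r * f ∈ (cellIdeal K μ).1 := by
        rw [hyf r (by omega), hf, mul_assoc, H.y_comm (r + 1) r hj (by omega), ← mul_assoc]
        exact mul_right_mem_cellIdeal ih _
      have hψf : psiN K ℓ n r * f ∈ (cellIdeal K μ).1 := by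
        have h1 := mul_right_mem_cellIdeal (mul_left_mem_cellIdeal hg (psiN K ℓ n r))
          (psiN K ℓ n r)
        have h2 := H.y_psi r hj
        rw [← sub_eq_iff_eq_add] at h2
        -- Sandwiching `y_r f` between two copies of `ψ_r` strips off `y_r`, since `ψ_r ^ 2 = 0`.
        have h3 : psiN K ℓ n r * (yN K ℓ n r * f) * psiN K ℓ n r = -(psiN K ℓ n r * f) := by
          rw [mul_assoc, mul_assoc, ← hcomm, ← mul_assoc, ← h2, sub_mul, one_mul, mul_assoc,
            ← mul_assoc (psiN K ℓ n r), H.psi_sq r hj, zero_mul, mul_zero, zero_sub]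
        rw [h3] at h1
        exact (Submodule.neg_mem_iff _).1 h1
      -- The relation `ψ_r y_{r+1} - y_r ψ_r = 1` applied to `f` recovers `f` from `ψ_r f`.
      have h4 : f = psiN K ℓ n r * f * yN K ℓ n (r + 1) - yN K ℓ n r * (psiN K ℓ n r * f) := by
        rw [mul_assoc, ← hyf _ hj, ← mul_assoc, H.psi_y r hj, add_mul, one_mul, mul_assoc,
          add_sub_cancel_left]
      rw [h4]
      exact (cellIdeal K μ).1.sub_mem (mul_right_mem_cellIdeal hψf _)
        (mul_left_mem_cellIdeal hψf _)

/-- Modulo the cell ideal all variables annihilate `y_μ`; only the constant term acts. -/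
theorem exists_yElt_mul_pol (μ : MultiPart ℓ n) (f : MvPolynomial (Fin n) K) :
    ∃ c : K, yElt K μ * pol K ℓ n f - algebraMap K _ c * yElt K μ ∈ (cellIdeal K μ).1 := by
  induction f using MvPolynomial.induction_on with
  | C a =>
    refine ⟨a, ?_⟩
    rw [← algebraMap_eq, AlgHom.commutes, Algebra.commutes, sub_self]
    exact (cellIdeal K μ).1.zero_mem
  | add f g hf hg =>
    obtain ⟨c, hc⟩ := hf
    obtain ⟨c', hc'⟩ := hg
    refine ⟨c + c', ?_⟩
    rw [map_add, map_add, mul_add, add_mul, add_sub_add_comm]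
    exact (cellIdeal K μ).1.add_mem hc hc'
  | mul_X f i hf =>
    refine ⟨0, ?_⟩
    rw [map_zero, zero_mul, sub_zero, mul_comm, map_mul, pol_X, ← mul_assoc]
    exact mul_right_mem_cellIdeal (yElt_mul_yN_mem μ i i.2) _

end Cells
end CycNilHecke

/-! ### A basis of the right ideal generated by the idempotent. -/

namespace CycNilHecke

section Basis

open MvPolynomial

variable {K : Type u} [Field K] {ℓ n : ℕ}

/-- The idempotent of `cornerData`. -/
noncomputable abbrev idem (K : Type u) [Field K] (ℓ n : ℕ) : CycNilHecke K ℓ n :=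
  (cornerData K ℓ n).e

theorem longest_mul_idem : longest K ℓ n * idem K ℓ n = longest K ℓ n := by
  change longest K ℓ n * (dualMon K ℓ (StairIdx.zero n) * longest K ℓ n) = _
  rw [← mul_assoc, longest_mul_dualMon_mul_longest]

theorem idem_mul_of_longest {a : CycNilHecke K ℓ n} :
    idem K ℓ n * a = dualMon K ℓ (StairIdx.zero n) * (longest K ℓ n * a) :=
  mul_assoc _ _ _

/-- The basis elements `e y_μ ψ` of the corner of the idempotent `e`. -/
noncomputable def zElt (K : Type u) [Field K] {ℓ n : ℕ} (μ : MultiPart ℓ n) :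
    CycNilHecke K ℓ n :=
  idem K ℓ n * yElt K μ * longest K ℓ n

theorem zElt_mem (μ : MultiPart ℓ n) :
    zElt K μ ∈ grading K ℓ n (2 * ((ℓ : ℤ) * n - μ.sumK) - n * (n - 1)) := by
  have := mul_mem K ℓ n (mul_mem K ℓ n (cornerData K ℓ n).e_mem (yElt_mem (K := K) μ)) longest_mem
  rwa [zero_add, ← sub_eq_add_neg] at this

/-- Next to `e` on the left and `ψ` on the right, `a` and `b` may be replaced by polynomials. These
commute with `y_μ` and act on it by a scalar modulo the cell ideal. -/
theorem exists_mul_yElt_mul (μ : MultiPart ℓ n) (a b : CycNilHecke K ℓ n) :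
    ∃ c : K, ∃ t ∈ (cellIdeal K μ).1, idem K ℓ n * (a * yElt K μ * b) * longest K ℓ n =
      algebraMap K _ c * zElt K μ + idem K ℓ n * t * longest K ℓ n := by
  obtain ⟨f, hf⟩ := exists_longest_mul a
  obtain ⟨g, hg⟩ := exists_mul_longest b
  obtain ⟨c, hc⟩ := exists_yElt_mul_pol μ (f * g)
  refine ⟨c, _, hc, ?_⟩
  have h1 : idem K ℓ n * a = idem K ℓ n * pol K ℓ n f := by
    rw [idem_mul_of_longest, idem_mul_of_longest, hf]
  have h2 : yElt K μ * pol K ℓ n (f * g) = pol K ℓ n f * yElt K μ * pol K ℓ n g := by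
    rw [map_mul, ← mul_assoc, yElt_eq_mono, mono, pol_commute]
  rw [mul_assoc, mul_assoc (a * yElt K μ), hg, mul_assoc a, ← mul_assoc, h1, mul_sub, sub_mul,
    h2, zElt]
  have h3 : idem K ℓ n * (algebraMap K _ c * yElt K μ) * longest K ℓ n =
      algebraMap K _ c * (idem K ℓ n * yElt K μ * longest K ℓ n) := by
    rw [← mul_assoc, ← Algebra.commutes, mul_assoc, mul_assoc, mul_assoc]
  rw [h3, add_sub_cancel]
  simp only [mul_assoc]

/-- Each generator contributes a multiple of one basis element plus an error in a smaller cell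
ideal; the sum of positions drops, so the process ends. -/
theorem idem_mul_cellIdeal_mem (μ : MultiPart ℓ n) {t : CycNilHecke K ℓ n}
    (ht : t ∈ (cellIdeal K μ).1) : idem K ℓ n * t * longest K ℓ n ∈
      Submodule.span K (zElt K '' {lam | lam.Dominates μ}) := by
  induction hN : ∑ i, (μ i : ℕ) using Nat.strong_induction_on generalizing μ t with
  | _ N ih =>
    suffices H : ∀ b, idem K ℓ n * (t * b) * longest K ℓ n ∈
        Submodule.span K (zElt K '' {lam | lam.Dominates μ}) by simpa using H 1
    refine Submodule.span_induction (p := fun (t : CycNilHecke K ℓ n) _ => ∀ b,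
      idem K ℓ n * (t * b) * longest K ℓ n ∈
        Submodule.span K (zElt K '' {lam | lam.Dominates μ})) ?_ ?_ ?_ ?_ ht
    · rintro _ ⟨lam, a, hlam, rfl⟩ b
      obtain ⟨c, s, hs, h⟩ := exists_mul_yElt_mul lam a b
      rw [h, ← Algebra.smul_def]
      refine Submodule.add_mem _ (Submodule.smul_mem _ _ (Submodule.subset_span ⟨lam, hlam, rfl⟩))
        (Submodule.span_mono (Set.image_mono ?_) (ih _ (hN ▸ hlam.sum_lt) lam hs rfl))
      exact fun nu hnu => hnu.trans hlam
    · intro b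
      rw [zero_mul, mul_zero, zero_mul]
      exact Submodule.zero_mem _
    · intro x y _ _ hx hy b
      rw [add_mul, mul_add, add_mul]
      exact Submodule.add_mem _ (hx b) (hy b)
    · intro a x _ hx b
      rw [MulOpposite.smul_eq_mul_unop, mul_assoc x]
      exact hx _

/-- Since `ψ = ψ d_0 ψ` and `d_0` is a multiple of `y_μ` for `μ = λ_min`, every element of `e H ψ`
has the form treated in `exists_mul_yElt_mul`. -/
theorem idem_mul_mem (hn : n ≤ ℓ) (h : CycNilHecke K ℓ n) :
    idem K ℓ n * h * longest K ℓ n ∈ Submodule.span K (Set.range (zElt K (ℓ := ℓ) (n := n))) := by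
  obtain ⟨c, -, hc⟩ := exists_dualMon_zero_eq (K := K) hn
  have h1 := longest_mul_dualMon_mul_longest (K := K) (ℓ := ℓ) (n := n)
  obtain ⟨c', t, ht, h'⟩ := exists_mul_yElt_mul (MultiPart.minimal ℓ n hn) (h * longest K ℓ n)
    (1 : CycNilHecke K ℓ n)
  rw [mul_one] at h'
  have h2 : idem K ℓ n * h * longest K ℓ n = algebraMap K _ c *
      (idem K ℓ n * (h * longest K ℓ n * yElt K (MultiPart.minimal ℓ n hn)) * longest K ℓ n) := by
    conv_lhs => rw [← h1, hc]
    simp only [← mul_assoc]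
    congr 2
    rw [← Algebra.commutes c]
    simp only [mul_assoc]
  rw [h2, h', ← Algebra.smul_def, ← Algebra.smul_def]
  refine Submodule.smul_mem _ _ (Submodule.add_mem _ (Submodule.smul_mem _ _
    (Submodule.subset_span ⟨_, rfl⟩)) ?_)
  exact Submodule.span_mono (Set.image_subset_range _ _) (idem_mul_cellIdeal_mem _ ht)

/-- The basis `e y_μ ψ y^a` of the right ideal `e H`. -/
noncomputable def zMon (K : Type u) [Field K] {ℓ n : ℕ} (i : MultiPart ℓ n × StairIdx n) :
    CycNilHecke K ℓ n :=
  zElt K i.1 * mon K ℓ i.2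

/-- Inserting `1 = ∑ d_a ψ y^a` on the right passes from statements about `e H ψ` to statements
about `e H`. -/
theorem idem_mul_mem_of_forall {x : CycNilHecke K ℓ n} {S : Set (MultiPart ℓ n)}
    (h : ∀ a, idem K ℓ n * (x * a) * longest K ℓ n ∈ Submodule.span K (zElt K '' S)) :
    idem K ℓ n * x ∈ Submodule.span K (zMon K '' (S ×ˢ Set.univ)) := by
  have h1 : idem K ℓ n * x = ∑ a : StairIdx n,
      idem K ℓ n * (x * dualMon K ℓ a) * longest K ℓ n * mon K ℓ a := by
    conv_lhs => rw [← mul_one x, ← sum_dualMon_mul, Finset.mul_sum, Finset.mul_sum]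
    simp only [mul_assoc]
  rw [h1]
  refine Submodule.sum_mem _ fun a _ => ?_
  refine Submodule.span_induction (p := fun (t : CycNilHecke K ℓ n) _ => t * mon K ℓ a ∈
    Submodule.span K (zMon K '' (S ×ˢ Set.univ))) ?_ ?_ ?_ ?_ (h (dualMon K ℓ a))
  · rintro _ ⟨μ, hμ, rfl⟩
    exact Submodule.subset_span ⟨(μ, a), ⟨hμ, trivial⟩, rfl⟩
  · rw [zero_mul]; exact Submodule.zero_mem _
  · intro x y _ _ hx hy
    rw [add_mul]
    exact Submodule.add_mem _ hx hy
  · intro c x _ hx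
    rw [smul_mul_assoc]
    exact Submodule.smul_mem _ _ hx

theorem idem_mul_mem_span_zMon (hn : n ≤ ℓ) (x : CycNilHecke K ℓ n) :
    idem K ℓ n * x ∈ Submodule.span K (Set.range (zMon K (ℓ := ℓ) (n := n))) := by
  have := idem_mul_mem_of_forall (x := x) (S := Set.univ) fun a => by
    rw [Set.image_univ]
    exact idem_mul_mem hn _
  rwa [Set.univ_prod_univ, Set.image_univ] at this

/-- A dimension count: the family has `C(ℓ,n) n! = ℓ (ℓ-1) ⋯ (ℓ-n+1)` members, and the splitting
algebra `R` of exactly this dimension embeds in their span by lifting to polynomials and multiplying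
by `e`. -/
theorem linearIndependent_zMon (hn : n ≤ ℓ) :
    LinearIndependent K (zMon K (ℓ := ℓ) (n := n)) := by
  rw [linearIndependent_iff_card_le_finrank_span]
  obtain ⟨R, _, _, φ, hrank, hsurj, hker⟩ := exists_quotient_of_pol K ℓ n hn
  have hcard : Fintype.card (MultiPart ℓ n × StairIdx n) = Module.finrank K R := by
    rw [Fintype.card_prod, MultiPart.card, StairIdx.card, hrank, mul_comm,
      Nat.descFactorial_eq_factorial_mul_choose]
  obtain ⟨s, hs⟩ := LinearMap.exists_rightInverse_of_surjective φ.toLinearMap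
    (LinearMap.range_eq_top.2 hsurj)
  let Φ : R →ₗ[K] Submodule.span K (Set.range (zMon K (ℓ := ℓ) (n := n))) :=
    LinearMap.codRestrict _ (LinearMap.mulLeft K (idem K ℓ n) ∘ₗ (pol K ℓ n).toLinearMap ∘ₗ s)
      fun r => idem_mul_mem_span_zMon hn _
  rw [hcard]
  have hfin : Module.Finite K (Submodule.span K (Set.range (zMon K (ℓ := ℓ) (n := n)))) :=
    FiniteDimensional.span_of_finite K (Set.finite_range _)
  refine LinearMap.finrank_le_finrank_of_injective (f := Φ) ?_
  rw [injective_iff_map_eq_zero]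
  intro r hr
  have h1 : idem K ℓ n * pol K ℓ n (s r) = 0 := congrArg Subtype.val hr
  have h2 : longest K ℓ n * pol K ℓ n (s r) = 0 := by
    rw [← longest_mul_idem, mul_assoc, h1, mul_zero]
  -- A polynomial killed by `ψ` from the left is zero: insert the decomposition of 1 and commute the
  -- polynomial past the monomials `y^a`.
  have h3 : pol K ℓ n (s r) = 0 := by
    rw [← one_mul (pol K ℓ n (s r)), ← sum_dualMon_mul, Finset.sum_mul]
    refine Finset.sum_eq_zero fun a _ => ?_
    obtain ⟨g, hg⟩ := mon_mem_range (K := K) (ℓ := ℓ) a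
    rw [← hg]
    change _ * pol K ℓ n g * _ = 0
    rw [mul_assoc, pol_commute, ← mul_assoc, mul_assoc (dualMon K ℓ a), h2, mul_zero, zero_mul]
  have h4 := hker _ h3
  have h5 : φ (s r) = r := LinearMap.congr_fun hs r
  rw [← h5, h4]

/-- The elements `y_μ ψ y^a` are linearly independent modulo the cell ideal. -/
theorem eq_zero_of_sum_mem_cellIdeal (hn : n ≤ ℓ) (μ : MultiPart ℓ n) (c : StairIdx n → K)
    (h : yElt K μ * ∑ a, algebraMap K _ (c a) * (longest K ℓ n * mon K ℓ a) ∈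
      (cellIdeal K μ).1) (a : StairIdx n) : c a = 0 := by
  classical
  have h1 := idem_mul_mem_of_forall (S := {lam | lam.Dominates μ}) fun a =>
    idem_mul_cellIdeal_mem μ (mul_right_mem_cellIdeal h a)
  have h2 : idem K ℓ n * (yElt K μ * ∑ a, algebraMap K _ (c a) *
      (longest K ℓ n * mon K ℓ a)) = ∑ a, c a • zMon K (μ, a) := by
    rw [Finset.mul_sum, Finset.mul_sum]
    refine Finset.sum_congr rfl fun a _ => ?_
    rw [Algebra.smul_def, zMon, zElt, ← mul_assoc (yElt K μ), ← Algebra.commutes, mul_assoc,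
      ← mul_assoc (idem K ℓ n), ← Algebra.commutes]
    simp only [mul_assoc]
  rw [h2] at h1
  have hli := linearIndependent_zMon (K := K) hn
  -- The sum lies in the span of the basis vectors for `μ`, while membership in the cell ideal
  -- places it in the span for shapes strictly above `μ`.
  have hdisj := hli.disjoint_span_image (s := {μ} ×ˢ Set.univ)
    (t := {lam | lam.Dominates μ} ×ˢ Set.univ) (by
      rw [Set.disjoint_left]
      rintro ⟨nu, b⟩ ⟨h3, -⟩ ⟨h4, -⟩
      simp only [Set.mem_singleton_iff] at h3
      subst h3
      exact h4.2 rfl)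
  have h3 := (Submodule.disjoint_def.1 hdisj) _ (Submodule.sum_mem _ fun a _ =>
    Submodule.smul_mem _ (c a) (Submodule.subset_span ⟨(μ, a), ⟨rfl, trivial⟩, rfl⟩)) h1
  have hli2 : LinearIndependent K fun a : StairIdx n => zMon K (μ, a) :=
    hli.comp (fun a => (μ, a)) (Prod.mk_right_injective μ)
  exact Fintype.linearIndependent_iff.1 hli2 c h3 a

end Basis

/-! ### Specht modules, the simple module and its projective cover. -/

section Specht

open scoped RightActions

variable {K : Type u} [Field K] {ℓ n : ℕ}

theorem exists_spechtGen_ract (μ : MultiPart ℓ n) (x : (specht K μ).carrier) :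
    ∃ a : CycNilHecke K ℓ n, spechtGen K μ <• a = x := by
  obtain ⟨a, ha⟩ := (((regular K ℓ n).quot (cellIdeal K μ)).mem_span_singleton_iff _ _).1
    (show x.1 ∈ Submodule.span _ {yBar K μ} from x.2)
  exact ⟨a, Subtype.ext ha⟩

theorem spechtGen_ract_eq_zero_iff (μ : MultiPart ℓ n) (a : CycNilHecke K ℓ n) :
    spechtGen K μ <• a = 0 ↔ yElt K μ * a ∈ (cellIdeal K μ).1 := by
  rw [← Submodule.Quotient.mk_eq_zero]
  exact ⟨fun h => congrArg Subtype.val h, fun h => Subtype.ext h⟩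

theorem spechtGen_mem (μ : MultiPart ℓ n) :
    spechtGen K μ ∈ (specht K μ).comp ((ℓ : ℤ) * n - μ.sumK) := by
  refine ⟨yElt K μ, ?_, rfl⟩
  have := yElt_mem (K := K) μ
  change _ ∈ grading K ℓ n _
  rwa [sub_neg_eq_add, ← two_mul]

/-- The vector of lowest degree in a Specht module. -/
noncomputable def spechtVec (K : Type u) [Field K] {ℓ n : ℕ} (μ : MultiPart ℓ n) :
    (specht K μ).carrier :=
  spechtGen K μ <• longest K ℓ n

theorem spechtVec_mem (μ : MultiPart ℓ n) :
    spechtVec K μ ∈ (specht K μ).comp ((ℓ : ℤ) * n - μ.sumK - n * (n - 1)) := by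
  have := (specht K μ).smul_mem _ _ _ _ longest_mem (spechtGen_mem (K := K) μ)
  rwa [← sub_eq_add_neg] at this

theorem spechtVec_ract_idem (μ : MultiPart ℓ n) :
    spechtVec K μ <• idem K ℓ n = spechtVec K μ := by
  rw [spechtVec, ← GrMod.ract_mul, longest_mul_idem]

/-- The product `a e` has the form `f ψ` with `f` a polynomial, and `f` acts on the generator by a
scalar. -/
theorem exists_ract_idem_eq (μ : MultiPart ℓ n) (x : (specht K μ).carrier) :
    ∃ c : K, x <• idem K ℓ n = c • spechtVec K μ := by
  obtain ⟨a, rfl⟩ := exists_spechtGen_ract μ x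
  obtain ⟨f, hf⟩ := exists_mul_longest (a * dualMon K ℓ (StairIdx.zero n))
  obtain ⟨c, hc⟩ := exists_yElt_mul_pol μ f
  refine ⟨c, ?_⟩
  have h1 : a * idem K ℓ n = pol K ℓ n f * longest K ℓ n := by
    rw [← hf, mul_assoc]
    rfl
  have h2 : spechtGen K μ <• pol K ℓ n f = c • spechtGen K μ := by
    have h3 : spechtGen K μ <• (pol K ℓ n f - algebraMap K _ c) = 0 := by
      rw [spechtGen_ract_eq_zero_iff, mul_sub, ← Algebra.commutes]
      exact hc
    have h4 := map_sub ((specht K μ).orbit (spechtGen K μ)) (pol K ℓ n f) (algebraMap K _ c)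
    rw [GrMod.orbit_apply, h3, eq_comm, sub_eq_zero] at h4
    refine h4.trans ?_
    rw [Algebra.algebraMap_eq_smul_one, map_smul, GrMod.orbit_apply, MulOpposite.op_one, one_smul]
  rw [← GrMod.ract_mul, h1, GrMod.ract_mul, h2, GrMod.smul_ract, spechtVec]

theorem linearIndependent_spechtVec (hn : n ≤ ℓ) (μ : MultiPart ℓ n) :
    LinearIndependent K fun a : StairIdx n => spechtVec K μ <• mon K ℓ a := by
  rw [Fintype.linearIndependent_iff]
  intro c hc
  refine eq_zero_of_sum_mem_cellIdeal hn μ c ?_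
  rw [← spechtGen_ract_eq_zero_iff, ← hc, ← GrMod.orbit_apply, map_sum]
  refine Finset.sum_congr rfl fun a _ => ?_
  rw [spechtVec, ← GrMod.ract_mul, ← Algebra.smul_def, GrMod.orbit_apply]
  exact GrMod.ract_smul _ _ _ _

theorem spechtVec_ne_zero (hn : n ≤ ℓ) (μ : MultiPart ℓ n) : spechtVec K μ ≠ 0 := by
  intro h0
  refine (linearIndependent_spechtVec (K := K) hn μ).ne_zero (StairIdx.zero n) ?_
  change spechtVec K μ <• mon K ℓ (StairIdx.zero n) = 0
  rw [h0, smul_zero]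

/-- Hence every Specht module here is graded simple, and its decomposition number is one power of
`q`, the difference of lowest degrees. -/
theorem specht_isType (hn : n ≤ ℓ) (μ : MultiPart ℓ n) :
    (specht K μ).IsType (idem K ℓ n) ((ℓ : ℤ) * n - μ.sumK - n * (n - 1)) :=
  ⟨spechtVec K μ, spechtVec_mem μ, spechtVec_ne_zero hn μ, spechtVec_ract_idem μ,
    exists_ract_idem_eq μ⟩

theorem specht_finite (μ : MultiPart ℓ n) : Module.Finite K (specht K μ).carrier := by
  have := (specht K μ).span_right_eq_top (cornerData K ℓ n) (exists_ract_idem_eq μ)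
  exact ⟨⟨(Set.finite_range _).toFinset, by rw [Set.Finite.coe_toFinset]; exact this⟩⟩

/-- By simplicity the radical is zero or everything. In the second case the generator is killed by
`ψ y_μ`, and `ψ = ψ d_0 ψ` with `d_0` a multiple of `y_μ` would make it killed by `ψ`, against
`spechtVec_ne_zero`. -/
theorem spechtRad_minimal_eq_bot (hn : n ≤ ℓ) :
    (spechtRad K (MultiPart.minimal ℓ n hn)).1 = ⊥ := by
  set μ := MultiPart.minimal ℓ n hn
  by_contra hne
  have htop := (specht_isType (K := K) hn μ).eq_top_of_ne_bot (h := cornerData K ℓ n) hne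
  have hgen : spechtGen K μ ∈ (spechtRad K μ).1 := by rw [htop]; trivial
  have h1 : MulOpposite.op (invol K ℓ n (invol K ℓ n (longest K ℓ n)) * yElt K μ) •
      spechtGen K μ = (0 : K) • spechtGen K μ := hgen (invol K ℓ n (longest K ℓ n))
  rw [invol_invol, zero_smul] at h1
  obtain ⟨c, -, hc⟩ := exists_dualMon_zero_eq (K := K) hn
  apply spechtVec_ne_zero (K := K) hn μ
  rw [spechtVec, ← longest_mul_dualMon_mul_longest, hc, ← mul_assoc, ← Algebra.commutes, mul_assoc,
    mul_assoc, Algebra.commutes, ← mul_assoc, GrMod.ract_mul, GrMod.ract_mul, h1, smul_zero,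
    smul_zero]

/-- The image of the lowest vector of the Specht module in the simple module. -/
noncomputable def minVec (K : Type u) [Field K] {ℓ n : ℕ} (hn : n ≤ ℓ) : (D₀ K ℓ n hn).carrier :=
  Submodule.Quotient.mk (p := (spechtRad K (MultiPart.minimal ℓ n hn)).1) (spechtVec K _)

theorem _root_.two_mul_sum_fin (n : ℕ) : (2 : ℤ) * ∑ i : Fin n, ((i : ℕ) : ℤ) = n * (n - 1) := by
  induction n with
  | zero => simp
  | succ n ih =>
    simp only [Fin.sum_univ_castSucc, Fin.val_castSucc, Fin.val_last, mul_add, ih]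
    push_cast
    ring

theorem sumK_minimal (hn : n ≤ ℓ) :
    2 * (MultiPart.minimal ℓ n hn).sumK = 2 * n * ℓ - n * (n - 1) := by
  have h1 : (MultiPart.minimal ℓ n hn).sumK = ∑ i : Fin n, ((ℓ : ℤ) - n + 1 + (i : ℕ)) := by
    refine Finset.sum_congr rfl fun i _ => ?_
    change ((ℓ - n + i : ℕ) : ℤ) + 1 = _
    push_cast [Nat.cast_sub hn]
    ring
  rw [h1, Finset.sum_add_distrib, mul_add, two_mul_sum_fin]
  simp
  ring

/-- The lowest degree in the simple module. -/
def minDeg (n : ℕ) : ℤ := -(n * (n - 1) / 2)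

theorem minDeg_eq (hn : n ≤ ℓ) :
    (ℓ : ℤ) * n - (MultiPart.minimal ℓ n hn).sumK - n * (n - 1) = minDeg n := by
  have h1 := sumK_minimal hn
  have h2 : (ℓ : ℤ) * n = n * ℓ := mul_comm _ _
  have h3 : (2 : ℤ) * n * ℓ = 2 * (n * ℓ) := mul_assoc _ _ _
  unfold minDeg
  rw [h3] at h1
  rw [h2]
  generalize (n : ℤ) * ℓ = a at *
  generalize (n : ℤ) * (n - 1) = b at *
  omega

/-- The integer division in `minDeg` is exact; this is read off from the integrality of the sum of
positions in the case `ℓ = n`. -/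
theorem two_mul_minDeg (n : ℕ) : 2 * minDeg n = -(n * (n - 1)) := by
  have h1 := sumK_minimal (le_refl n)
  have h2 := minDeg_eq (le_refl n)
  linarith

theorem minVec_mem (hn : n ≤ ℓ) : minVec K hn ∈ (D₀ K ℓ n hn).comp (minDeg n) := by
  rw [← minDeg_eq hn]
  exact ⟨_, spechtVec_mem _, rfl⟩

theorem exists_ract_idem_eq_minVec (hn : n ≤ ℓ) (x : (D₀ K ℓ n hn).carrier) :
    ∃ c : K, x <• idem K ℓ n = c • minVec K hn := by
  obtain ⟨x, rfl⟩ := Submodule.Quotient.mk_surjective _ x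
  obtain ⟨c, hc⟩ := exists_ract_idem_eq (K := K) _ x
  exact ⟨c, congrArg (Submodule.Quotient.mk
    (p := (spechtRad K (MultiPart.minimal ℓ n hn)).1)) hc⟩

theorem linearIndependent_minVec (hn : n ≤ ℓ) :
    LinearIndependent K fun a : StairIdx n => minVec K hn <• mon K ℓ a := by
  rw [Fintype.linearIndependent_iff]
  intro c hc
  refine Fintype.linearIndependent_iff.1
    (linearIndependent_spechtVec (K := K) hn (MultiPart.minimal ℓ n hn)) c ?_
  have h1 : ∑ a, c a • (spechtVec K (MultiPart.minimal ℓ n hn) <• mon K ℓ a) ∈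
      (spechtRad K (MultiPart.minimal ℓ n hn)).1 := by
    refine (Submodule.Quotient.mk_eq_zero _).1 (Eq.trans ?_ hc)
    exact map_sum ((spechtRad K (MultiPart.minimal ℓ n hn)).1.mkQ.restrictScalars K) _ _
  rw [spechtRad_minimal_eq_bot] at h1
  exact h1

theorem D₀_isType (hn : n ≤ ℓ) : (D₀ K ℓ n hn).IsType (idem K ℓ n) (minDeg n) := by
  refine ⟨minVec K hn, minVec_mem hn, fun h0 => ?_, ?_, exists_ract_idem_eq_minVec hn⟩
  · refine (linearIndependent_minVec (K := K) hn).ne_zero (StairIdx.zero n) ?_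
    change minVec K hn <• mon K ℓ (StairIdx.zero n) = 0
    rw [h0, smul_zero]
  · exact congrArg (Submodule.Quotient.mk
      (p := (spechtRad K (MultiPart.minimal ℓ n hn)).1)) (spechtVec_ract_idem _)

theorem D₀_span (hn : n ≤ ℓ) :
    Submodule.span K (Set.range fun a : StairIdx n => minVec K hn <• mon K ℓ a) = ⊤ :=
  (D₀ K ℓ n hn).span_right_eq_top (cornerData K ℓ n) (exists_ract_idem_eq_minVec hn)

theorem D₀_finite (hn : n ≤ ℓ) : Module.Finite K (D₀ K ℓ n hn).carrier :=
  ⟨⟨(Set.finite_range _).toFinset, by rw [Set.Finite.coe_toFinset]; exact D₀_span hn⟩⟩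

theorem D₀_grDim (hn : n ≤ ℓ) : (D₀ K ℓ n hn).grDim =
    ∑ a : StairIdx n, LaurentPolynomial.T (minDeg n + 2 * StairIdx.total n a) :=
  (D₀ K ℓ n hn).grDim_eq (linearIndependent_minVec hn) (D₀_span hn)
    fun a => (D₀ K ℓ n hn).smul_mem _ _ _ _ (mon_mem a) (minVec_mem hn)

/-- The generator has the same annihilator as `e`, so the bases of `e H` and `e H ψ` transport to
`P` and to its corner; the degrees of `e y_μ ψ` give the Cartan exponents. -/
theorem isProjCover_D₀ (hn : n ≤ ℓ) {P : GrMod.{u, u, v} (grading K ℓ n)}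
    (hP : P.IsProjCover (D₀ K ℓ n hn)) :
    Module.Finite K P.carrier ∧
    P.grDim = ∑ i : MultiPart ℓ n × StairIdx n, LaurentPolynomial.T
      (minDeg n + (2 * ((ℓ : ℤ) * n - i.1.sumK) - n * (n - 1) + 2 * StairIdx.total n i.2)) ∧
    P.HasGrMult (D₀ K ℓ n hn) (∑ μ : MultiPart ℓ n,
      LaurentPolynomial.T (2 * ((ℓ : ℤ) * n - μ.sumK) - n * (n - 1))) := by
  obtain ⟨x, hxd, hxe, hx, hker⟩ := hP.exists_vector (cornerData K ℓ n) (D₀_isType hn)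
  have hli : LinearIndependent K fun i : MultiPart ℓ n × StairIdx n => x <• zMon K i := by
    rw [Fintype.linearIndependent_iff]
    intro c hc
    refine Fintype.linearIndependent_iff.1 (linearIndependent_zMon (K := K) hn) c ?_
    have h1 : x <• (∑ i, c i • zMon K i) = 0 := by
      rw [← GrMod.orbit_apply, map_sum, ← hc]
      exact Finset.sum_congr rfl fun i _ => P.ract_smul _ _ _
    have h2 := hker _ h1
    rw [Finset.mul_sum] at h2
    rw [← h2]
    refine Finset.sum_congr rfl fun i _ => ?_
    rw [mul_smul_comm]
    congr 1
    change _ = idem K ℓ n * (idem K ℓ n * yElt K i.1 * longest K ℓ n * mon K ℓ i.2)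
    simp only [← mul_assoc]
    rw [(cornerData K ℓ n).idem]
    rfl
  have hxa : ∀ a : CycNilHecke K ℓ n, x <• a = x <• (idem K ℓ n * a) := fun a => by
    rw [P.ract_mul x, hxe]
  have hspan : Submodule.span K
      (Set.range fun i : MultiPart ℓ n × StairIdx n => x <• zMon K i) = ⊤ := by
    rw [eq_top_iff]
    rintro y -
    obtain ⟨a, rfl⟩ := hx y
    have h1 := Submodule.mem_map_of_mem (f := P.orbit x) (idem_mul_mem_span_zMon (K := K) hn a)
    rw [Submodule.map_span, ← Set.range_comp] at h1
    rw [hxa]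
    exact h1
  have hzd : ∀ μ : MultiPart ℓ n, x <• zElt K μ ∈
      P.comp (minDeg n + (2 * ((ℓ : ℤ) * n - μ.sumK) - n * (n - 1))) := fun μ =>
    P.smul_mem _ _ _ _ (zElt_mem μ) hxd
  have hfin : Module.Finite K P.carrier :=
    ⟨⟨(Set.finite_range _).toFinset, by rw [Set.Finite.coe_toFinset]; exact hspan⟩⟩
  refine ⟨hfin, ?_, ?_⟩
  · refine P.grDim_eq hli hspan fun i => ?_
    exact P.smul_mem _ _ _ _ (mul_mem K ℓ n (zElt_mem i.1) (mon_mem i.2)) hxd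
  · have hli' : LinearIndependent K fun μ : MultiPart ℓ n => x <• zElt K μ := by
      have h1 := hli.comp (fun μ : MultiPart ℓ n => (μ, StairIdx.zero n))
        (Prod.mk_left_injective _)
      convert h1 using 2 with μ
      simp only [Function.comp, zMon, mon_zero, mul_one]
    have := P.hasGrMult_of_basis (cornerData K ℓ n) (D₀_isType hn) hli' (fun y => ?_) hzd
    · simpa only [add_sub_cancel_left] using this
    · constructor
      · intro hy
        obtain ⟨a, rfl⟩ := hx y
        obtain ⟨f, hf⟩ := exists_mul_longest (a * dualMon K ℓ (StairIdx.zero n))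
        have h1 := Submodule.mem_map_of_mem (f := P.orbit x)
          (idem_mul_mem (K := K) hn (a * dualMon K ℓ (StairIdx.zero n)))
        rw [Submodule.map_span, ← Set.range_comp] at h1
        -- A vector of the corner is `x a = x e a d_0 ψ`, hence comes from `e H ψ`.
        have h2 : P.orbit x (idem K ℓ n * (a * dualMon K ℓ (StairIdx.zero n)) * longest K ℓ n) =
            x <• a := by
          rw [← hy, P.orbit_apply, mul_assoc, ← hxa, mul_assoc]
          exact P.ract_mul _ _ _
        rw [h2] at h1
        exact h1
      · intro hy
        refine Submodule.span_induction (p := fun y _ => y <• idem K ℓ n = y) ?_ ?_ ?_ ?_ hy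
        · rintro _ ⟨μ, rfl⟩
          change (x <• zElt K μ) <• _ = x <• zElt K μ
          rw [← P.ract_mul, zElt, mul_assoc, longest_mul_idem]
        · exact smul_zero _
        · intro y z _ _ hy hz
          rw [smul_add, hy, hz]
        · intro c y _ hy
          rw [P.smul_ract, hy]

end Specht

end CycNilHecke

/-! ### Coinversions of permutations and the Lehmer code. -/

section Coinversions

/-- The number of pairs `i < j` with `σ i < σ j`. -/
def coinversions {n : ℕ} (σ : Equiv.Perm (Fin n)) : ℕ :=
  ∑ i, (Finset.univ.filter fun j => i < j ∧ σ i < σ j).card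

/-- The permutation with `0 ↦ p` whose remaining values are ordered as those of `e`. -/
def insertZeroPerm {n : ℕ} (p : Fin (n + 1)) (e : Equiv.Perm (Fin n)) :
    Equiv.Perm (Fin (n + 1)) :=
  ((finSuccEquiv' 0).trans (Equiv.optionCongr e)).trans (finSuccEquiv' p).symm

@[simp]
theorem insertZeroPerm_zero {n : ℕ} (p : Fin (n + 1)) (e : Equiv.Perm (Fin n)) :
    insertZeroPerm p e 0 = p := by
  simp [insertZeroPerm]

@[simp]
theorem insertZeroPerm_succ {n : ℕ} (p : Fin (n + 1)) (e : Equiv.Perm (Fin n)) (i : Fin n) :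
    insertZeroPerm p e i.succ = p.succAbove (e i) := by
  rw [insertZeroPerm, Equiv.trans_apply, Equiv.trans_apply, ← Fin.succAbove_zero,
    finSuccEquiv'_succAbove]
  simp

theorem insertZeroPerm_bijective (n : ℕ) :
    Function.Bijective fun x : Equiv.Perm (Fin n) × Fin (n + 1) => insertZeroPerm x.2 x.1 := by
  rw [Fintype.bijective_iff_injective_and_card]
  constructor
  · rintro ⟨e, p⟩ ⟨e', p'⟩ h
    have h0 : p = p' := by simpa using congrArg (fun σ : Equiv.Perm (Fin (n + 1)) => σ 0) h
    subst h0
    have h1 : e = e' := by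
      ext i : 1
      simpa using congrArg (fun σ : Equiv.Perm (Fin (n + 1)) => σ i.succ) h
    rw [h1]
  · simp [Fintype.card_perm, Nat.factorial_succ, mul_comm]

/-- The pairs starting at 0 count the values above `p`; the remaining pairs see only the relative
order, which `Fin.succAbove` preserves. -/
theorem coinversions_insertZeroPerm {n : ℕ} (p : Fin (n + 1)) (e : Equiv.Perm (Fin n)) :
    coinversions (insertZeroPerm p e) = coinversions e + (p.rev : ℕ) := by
  have h : (Finset.univ.filter fun j => 0 < j ∧ insertZeroPerm p e 0 < insertZeroPerm p e j).card =
      (p.rev : ℕ) := by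
    rw [← Finset.card_map (insertZeroPerm p e).toEmbedding]
    have : Finset.map (insertZeroPerm p e).toEmbedding
        (Finset.univ.filter fun j => 0 < j ∧ insertZeroPerm p e 0 < insertZeroPerm p e j) =
        Finset.Ioi p := by
      ext v
      simp only [Finset.mem_map_equiv, Finset.mem_filter, Finset.mem_univ, true_and,
        insertZeroPerm_zero, Equiv.apply_symm_apply, Finset.mem_Ioi, and_iff_right_iff_imp]
      intro hv
      rw [Fin.pos_iff_ne_zero, ne_eq, Equiv.symm_apply_eq, insertZeroPerm_zero]
      exact hv.ne'
    rw [this, Fin.card_Ioi, Fin.val_rev]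
    omega
  unfold coinversions
  rw [Fin.sum_univ_succ, h, add_comm]
  congr 1
  refine Finset.sum_congr rfl fun i _ => ?_
  rw [Fin.card_filter_univ_succ]
  simp

/-- Peeling off the first value of a permutation matches the last coordinate of the staircase index,
after reversing the order of values. -/
theorem sum_coinversions {M : Type*} [AddCommMonoid M] (n : ℕ) (f : ℕ → M) :
    ∑ σ : Equiv.Perm (Fin n), f (coinversions σ) = ∑ a : StairIdx n, f (StairIdx.total n a) := by
  induction n generalizing f with
  | zero =>
    have : ∑ a : StairIdx 0, f (StairIdx.total 0 a) = f 0 := Fintype.sum_unique (ι := Unit) _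
    rw [this, Fintype.sum_unique]
    rfl
  | succ n ih =>
    have : ∑ a : StairIdx (n + 1), f (StairIdx.total (n + 1) a) =
        ∑ a : StairIdx n × Fin (n + 1), f (StairIdx.total n a.1 + a.2) := rfl
    rw [this, Fintype.sum_prod_type_right, ← (insertZeroPerm_bijective n).sum_comp,
      Fintype.sum_prod_type_right, ← Equiv.sum_comp Fin.revPerm]
    refine Finset.sum_congr rfl fun p _ => ?_
    rw [← ih fun k => f (k + p)]
    simp [coinversions_insertZeroPerm]

end Coinversions

/-! ### Tableau degrees for the minimal shape, and its extremality. -/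

namespace MultiPart

variable {ℓ n : ℕ}

theorem mem_range_minimal (hn : n ≤ ℓ) {i : Fin n} {j : Fin ℓ} (h : minimal ℓ n hn i < j) :
    j ∈ Set.range (minimal ℓ n hn) := by
  have h1 : ℓ - n + (i : ℕ) < j := h
  refine ⟨⟨j - (ℓ - n), by omega⟩, Fin.ext ?_⟩
  change ℓ - n + (j - (ℓ - n)) = (j : ℕ)
  omega

/-- The tableau of shape `μ` given by a permutation. -/
noncomputable def tableauEquiv (μ : MultiPart ℓ n) : Equiv.Perm (Fin n) ≃ Tableau μ :=
  (Equiv.ofInjective μ μ.injective).equivCongr (Equiv.refl _)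

theorem tableauEquiv_apply (μ : MultiPart ℓ n) (σ : Equiv.Perm (Fin n)) (i : Fin n)
    (h : μ i ∈ Set.range μ) : tableauEquiv μ σ ⟨μ i, h⟩ = σ i := by
  change σ ((Equiv.ofInjective μ μ.injective).symm ⟨μ i, h⟩) = σ i
  rw [Equiv.ofInjective_symm_apply]

/-- No position after an occupied one is empty, so the degree is coinversions minus inversions,
while together they number `n(n-1)/2`. -/
theorem tabDeg_minimal (hn : n ≤ ℓ) (σ : Equiv.Perm (Fin n)) :
    tabDeg (minimal ℓ n hn) (tableauEquiv _ σ) = CycNilHecke.minDeg n + 2 * coinversions σ := by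
  classical
  set μ := minimal ℓ n hn
  have hcard : ∀ (i : Fin n) (p : Fin ℓ → Prop) (q : Fin n → Prop) [DecidablePred p]
      [DecidablePred q], (∀ j, p (μ j) ↔ q j) →
      (Finset.univ.filter fun j => μ i < j ∧ p j).card =
        (Finset.univ.filter fun j => i < j ∧ q j).card := by
    intro i p q _ _ hpq
    rw [← Finset.card_map μ.toEmbedding]
    congr 1
    ext j
    simp only [Finset.mem_filter, Finset.mem_univ, true_and, Finset.mem_map]
    constructor
    · rintro ⟨h1, h2⟩
      obtain ⟨j, rfl⟩ := mem_range_minimal hn h1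
      exact ⟨j, ⟨(OrderEmbedding.lt_iff_lt _).1 h1, (hpq j).1 h2⟩, rfl⟩
    · rintro ⟨j, ⟨h1, h2⟩, rfl⟩
      exact ⟨(OrderEmbedding.lt_iff_lt _).2 h1, (hpq j).2 h2⟩
  -- Each of the `n - 1 - i` indices after `i` gives either a coinversion or an inversion.
  have hsum : ∀ i : Fin n, (Finset.univ.filter fun j => i < j ∧ σ i < σ j).card +
      (Finset.univ.filter fun j => i < j ∧ σ j < σ i).card + ((i : ℕ) + 1) = n := by
    intro i
    have h1 : (Finset.Ioi i).card = n - 1 - i := Fin.card_Ioi i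
    rw [← Finset.card_union_of_disjoint, ← Finset.filter_or]
    · have : (Finset.univ.filter fun j => i < j ∧ σ i < σ j ∨ i < j ∧ σ j < σ i) =
          Finset.Ioi i := by
        ext j
        simp only [Finset.mem_filter, Finset.mem_univ, true_and, Finset.mem_Ioi, ← and_or_left,
          and_iff_left_iff_imp]
        exact fun hij => lt_or_gt_of_ne (σ.injective.ne hij.ne)
      rw [this, h1]
      omega
    · rw [Finset.disjoint_filter]
      exact fun j _ h h' => h.2.not_gt h'.2
  have hn2 : (2 : ℤ) * ∑ i : Fin n, ((i : ℕ) : ℤ) = n * (n - 1) := two_mul_sum_fin n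
  have hmin := CycNilHecke.two_mul_minDeg n
  have key : ∀ i : Fin n,
      (((Finset.univ.filter fun j : Fin ℓ => μ i < j ∧ (j ∉ Set.range μ ∨
        ∃ h : j ∈ Set.range μ, tableauEquiv μ σ ⟨μ i, Set.mem_range_self i⟩ <
          tableauEquiv μ σ ⟨j, h⟩)).card : ℤ) -
      ((Finset.univ.filter fun j : Fin ℓ => μ i < j ∧
        ∃ h : j ∈ Set.range μ, tableauEquiv μ σ ⟨j, h⟩ <
          tableauEquiv μ σ ⟨μ i, Set.mem_range_self i⟩).card : ℤ)) =
      2 * (Finset.univ.filter fun j => i < j ∧ σ i < σ j).card - (n - 1) + (i : ℕ) := by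
    intro i
    rw [hcard i _ (fun j => σ i < σ j) fun j => by simp [tableauEquiv_apply],
      hcard i _ (fun j => σ j < σ i) fun j => by simp [tableauEquiv_apply]]
    have := hsum i
    zify at this
    linarith
  unfold tabDeg coinversions
  rw [Finset.sum_congr rfl fun i _ => by convert key i]
  simp only [Finset.sum_add_distrib, Finset.sum_sub_distrib, ← Finset.mul_sum, Finset.sum_const,
    Finset.card_univ, Fintype.card_fin, nsmul_eq_mul]
  push_cast
  linarith

theorem sum_tabDeg_minimal {M : Type*} [AddCommMonoid M] (hn : n ≤ ℓ) (f : ℤ → M) :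
    ∑ t : Tableau (minimal ℓ n hn), f (tabDeg (minimal ℓ n hn) t) =
      ∑ a : StairIdx n, f (CycNilHecke.minDeg n + 2 * StairIdx.total n a) := by
  rw [← Equiv.sum_comp (tableauEquiv _)]
  simp only [tabDeg_minimal]
  exact sum_coinversions n fun k => f (CycNilHecke.minDeg n + 2 * k)

/-- The later components need distinct positions to the right, all within `ℓ`; the induction runs
from the last index downwards. -/
theorem le_minimal (hn : n ≤ ℓ) (μ : MultiPart ℓ n) (i : Fin n) : μ i ≤ minimal ℓ n hn i := by
  change (μ i : ℕ) ≤ ℓ - n + i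
  have key : ∀ k : ℕ, ∀ i : Fin n, (i : ℕ) + k + 1 = n → (μ i : ℕ) + k + 1 ≤ ℓ := by
    intro k
    induction k with
    | zero => intro i _; have := (μ i).2; omega
    | succ k ih =>
      intro i hi
      have h1 := ih ⟨i + 1, by omega⟩ (by simp only; omega)
      have h2 : (μ i : ℕ) < μ ⟨i + 1, by omega⟩ := μ.strictMono (Fin.lt_def.2 (Nat.lt_succ_self _))
      omega
  have := key (n - 1 - i) i (by omega)
  omega

theorem sumK_le_minimal (hn : n ≤ ℓ) (μ : MultiPart ℓ n) : μ.sumK ≤ (minimal ℓ n hn).sumK :=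
  Finset.sum_le_sum fun i _ => by
    have : (μ i : ℕ) ≤ minimal ℓ n hn i := le_minimal hn μ i
    omega

theorem eq_minimal_of_sumK (hn : n ≤ ℓ) {μ : MultiPart ℓ n}
    (h : μ.sumK = (minimal ℓ n hn).sumK) : μ = minimal ℓ n hn := by
  have h1 := (Finset.sum_eq_sum_iff_of_le fun i _ => by
    have : (μ i : ℕ) ≤ minimal ℓ n hn i := le_minimal hn μ i
    omega).1 h
  ext i
  have := h1 i (Finset.mem_univ i)
  omega

end MultiPart

/-! ### Positivity of the exponents and the main theorem. -/

theorem LaurentPolynomial.exists_T_eq_toLaurent {d : ℤ} (hd : 0 < d) :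
    ∃ f : Polynomial ℕ, (LaurentPolynomial.T d : ℕ[T;T⁻¹]) =
      Polynomial.toLaurent (Polynomial.X * f) := by
  obtain ⟨k, rfl⟩ : ∃ k : ℕ, d = ((k + 1 : ℕ) : ℤ) := ⟨(d - 1).toNat, by omega⟩
  exact ⟨Polynomial.X ^ k, by rw [← pow_succ', Polynomial.toLaurent_X_pow]⟩

namespace CycNilHecke

variable {K : Type u} [Field K] {ℓ n : ℕ}

theorem specht_mult_exponent (hn : n ≤ ℓ) (μ : MultiPart ℓ n) :
    (n : ℤ) * ℓ - n * (n - 1) / 2 - μ.sumK = (MultiPart.minimal ℓ n hn).sumK - μ.sumK := by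
  have h1 := sumK_minimal hn
  have h2 := two_mul_minDeg n
  have h3 : minDeg n = -((n : ℤ) * (n - 1) / 2) := rfl
  linarith

theorem cartan_exponent (hn : n ≤ ℓ) (μ : MultiPart ℓ n) :
    (2 : ℤ) * n * ℓ - n * (n - 1) - 2 * μ.sumK =
      2 * ((MultiPart.minimal ℓ n hn).sumK - μ.sumK) := by
  have h1 := sumK_minimal hn
  linarith

theorem sumK_lt_minimal (hn : n ≤ ℓ) {μ : MultiPart ℓ n} (h : μ ≠ MultiPart.minimal ℓ n hn) :
    0 < (MultiPart.minimal ℓ n hn).sumK - μ.sumK :=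
  sub_pos.2 ((MultiPart.sumK_le_minimal hn μ).lt_of_ne fun h' =>
    h (MultiPart.eq_minimal_of_sumK hn h'))

end CycNilHecke

open CycNilHecke MultiPart in
open Classical in
theorem mainTheorem11 (K : Type u) [Field K] (ℓ n : ℕ) (hn : n ≤ ℓ) :
    -- the graded dimension of `D₀`
    (Module.Finite K (D₀ K ℓ n hn).carrier ∧
      (D₀ K ℓ n hn).grDim =
        ∑ t : Tableau (minimal ℓ n hn), LaurentPolynomial.T (tabDeg (minimal ℓ n hn) t)) ∧
    -- a graded projective cover of `D₀` exists
    (∃ P : GrMod.{u, u, u} (grading K ℓ n), P.IsProjCover (D₀ K ℓ n hn)) ∧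
    -- its graded dimension, and the graded Cartan number
    (∀ P : GrMod.{u, u, v} (grading K ℓ n), P.IsProjCover (D₀ K ℓ n hn) →
      Module.Finite K P.carrier ∧
      P.grDim = ∑ k : MultiPart ℓ n, ∑ t : Tableau (minimal ℓ n hn),
        LaurentPolynomial.T (tabDeg (minimal ℓ n hn) t + 2 * n * ℓ - n * (n - 1) - 2 * k.sumK) ∧
      P.HasGrMult (D₀ K ℓ n hn) (∑ k : MultiPart ℓ n,
        LaurentPolynomial.T (2 * n * ℓ - n * (n - 1) - 2 * k.sumK))) ∧
    (∃ f : Polynomial ℕ, (∑ k : MultiPart ℓ n,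
        LaurentPolynomial.T (2 * n * ℓ - n * (n - 1) - 2 * k.sumK) : ℕ[T;T⁻¹]) =
      1 + Polynomial.toLaurent (Polynomial.X * f)) ∧
    -- the graded decomposition numbers
    (∀ μ : MultiPart ℓ n,
      (specht K μ).HasGrMult (D₀ K ℓ n hn)
        (LaurentPolynomial.T (n * ℓ - n * (n - 1) / 2 - μ.sumK)) ∧
      ∃ f : Polynomial ℕ,
        (LaurentPolynomial.T (n * ℓ - n * (n - 1) / 2 - μ.sumK) : ℕ[T;T⁻¹]) =
          (if μ = minimal ℓ n hn then 1 else 0) + Polynomial.toLaurent (Polynomial.X * f)) := by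
  refine ⟨⟨D₀_finite hn, ?_⟩, GrMod.exists_isProjCover (cornerData K ℓ n) (D₀_isType hn),
    fun P hP => ?_, ?_, fun μ => ⟨?_, ?_⟩⟩
  · rw [D₀_grDim, sum_tabDeg_minimal hn fun d => (LaurentPolynomial.T d : ℕ[T;T⁻¹])]
  · obtain ⟨h1, h2, h3⟩ := isProjCover_D₀ hn hP
    refine ⟨h1, ?_, ?_⟩
    · rw [h2, Fintype.sum_prod_type]
      refine Finset.sum_congr rfl fun k _ => ?_
      rw [sum_tabDeg_minimal hn fun d =>
        (LaurentPolynomial.T (d + 2 * n * ℓ - n * (n - 1) - 2 * k.sumK) : ℕ[T;T⁻¹])]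
      refine Finset.sum_congr rfl fun a _ => ?_
      congr 1
      ring
    · convert h3 using 3 with k
      rw [show (2 : ℤ) * n * ℓ - n * (n - 1) - 2 * k.sumK =
        2 * ((ℓ : ℤ) * n - k.sumK) - n * (n - 1) by ring]
  · have h : ∀ k : MultiPart ℓ n, ∃ f : Polynomial ℕ, k ≠ minimal ℓ n hn →
        (LaurentPolynomial.T (2 * n * ℓ - n * (n - 1) - 2 * k.sumK) : ℕ[T;T⁻¹]) =
          Polynomial.toLaurent (Polynomial.X * f) := by
      intro k
      by_cases hk : k = minimal ℓ n hn
      · exact ⟨0, fun h => absurd hk h⟩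
      · obtain ⟨f, hf⟩ := LaurentPolynomial.exists_T_eq_toLaurent
          (d := 2 * n * ℓ - n * (n - 1) - 2 * k.sumK)
          (by have := sumK_lt_minimal hn hk; rw [cartan_exponent hn]; omega)
        exact ⟨f, fun _ => hf⟩
    choose f hf using h
    refine ⟨∑ k ∈ Finset.univ.erase (minimal ℓ n hn), f k, ?_⟩
    rw [← Finset.add_sum_erase _ _ (Finset.mem_univ (minimal ℓ n hn)), Finset.mul_sum, map_sum]
    congr 1
    -- The minimal shape contributes the constant term 1; every other exponent is positive because
    -- its sum of positions is strictly smaller.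
    · rw [cartan_exponent hn, sub_self, mul_zero, LaurentPolynomial.T_zero]
    · exact Finset.sum_congr rfl fun k hk => hf k (Finset.ne_of_mem_erase hk)
  · have := specht_finite (K := K) μ
    convert (specht_isType (K := K) hn μ).hasGrMult (h := cornerData K ℓ n) (D₀_isType hn) using 2
    rw [specht_mult_exponent hn, ← minDeg_eq hn]
    ring
  · rw [specht_mult_exponent hn]
    split_ifs with h
    · exact ⟨0, by rw [h, sub_self, LaurentPolynomial.T_zero, mul_zero, map_zero, add_zero]⟩
    · obtain ⟨f, hf⟩ := LaurentPolynomial.exists_T_eq_toLaurent (sumK_lt_minimal hn h)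
      exact ⟨f, by rw [hf, zero_add]⟩
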